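/- Let $d\ge 1$ be an integer, $n>0$ and $j\ge 0$ real numbers with $\theta:=\frac jn+\frac d{2n}<1$. Notation. The Fourier transform on $\mathbb R^d$ is $\mathcal F\varphi(k)=(2\pi)^{-d/2}\int e^{-ik\cdot x}\varphi(x)\,dx$. $\Phi$ is the Lizorkin space of Schwartz functions $\mathbb R^d\to\mathbb C$ all of whose moments vanish, and $\Phi'$ is its topological dual, into which functions are embedded by $f\mapsto(\varphi\mapsto\int f\varphi)$. For real $s\ge 0$, $D^s=\sqrt{-\Delta}^{\,s}:\Phi'\to\Phi'$ is given by $\mathcal F(D^sf)=|k|^s\mathcal Ff$, i.e. $\langle D^sf,\varphi\rangle=\langle f,\mathcal F^{-1}(|k|^s\mathcal F\varphi)\rangle$ for $\varphi\in\Phi$. Let $H^n=\{f\in L^2(\mathbb R^d,\mathbb C): D^nf\in L^2\}$, and let $C_0$ be the space of continuous functions $\mathbb R^d\to\mathbb C$ vanishing at infinity, with the sup norm $\|\cdot\|_\infty$. For $z>0$, complex $a_\ell,a^*_\ell,b_\ell,b^*_\ell$ and positive $A_\ell,A^*_\ell,B_\ell,B^*_\ell$, the Fox function is $$H\!\left(\left.\begin{matrix}(a_\ell,A_\ell);(a^*_\ell,A^*_\ell)\\(b_\ell,B_\ell);(b^*_\ell,B^*_\ell)\end{matrix}\right|z\right)=\frac1{2\pi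 i}\int_{\Lambda}z^s\,\frac{\prod_\ell\Gamma(1-a_\ell+A_\ell s)\prod_\ell\Gamma(b_\ell-B_\ell s)}{\prod_\ell\Gamma(a^*_\ell-A^*_\ell s)\prod_\ell\Gamma(1-b^*_\ell+B^*_\ell s)}\,ds,$$ where the poles of the $\Gamma(1-a_\ell+A_\ell s)$ and those of the $\Gamma(b_\ell-B_\ell s)$ form disjoint sets, $\sum A_\ell-\sum A^*_\ell+\sum B_\ell-\sum B^*_\ell>0$, and $\Lambda$ is any $C^1$ path $\gamma:\mathbb R\to\mathbb C$ with $\gamma(t)=c+it+O(1/t)$, $\gamma'(t)=i+O(1/t)$ as $t\to\pm\infty$ for some $c\in\mathbb R$, having the first set of poles on its left and the second on its right (the integral converges absolutely and does not depend on $\Lambda$). At $z=0$ the value is the limit for $z\to0^+$. The Meijer function $G$ is the case in which all of $A_\ell,A^*_\ell,B_\ell,B^*_\ell$ are $1$. (i) For every $f\in H^n$ one has $D^jf\in C_0$, and the Sobolev inequality $$\|D^jf\|_{\infty}\le S\,\sqrt{\|f\|_{L^2}^2+\|D^nf\|_{L^2}^2}\qquad(f\in H^n)$$ holds for some $S\ge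 0$; the smallest such $S$ (the sharp constant) is $$S(j,n)=\frac1{2^{d/2}\,\pi^{d/4-1/2}\sqrt{\Gamma(d/2)\,n\,\sin(\pi\theta)}}.$$ The function $k\mapsto|k|^j/(1+|k|^{2n})$ is in $L^1$, and $$f:=\mathcal F^{-1}\Big(\frac{|k|^j}{1+|k|^{2n}}\Big)$$ is a maximizer: $f\in H^n$, $f\ne0$ and $\|D^jf\|_\infty=S(j,n)\sqrt{\|f\|_{L^2}^2+\|D^nf\|_{L^2}^2}$. Moreover $f\in C_0$, and $f(x)=F_{jn}(|x|)$ for all $x\in\mathbb R^d$, where $F_{jn}:[0,\infty)\to\mathbb R$ is the continuous function $$F_{jn}(\rho)=\int_0^\infty\frac{J_{d/2-1}(\rho\xi)}{(\rho\xi)^{d/2-1}}\,\frac{\xi^{d+j-1}}{1+\xi^{2n}}\,d\xi\quad(\rho>0),\qquad F_{jn}(0)=\frac{\pi}{2^{d/2}\,\Gamma(d/2)\,n\,\sin\!\big(\pi\frac{j+d}{2n}\big)},$$ with $J_{d/2-1}$ the Bessel function of the first kind; the integral converges absolutely. (ii) For all $\rho\in[0,\infty)$, $$F_{jn}(\rho)=\frac1{2^{d/2}n}\,H\!\left(\left.\begin{matrix}\big(1-\frac{j+d}{2n},\frac1n\big);\\(0,1),\big(1-\frac{j+d}{2n},\frac1n\big);\big(1-\frac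 d2,1\big)\end{matrix}\right|\Big(\frac\rho2\Big)^2\right).$$ If $n=N/M$ with positive integers $N,M$, then for all $\rho\in[0,\infty)$, $$F_{jn}(\rho)=\frac{M}{2^{d/2+M-1}\,\pi^{M-1}\,N^{d/2}}\;G\!\left(\left.\begin{matrix}a_1,\dots,a_M;\\b_1,\dots,b_{N+M};\,b^*_1,\dots,b^*_N\end{matrix}\right|\Big(\frac\rho{2N}\Big)^{2N}\right),$$ where $a_\ell=1-\frac{j+d}{2N}-\frac{\ell-1}M$ for $\ell=1,\dots,M$; $b_h=\frac{h-1}N$ for $h=1,\dots,N$ and $b_{N+h}=-\frac{j+d}{2N}+\frac hM$ for $h=1,\dots,M$; $b^*_\ell=1-\frac d{2N}-\frac{\ell-1}N$ for $\ell=1,\dots,N$. -/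

import Mathlib

open MeasureTheory Filter Topology Set
open scoped SchwartzMap ENNReal ZeroAtInfty

noncomputable section

/-! ## Lizorkin distributions and the fractional Laplacian -/

/-- The Euclidean space `ℝ^d`. -/
abbrev RSpace (d : ℕ) : Type := EuclideanSpace ℝ (Fin d)

/-- A monomial times a Schwartz function is integrable. -/
theorem integrable_monomial_mul_schwartz {d : ℕ} (φ : 𝓢(RSpace d, ℂ)) (m : ℕ)
    (i : Fin m → Fin d) :
    Integrable (fun x : RSpace d => (∏ l, ((x (i l) : ℝ) : ℂ)) * φ x) := by
  refine (φ.integrable_pow_mul volume m).mono' ?_ (Eventually.of_forall fun x => ?_)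
  · refine Continuous.aestronglyMeasurable ?_
    refine Continuous.mul ?_ φ.continuous
    fun_prop
  · rw [norm_mul, norm_prod]
    refine mul_le_mul_of_nonneg_right ?_ (norm_nonneg _)
    calc ∏ l, ‖((x (i l) : ℝ) : ℂ)‖ ≤ ∏ _l : Fin m, ‖x‖ := by
          refine Finset.prod_le_prod (fun _ _ => norm_nonneg _) fun l _ => ?_
          rw [Complex.norm_real]
          exact PiLp.norm_apply_le x (i l)
      _ = ‖x‖ ^ m := by simp

/-- The Lizorkin space `Φ(ℝ^d, ℂ)`: the Schwartz functions all of whose moments vanish, a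
subspace of the Schwartz space with the induced topology. -/
def LizorkinSpace (d : ℕ) : Submodule ℂ 𝓢(RSpace d, ℂ) where
  carrier := {φ | ∀ (m : ℕ) (i : Fin m → Fin d),
    ∫ x : RSpace d, (∏ l, ((x (i l) : ℝ) : ℂ)) * φ x = 0}
  zero_mem' := by
    intro m i
    simp
  add_mem' := by
    intro φ χ hφ hχ m i
    have h := integral_add (integrable_monomial_mul_schwartz φ m i)
      (integrable_monomial_mul_schwartz χ m i)
    rw [hφ m i, hχ m i, add_zero] at h
    rw [← h]
    refine integral_congr_ae (Eventually.of_forall fun x => ?_)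
    exact mul_add _ (φ x) (χ x)
  smul_mem' := by
    intro c φ hφ m i
    have h := integral_const_mul (μ := volume) c (fun x : RSpace d => (∏ l, ((x (i l) : ℝ) : ℂ)) * φ x)
    rw [hφ m i, mul_zero] at h
    rw [← h]
    refine integral_congr_ae (Eventually.of_forall fun x => ?_)
    exact mul_left_comm _ c (φ x)

/-- The Lizorkin distributions `Φ'(ℝ^d)`: continuous linear forms on the Lizorkin space. -/
abbrev LizorkinDistribution (d : ℕ) : Type := LizorkinSpace d →L[ℂ] ℂ

/-- A tempered distribution seen as a Lizorkin distribution, by restriction. -/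
def TemperedDistribution.toLizorkin {d : ℕ} (u : 𝓢'(RSpace d, ℂ)) : LizorkinDistribution d where
  toFun φ := u (φ : 𝓢(RSpace d, ℂ))
  map_add' φ χ := by simp
  map_smul' c φ := by simp
  cont := (ContinuousLinearMap.continuous u).comp continuous_subtype_val

/-- The embedding `L^2 → Φ'`, `f ↦ (φ ↦ ∫ f φ)`. -/
def L2toLizorkin {d : ℕ} (f : Lp ℂ 2 (volume : Measure (RSpace d))) : LizorkinDistribution d :=
  TemperedDistribution.toLizorkin (Lp.toTemperedDistribution f)

/-- A continuous function vanishing at infinity is in `L^∞`. -/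
theorem memLp_top_zeroAtInfty {d : ℕ} (g : C₀(RSpace d, ℂ)) :
    MemLp (g : RSpace d → ℂ) ∞ (volume : Measure (RSpace d)) :=
  memLp_top_of_bound (map_continuous g).aestronglyMeasurable ‖g‖
    (Eventually.of_forall fun x => g.toBCF.norm_coe_le_norm x)

/-- The embedding `C₀ → Φ'`, `g ↦ (φ ↦ ∫ g φ)`. -/
def C0toLizorkin {d : ℕ} (g : C₀(RSpace d, ℂ)) : LizorkinDistribution d :=
  TemperedDistribution.toLizorkin (Lp.toTemperedDistribution (memLp_top_zeroAtInfty g).toLp)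

theorem L2toLizorkin_apply {d : ℕ} (f : Lp ℂ 2 (volume : Measure (RSpace d)))
    (φ : LizorkinSpace d) :
    L2toLizorkin f φ = ∫ x, (φ : 𝓢(RSpace d, ℂ)) x * f x :=
  Lp.toTemperedDistribution_apply f (φ : 𝓢(RSpace d, ℂ))

theorem C0toLizorkin_apply {d : ℕ} (g : C₀(RSpace d, ℂ)) (φ : LizorkinSpace d) :
    C0toLizorkin g φ = ∫ x, (φ : 𝓢(RSpace d, ℂ)) x * g x := by
  refine (Lp.toTemperedDistribution_apply _ (φ : 𝓢(RSpace d, ℂ))).trans ?_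
  refine integral_congr_ae ?_
  filter_upwards [(memLp_top_zeroAtInfty g).coeFn_toLp] with x hx
  rw [hx, smul_eq_mul]

/-- The Fourier transform `(2π)^(-d/2) ∫ e^(-i k•x) φ(x) dx` of an integrable function. -/
def unitaryFourier {d : ℕ} (φ : RSpace d → ℂ) (k : RSpace d) : ℂ :=
  (((2 * Real.pi) ^ (-(d : ℝ) / 2) : ℝ) : ℂ) *
    ∫ x : RSpace d, Complex.exp (-(Complex.I * ((inner ℝ k x : ℝ) : ℂ))) * φ x

/-- The inverse Fourier transform `(2π)^(-d/2) ∫ e^(i k•x) g(k) dk` of an integrable function. -/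
def unitaryFourierInv {d : ℕ} (g : RSpace d → ℂ) (x : RSpace d) : ℂ :=
  (((2 * Real.pi) ^ (-(d : ℝ) / 2) : ℝ) : ℂ) *
    ∫ k : RSpace d, Complex.exp (Complex.I * ((inner ℝ k x : ℝ) : ℂ)) * g k

/-- `v = D^s u` in `Φ'`, where `D^s = (-Δ)^(s/2)`. On the Lizorkin space, `D^s` is the bijection
`φ ↦ χ` given by `F χ = |k|^s F φ`; on `Φ'` it acts by duality, `⟨D^s u, φ⟩ = ⟨u, D^s φ⟩`, which is
the same as `F (D^s u) = |k|^s F u` since the weight `|k|^s` is even. As each `φ` has exactly one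
such `χ`, the relation determines `v` from `u`. -/
def IsFracLaplacian {d : ℕ} (s : ℝ) (u v : LizorkinDistribution d) : Prop :=
  ∀ φ χ : LizorkinSpace d,
    (∀ k : RSpace d, unitaryFourier (χ : 𝓢(RSpace d, ℂ)) k =
      ((‖k‖ ^ s : ℝ) : ℂ) * unitaryFourier (φ : 𝓢(RSpace d, ℂ)) k) →
    v φ = u χ

/-- The Sobolev inequality with constant `S`: for every `f` in
`H^n = {f ∈ L^2 | D^n f ∈ L^2}` (`h` is `D^n f`), `D^j f` is a function `g` in `C₀`, and
`‖D^j f‖_∞ ≤ S √(‖f‖₂² + ‖D^n f‖₂²)`. The norm of `C₀` is the sup norm. -/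
def SobolevInequality (d : ℕ) (j n S : ℝ) : Prop :=
  ∀ f h : Lp ℂ 2 (volume : Measure (RSpace d)),
    IsFracLaplacian n (L2toLizorkin f) (L2toLizorkin h) →
    ∃ g : C₀(RSpace d, ℂ), IsFracLaplacian j (L2toLizorkin f) (C0toLizorkin g) ∧
      ‖g‖ ≤ S * Real.sqrt (‖f‖ ^ 2 + ‖h‖ ^ 2)

/-- `S` is the sharp constant of the Sobolev inequality: the least nonnegative constant for which
it holds. -/
def IsSharpSobolevConstant (d : ℕ) (j n S : ℝ) : Prop :=
  IsLeast {C : ℝ | 0 ≤ C ∧ SobolevInequality d j n C} S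

/-- `f` is a nonzero element of `H^n` for which the Sobolev inequality with constant `S` is an
equality. -/
def IsSobolevMaximizer (d : ℕ) (j n S : ℝ) (f : Lp ℂ 2 (volume : Measure (RSpace d))) : Prop :=
  f ≠ 0 ∧
  ∃ h : Lp ℂ 2 (volume : Measure (RSpace d)),
    IsFracLaplacian n (L2toLizorkin f) (L2toLizorkin h) ∧
  ∃ g : C₀(RSpace d, ℂ), IsFracLaplacian j (L2toLizorkin f) (C0toLizorkin g) ∧
    ‖g‖ = S * Real.sqrt (‖f‖ ^ 2 + ‖h‖ ^ 2)

/-! ## The sharp constant, the maximizer and its radial profile -/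

/-- `1 / (2^(d/2) π^(d/4-1/2) √(Γ(d/2) n sin(π θ)))` with `θ = j/n + d/(2n)`. -/
def sharpSobolevValue (d : ℕ) (j n : ℝ) : ℝ :=
  1 / ((2 : ℝ) ^ ((d : ℝ) / 2) * Real.pi ^ ((d : ℝ) / 4 - 1 / 2) *
    Real.sqrt (Real.Gamma ((d : ℝ) / 2) * n * Real.sin (Real.pi * (j / n + d / (2 * n)))))

/-- The function `k ↦ |k|^j / (1 + |k|^(2n))` on `ℝ^d`. -/
def maximizerSymbol (d : ℕ) (j n : ℝ) (k : RSpace d) : ℂ :=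
  ((‖k‖ ^ j / (1 + ‖k‖ ^ (2 * n)) : ℝ) : ℂ)

/-- `F^{-1}(|k|^j / (1 + |k|^(2n)))`. -/
def maximizerFun (d : ℕ) (j n : ℝ) : RSpace d → ℂ :=
  unitaryFourierInv (maximizerSymbol d j n)

/-- The Bessel function of the first kind `J_ν(x)`, for `x > 0`. -/
def besselJ (ν x : ℝ) : ℝ :=
  ∑' m : ℕ, (-1 : ℝ) ^ m / ((m.factorial : ℝ) * Real.Gamma ((m : ℝ) + ν + 1)) *
    (x / 2) ^ (2 * (m : ℝ) + ν)

/-- The integrand of the Bessel representation of the radial profile. -/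
def besselIntegrand (d : ℕ) (j n ρ ξ : ℝ) : ℝ :=
  besselJ ((d : ℝ) / 2 - 1) (ρ * ξ) / (ρ * ξ) ^ ((d : ℝ) / 2 - 1) *
    (ξ ^ ((d : ℝ) + j - 1) / (1 + ξ ^ (2 * n)))

/-- The radial profile `F_{jn}` on `[0, ∞)`. -/
def radialProfile (d : ℕ) (j n ρ : ℝ) : ℝ :=
  if ρ = 0 then
    Real.pi / ((2 : ℝ) ^ ((d : ℝ) / 2) * Real.Gamma ((d : ℝ) / 2) * n *
      Real.sin (Real.pi * ((j + d) / (2 * n))))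
  else ∫ ξ in Ioi (0 : ℝ), besselIntegrand d j n ρ ξ

/-! ## Fox `H`-functions and Meijer `G`-functions -/

/-- `γ` parametrizes a path from `c - i∞` to `c + i∞`: it is `C^1`, with
`γ(t) = c + i t + O(1/t)` and `γ'(t) = i + O(1/t)` for `t → ±∞`. -/
structure IsVerticalPath (γ : ℝ → ℂ) (c : ℝ) : Prop where
  contDiff : ContDiff ℝ 1 γ
  asymp : (fun t : ℝ => γ t - (c + t * Complex.I)) =O[cocompact ℝ] (fun t : ℝ => t⁻¹)
  asymp_deriv : (fun t : ℝ => deriv γ t - Complex.I) =O[cocompact ℝ] (fun t : ℝ => t⁻¹)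

/-- `σ` is on the left of the (upward) path `γ`: `σ` is not on the path, and along the path the
argument of `γ - σ` increases by `π` in total. -/
def LiesLeftOf (σ : ℂ) (γ : ℝ → ℂ) : Prop :=
  σ ∉ range γ ∧
  Tendsto (fun T : ℝ => ∫ t in (-T)..T, deriv γ t / (γ t - σ)) atTop (𝓝 (Real.pi * Complex.I))

/-- `σ` is on the right of the (upward) path `γ`: `σ` is not on the path, and along the path the
argument of `γ - σ` decreases by `π` in total. -/
def LiesRightOf (σ : ℂ) (γ : ℝ → ℂ) : Prop :=
  σ ∉ range γ ∧
  Tendsto (fun T : ℝ => ∫ t in (-T)..T, deriv γ t / (γ t - σ)) atTop (𝓝 (-(Real.pi * Complex.I)))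

/-- The parameters `(a, A); (a*, A*)` (upper line) and `(b, B); (b*, B*)` (lower line) of a Fox
`H`-function. -/
structure FoxParameters (n ns m ms : ℕ) where
  a : Fin n → ℂ
  A : Fin n → ℝ
  as : Fin ns → ℂ
  As : Fin ns → ℝ
  b : Fin m → ℂ
  B : Fin m → ℝ
  bs : Fin ms → ℂ
  Bs : Fin ms → ℝ

namespace FoxParameters

variable {n ns m ms : ℕ}

/-- The quotient of products of Gamma functions in the Mellin-Barnes integral. -/
def kernel (P : FoxParameters n ns m ms) (s : ℂ) : ℂ :=
  ((∏ l, Complex.Gamma (1 - P.a l + P.A l * s)) * ∏ l, Complex.Gamma (P.b l - P.B l * s)) /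
    ((∏ l, Complex.Gamma (P.as l - P.As l * s)) * ∏ l, Complex.Gamma (1 - P.bs l + P.Bs l * s))

/-- The left poles: the poles of the factors `Γ(1 - a + A s)`. -/
def leftPoles (P : FoxParameters n ns m ms) : Set ℂ :=
  {σ | ∃ (l : Fin n) (k : ℕ), σ = (-1 + P.a l - k) / P.A l}

/-- The right poles: the poles of the factors `Γ(b - B s)`. -/
def rightPoles (P : FoxParameters n ns m ms) : Set ℂ :=
  {σ | ∃ (l : Fin m) (k : ℕ), σ = (P.b l + k) / P.B l}

/-- `∑ A - ∑ A* + ∑ B - ∑ B*`. -/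
def alpha (P : FoxParameters n ns m ms) : ℝ :=
  ∑ l, P.A l - ∑ l, P.As l + ∑ l, P.B l - ∑ l, P.Bs l

/-- Conditions on the parameters under which the `H`-function of a positive variable `z` (for
which `arg z = 0`) is defined. -/
structure Admissible (P : FoxParameters n ns m ms) : Prop where
  A_pos : ∀ l, 0 < P.A l
  As_pos : ∀ l, 0 < P.As l
  B_pos : ∀ l, 0 < P.B l
  Bs_pos : ∀ l, 0 < P.Bs l
  disjoint : Disjoint P.leftPoles P.rightPoles
  alpha_pos : 0 < P.alpha

/-- `γ` is an admissible integration path: a path from `c - i∞` to `c + i∞`, for some real `c`,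
with the left poles on its left and the right poles on its right. -/
def IsContour (P : FoxParameters n ns m ms) (γ : ℝ → ℂ) : Prop :=
  (∃ c : ℝ, IsVerticalPath γ c) ∧ (∀ σ ∈ P.leftPoles, LiesLeftOf σ γ) ∧
    ∀ σ ∈ P.rightPoles, LiesRightOf σ γ

/-- For `z > 0`, the Fox `H`-function with parameters `P` is defined at `z` and has the value `w`:
admissible paths exist, and for each of them
`(1 / 2πi) ∫ z^s kernel(s) ds` is (absolutely) convergent and equal to `w`. -/
def HasValuePos (P : FoxParameters n ns m ms) (z : ℝ) (w : ℂ) : Prop :=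
  P.Admissible ∧ (∃ γ, P.IsContour γ) ∧
  ∀ γ, P.IsContour γ →
    Integrable (fun t : ℝ => deriv γ t * ((z : ℂ) ^ γ t * P.kernel (γ t))) ∧
    1 / (2 * Real.pi * Complex.I) *
      ∫ t : ℝ, deriv γ t * ((z : ℂ) ^ γ t * P.kernel (γ t)) = w

/-- For a real variable `z ≥ 0`, the Fox `H`-function with parameters `P` is defined at `z` and has
the value `w`; at `z = 0` this means that `w` is the limit of the values at `z > 0`. -/
def HasFoxH (P : FoxParameters n ns m ms) (z : ℝ) (w : ℂ) : Prop :=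
  (0 < z ∧ P.HasValuePos z w) ∨
  (z = 0 ∧ ∃ H : ℝ → ℂ, (∀ x, 0 < x → P.HasValuePos x (H x)) ∧ Tendsto H (𝓝[>] 0) (𝓝 w))

end FoxParameters

/-- The parameters of a Fox `H`-function which is a Meijer `G`-function: all of `A`, `A*`, `B`, `B*`
are equal to one. -/
def meijerParameters {n ns m ms : ℕ} (a : Fin n → ℂ) (as : Fin ns → ℂ) (b : Fin m → ℂ)
    (bs : Fin ms → ℂ) : FoxParameters n ns m ms where
  a := a
  A := fun _ => 1
  as := as
  As := fun _ => 1
  b := b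
  B := fun _ => 1
  bs := bs
  Bs := fun _ => 1

/-- The Meijer `G`-function with the given parameters is defined at `z ≥ 0`, with value `w`. -/
def HasMeijerG {n ns m ms : ℕ} (a : Fin n → ℂ) (as : Fin ns → ℂ) (b : Fin m → ℂ)
    (bs : Fin ms → ℂ) (z : ℝ) (w : ℂ) : Prop :=
  (meijerParameters a as b bs).HasFoxH z w

/-- The parameters `(1 - (j+d)/(2n), 1/n);` and `(0, 1), (1 - (j+d)/(2n), 1/n); (1 - d/2, 1)`. -/
def profileFoxParameters (d : ℕ) (j n : ℝ) : FoxParameters 1 0 2 1 where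
  a := ![1 - (j + d) / (2 * n)]
  A := ![1 / n]
  as := ![]
  As := ![]
  b := ![0, 1 - (j + d) / (2 * n)]
  B := ![1, 1 / n]
  bs := ![1 - d / 2]
  Bs := ![1]

/-- `a_ℓ = 1 - (j+d)/(2N) - (ℓ-1)/M` for `ℓ = 1, …, M` (here the index starts from zero). -/
def profileMeijerA (d : ℕ) (j : ℝ) (N M : ℕ) : Fin M → ℂ :=
  fun l => 1 - (j + d) / (2 * N) - (l : ℕ) / M

/-- `b_h = (h-1)/N` for `h = 1, …, N`, then `b_{N+h} = -(j+d)/(2N) + h/M` for `h = 1, …, M`. -/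
def profileMeijerB (d : ℕ) (j : ℝ) (N M : ℕ) : Fin (N + M) → ℂ :=
  Fin.append (fun h : Fin N => (((h : ℕ) : ℂ) / N))
    (fun h : Fin M => -((j : ℂ) + d) / (2 * N) + (((h : ℕ) : ℂ) + 1) / M)

/-- `b*_ℓ = 1 - d/(2N) - (ℓ-1)/N` for `ℓ = 1, …, N`. -/
def profileMeijerBs (d N : ℕ) : Fin N → ℂ :=
  fun l => 1 - d / (2 * N) - (l : ℕ) / N

end

/-! ### Fractional Laplacian and Lizorkin test functions on the Fourier side -/

section

open scoped ContDiff FourierTransform LineDeriv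

/-! Sobolev inequality. After the rescaling `k = 2πξ`, `D^s` is multiplication by `fracSymbol s` on
the Fourier side. The supremum of `D^j f` is at most the `L¹` norm of `fracSymbol j · 𝓕 f`.
Cauchy–Schwarz with the weight `1 + fracSymbol n ^ 2`, followed by Plancherel, bounds this norm by
`√I · √(‖f‖² + ‖D^n f‖²)`, where `I` is the integral of `sobolevWeight`. Equality holds when `𝓕 f`
is a multiple of `|k|^j / (1 + |k|^(2n))`: then `D^j f` has a nonnegative transform and attains the
`L¹` bound at the origin. So `√I` is attained, hence sharp; polar coordinates and Euler's integral
`∫ x^(w-1) / (1+x) dx = Γ(w) Γ(1-w)` evaluate it.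

Lizorkin distributions are tested here only away from the origin of Fourier space. For `L²`
functions this loses nothing, the origin being a null set (`fourier_eq_of_isFracLaplacian`). For
`C₀` functions a dilation argument shows that nothing is lost either
(`C0_eq_zero_of_integral_fourier_mul`). The latter gives uniqueness of `D^j f` in `C₀`, without
which the maximizer would say nothing about a competing constant.

Bessel formula. Polar coordinates reduce it to the Fourier transform of the surface measure of the
sphere (`sphereExp_eq_besselJ`), whose Taylor coefficients are spherical moments, read off from
Gaussian integrals.

Fox function. The Mellin–Barnes formula is verified by testing against Gaussians. Against `r^(d-1)
exp(-μr²/2)` the profile gives `μ^(-d/2) ∫ r^(j+d-1) / (1+r^(2n)) · exp(-r²/(2μ)) dr`, by Fourier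
duality. On a line `Re s = c` with `-d/2 < c < 0`, the Gaussian integral of `r^(2s)` produces
`Γ(d/2+s)`, which cancels the denominator of `profileKernel`. The remaining `Γ(-s)` and
`Γ(w)Γ(1-w)`, `w = (j+d)/(2n) + s/n`, come from the Cahen–Mellin and Euler integrals, and undoing
these gives the same expression. The Gaussians with `μ = 1, 2, …` separate continuous functions, by
Weierstrass approximation (`eq_zero_of_integral_exp_pow_smul`).

The definition of the Fox function quantifies over all admissible paths. `integral_eq_of_sameSide`
passes from any path to a vertical line: a strip contains finitely many poles, their principal parts
are subtracted one pole at a time, and what is left has a primitive in the strip. The decay needed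
for this comes from the reflection formula and from comparing values of `Γ` at equal height through
the Beta integral.

Meijer function. Gauss's multiplication formula and the product formula for sines identify its
kernel at `s` with the profile kernel at `N s`, up to an explicit factor. Values at `z = 0` follow
from continuity of the profile. -/

/-- The weight `(2π|ξ|)^s`, the symbol of `D^s` for the Fourier transform `∫ e^(-2πi x•ξ) φ(x) dx`. -/
noncomputable def fracSymbol {d : ℕ} (s : ℝ) (ξ : RSpace d) : ℝ := (2 * Real.pi * ‖ξ‖) ^ s

theorem fracSymbol_nonneg {d : ℕ} (s : ℝ) (ξ : RSpace d) : 0 ≤ fracSymbol s ξ :=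
  Real.rpow_nonneg (by positivity) _

theorem fracSymbol_neg {d : ℕ} (s : ℝ) (ξ : RSpace d) : fracSymbol s (-ξ) = fracSymbol s ξ := by
  simp [fracSymbol]

theorem continuous_fracSymbol {d : ℕ} {s : ℝ} (hs : 0 ≤ s) :
    Continuous (fracSymbol s : RSpace d → ℝ) := by
  unfold fracSymbol
  exact Continuous.rpow_const (by fun_prop) fun _ => Or.inr hs

theorem contDiffAt_fracSymbol {d : ℕ} (s : ℝ) {ξ : RSpace d} (hξ : ξ ≠ 0) :
    ContDiffAt ℝ ∞ (fracSymbol s : RSpace d → ℝ) ξ := by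
  unfold fracSymbol
  refine ContDiffAt.rpow_const_of_ne ?_ (by have := norm_pos_iff.2 hξ; positivity)
  exact contDiffAt_const.mul (contDiffAt_norm ℝ hξ)

theorem unitaryFourier_eq_fourier {d : ℕ} (φ : RSpace d → ℂ) (k : RSpace d) :
    unitaryFourier φ k =
      (((2 * Real.pi) ^ (-(d : ℝ) / 2) : ℝ) : ℂ) * 𝓕 φ ((2 * Real.pi)⁻¹ • k) := by
  unfold unitaryFourier
  rw [Real.fourier_eq']
  congr 1
  refine integral_congr_ae (Eventually.of_forall fun x => ?_)
  simp only [smul_eq_mul]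
  congr 2
  rw [inner_smul_right, real_inner_comm]
  have : (Real.pi : ℂ) ≠ 0 := by exact_mod_cast Real.pi_ne_zero
  push_cast
  field_simp

theorem unitaryFourierInv_eq_fourierInv {d : ℕ} (g : RSpace d → ℂ) (x : RSpace d) :
    unitaryFourierInv g x =
      (((2 * Real.pi) ^ ((d : ℝ) / 2) : ℝ) : ℂ) * 𝓕⁻ (fun ξ => g ((2 * Real.pi) • ξ)) x := by
  unfold unitaryFourierInv
  rw [Real.fourierInv_eq']
  have h2 : (0 : ℝ) < 2 * Real.pi := by positivity
  have h := Measure.integral_comp_smul (volume : Measure (RSpace d))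
    (fun k => Complex.exp (Complex.I * ((inner ℝ k x : ℝ) : ℂ)) * g k) (2 * Real.pi)
  have h' : ∫ v : RSpace d, Complex.exp (((2 * Real.pi * inner ℝ v x : ℝ) : ℂ) * Complex.I) •
      g ((2 * Real.pi) • v) = ∫ v : RSpace d, Complex.exp (Complex.I *
        ((inner ℝ ((2 * Real.pi) • v) x : ℝ) : ℂ)) * g ((2 * Real.pi) • v) := by
    refine integral_congr_ae (Eventually.of_forall fun v => ?_)
    simp only [smul_eq_mul, inner_smul_left, mul_comm Complex.I]
    simp
  rw [h', h, Complex.real_smul, ← mul_assoc]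
  congr 1
  rw [← Complex.ofReal_mul]
  congr 1
  rw [abs_of_pos (by positivity), finrank_euclideanSpace_fin, ← Real.rpow_natCast,
    ← Real.rpow_neg h2.le, ← Real.rpow_add h2]
  congr 1
  ring

/-- The prefactor `(2π)^(-d/2)` is common to both sides, and `k = 2πξ` turns `‖k‖^s` into
`fracSymbol s ξ`. This moves the definition of `D^s` to the normalization of `𝓕`. -/
theorem unitaryFourier_eq_mul_iff {d : ℕ} (s : ℝ) (φ χ : RSpace d → ℂ) :
    (∀ k : RSpace d, unitaryFourier χ k = ((‖k‖ ^ s : ℝ) : ℂ) * unitaryFourier φ k) ↔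
      ∀ ξ : RSpace d, 𝓕 χ ξ = (fracSymbol s ξ : ℂ) * 𝓕 φ ξ := by
  have h2 : (0 : ℝ) < 2 * Real.pi := by positivity
  have hc : (((2 * Real.pi) ^ (-(d : ℝ) / 2) : ℝ) : ℂ) ≠ 0 := by
    exact_mod_cast (Real.rpow_pos_of_pos h2 _).ne'
  simp only [unitaryFourier_eq_fourier]
  constructor
  · intro h ξ
    have := h ((2 * Real.pi) • ξ)
    rw [inv_smul_smul₀ h2.ne', norm_smul, Real.norm_of_nonneg h2.le, mul_left_comm] at this
    exact mul_left_cancel₀ hc this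
  · intro h k
    have hk : fracSymbol s ((2 * Real.pi)⁻¹ • k) = ‖k‖ ^ s := by
      rw [fracSymbol, norm_smul, norm_inv, Real.norm_of_nonneg h2.le, mul_inv_cancel_left₀ h2.ne']
    rw [h, hk]
    ring

/-- The Fourier transform of a Schwartz function that vanishes near `0`, times a monomial, is again
the Fourier transform of such a function. -/
theorem exists_monomial_mul_fourier {d : ℕ} (ψ : 𝓢(RSpace d, ℂ)) (hψ : ∀ᶠ ξ in 𝓝 0, ψ ξ = 0)
    (m : ℕ) (i : Fin m → Fin d) :
    ∃ ψ' : 𝓢(RSpace d, ℂ), (∀ᶠ ξ in 𝓝 0, ψ' ξ = 0) ∧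
      ∀ x : RSpace d, (∏ l, ((x (i l) : ℝ) : ℂ)) * 𝓕 ψ x = 𝓕 ψ' x := by
  induction m with
  | zero => exact ⟨ψ, hψ, fun x => by simp⟩
  | succ m ih =>
    obtain ⟨ψ', h0, h1⟩ := ih (fun l => i l.succ)
    set e : RSpace d := EuclideanSpace.single (i 0) 1
    have hI : (2 * Real.pi * Complex.I : ℂ) ≠ 0 := by
      simp [Real.pi_ne_zero, Complex.I_ne_zero]
    -- The derivative along `e` becomes multiplication by `2πi x (i 0)` under `𝓕`, whence the
    -- scalar; it still vanishes near the origin.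
    refine ⟨(2 * Real.pi * Complex.I : ℂ)⁻¹ • ∂_{e} ψ', ?_, fun x => ?_⟩
    · filter_upwards [h0.eventually_nhds] with ξ hξ
      have : (ψ' : RSpace d → ℂ) =ᶠ[𝓝 ξ] fun _ => 0 := hξ
      simp [SchwartzMap.lineDerivOp_apply_eq_fderiv, this.fderiv_eq]
    · rw [Fin.prod_univ_succ, mul_assoc, h1, FourierTransform.fourier_smul,
        SchwartzMap.fourier_lineDerivOp_eq, inv_smul_smul₀ hI]
      have : (inner ℝ · e : RSpace d → ℝ).HasTemperateGrowth :=
        ((innerSL ℝ).flip e).hasTemperateGrowth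
      rw [SchwartzMap.smulLeftCLM_apply_apply this]
      simp [e, EuclideanSpace.inner_single_right]

/-- The Fourier transform of a Schwartz function that vanishes near `0` is in the Lizorkin space. -/
theorem fourier_mem_lizorkinSpace {d : ℕ} (ψ : 𝓢(RSpace d, ℂ)) (hψ : ∀ᶠ ξ in 𝓝 0, ψ ξ = 0) :
    𝓕 ψ ∈ LizorkinSpace d := by
  intro m i
  obtain ⟨ψ', h0, h1⟩ := exists_monomial_mul_fourier ψ hψ m i
  simp_rw [h1]
  -- The moment is the integral of `𝓕 ψ'`, that is, its inverse transform at the origin, `ψ' 0 = 0`.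
  have h2 : 𝓕⁻ (𝓕 ψ' : 𝓢(RSpace d, ℂ)) 0 = ∫ x, 𝓕 ψ' x := by
    rw [SchwartzMap.fourierInv_coe, Real.fourierInv_eq']
    simp
  rw [← h2, FourierTransform.fourierInv_fourier_eq]
  exact h0.self_of_nhds

end

/-! ### `D^s` on `L²` and inverse Fourier transforms in `C₀` -/

section

open scoped ContDiff FourierTransform LineDeriv

theorem integral_schwartz_mul_fourier_Lp {d : ℕ} (f : Lp ℂ 2 (volume : Measure (RSpace d)))
    (ψ : 𝓢(RSpace d, ℂ)) :
    ∫ x, ψ x * (𝓕 f : Lp ℂ 2 (volume : Measure (RSpace d))) x = ∫ x, 𝓕 ψ x * f x := by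
  have h := congrArg (fun u : 𝓢'(RSpace d, ℂ) => u ψ) (Lp.fourier_toTemperedDistribution_eq f)
  simp only [TemperedDistribution.fourier_apply, Lp.toTemperedDistribution_apply] at h
  exact h.symm

theorem integral_fourierInv_schwartz_mul_fourier_Lp {d : ℕ}
    (f : Lp ℂ 2 (volume : Measure (RSpace d))) (φ : 𝓢(RSpace d, ℂ)) :
    ∫ x, 𝓕⁻ φ x * (𝓕 f : Lp ℂ 2 (volume : Measure (RSpace d))) x = ∫ x, φ x * f x := by
  rw [integral_schwartz_mul_fourier_Lp, FourierTransform.fourier_fourierInv_eq]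

theorem SchwartzMap.fourierInv_apply_eq_fourier_neg {d : ℕ} (φ : 𝓢(RSpace d, ℂ)) (ξ : RSpace d) :
    𝓕⁻ φ ξ = 𝓕 φ (-ξ) := by
  rw [SchwartzMap.fourierInv_coe, Real.fourierInv_eq_fourier_neg, SchwartzMap.fourier_coe]

/-- Both pairings are moved to the Fourier side by `∫ φ f = ∫ 𝓕⁻ φ · 𝓕 f`. The reflection in `𝓕⁻` is
harmless because the symbol is even, which makes `D^s` its own transpose for the bilinear pairing.
-/
theorem isFracLaplacian_of_fourier {d : ℕ} {s : ℝ} {f h : Lp ℂ 2 (volume : Measure (RSpace d))}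
    (hfh : ∀ᵐ ξ, (𝓕 h : Lp ℂ 2 (volume : Measure (RSpace d))) ξ =
      (fracSymbol s ξ : ℂ) * (𝓕 f : Lp ℂ 2 (volume : Measure (RSpace d))) ξ) :
    IsFracLaplacian s (L2toLizorkin f) (L2toLizorkin h) := by
  intro φ χ hφχ
  rw [unitaryFourier_eq_mul_iff] at hφχ
  rw [L2toLizorkin_apply, L2toLizorkin_apply, ← integral_fourierInv_schwartz_mul_fourier_Lp h,
    ← integral_fourierInv_schwartz_mul_fourier_Lp f]
  refine integral_congr_ae ?_
  filter_upwards [hfh] with ξ hξ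
  rw [hξ, SchwartzMap.fourierInv_apply_eq_fourier_neg, SchwartzMap.fourierInv_apply_eq_fourier_neg,
    SchwartzMap.fourier_coe (χ : 𝓢(RSpace d, ℂ)), hφχ, fracSymbol_neg, SchwartzMap.fourier_coe]
  ring

/-- Test functions supported away from the origin, together with their product with `fracSymbol s`. -/
theorem exists_schwartz_fracSymbol {d : ℕ} (s : ℝ) (g : RSpace d → ℂ) (hg : ContDiff ℝ ∞ g)
    (hc : HasCompactSupport g) (h0 : (0 : RSpace d) ∉ tsupport g) :
    ∃ ψ χ : 𝓢(RSpace d, ℂ), (∀ ξ, ψ ξ = g ξ) ∧ (∀ ξ, χ ξ = (fracSymbol s ξ : ℂ) * g ξ) ∧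
      (∀ᶠ ξ in 𝓝 0, ψ ξ = 0) ∧ (∀ᶠ ξ in 𝓝 0, χ ξ = 0) := by
  have hz : ∀ᶠ ξ in 𝓝 (0 : RSpace d), g ξ = 0 := notMem_tsupport_iff_eventuallyEq.1 h0
  have hz' : ∀ᶠ ξ in 𝓝 (0 : RSpace d), (fracSymbol s ξ : ℂ) * g ξ = 0 := by
    filter_upwards [hz] with ξ hξ using by rw [hξ, mul_zero]
  have hd : ContDiff ℝ ∞ (fun ξ => (fracSymbol s ξ : ℂ) * g ξ) := by
    rw [contDiff_iff_contDiffAt]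
    intro ξ
    by_cases hξ : ξ = 0
    · subst hξ
      exact contDiffAt_const.congr_of_eventuallyEq hz'
    · exact (Complex.ofRealCLM.contDiff.contDiffAt.comp ξ (contDiffAt_fracSymbol s hξ)).mul
        hg.contDiffAt
  have hcc : HasCompactSupport (fun ξ => (fracSymbol s ξ : ℂ) * g ξ) := hc.mul_left
  exact ⟨hc.toSchwartzMap hg, hcc.toSchwartzMap hd, fun _ => rfl, fun _ => rfl, hz, hz'⟩

/-- Testing the relation `v = D^s u` with the Fourier transform of a function supported away from
the origin. -/
theorem IsFracLaplacian.exists_test {d : ℕ} {s : ℝ} {u v : LizorkinDistribution d}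
    (huv : IsFracLaplacian s u v) (g : RSpace d → ℂ) (hg : ContDiff ℝ ∞ g)
    (hc : HasCompactSupport g) (h0 : (0 : RSpace d) ∉ tsupport g) :
    ∃ (ψ χ : 𝓢(RSpace d, ℂ)) (hψ : 𝓕 ψ ∈ LizorkinSpace d) (hχ : 𝓕 χ ∈ LizorkinSpace d),
      (∀ ξ, ψ ξ = g ξ) ∧ (∀ ξ, χ ξ = (fracSymbol s ξ : ℂ) * g ξ) ∧ v ⟨𝓕 ψ, hψ⟩ = u ⟨𝓕 χ, hχ⟩ := by
  obtain ⟨ψ, χ, h1, h2, h3, h4⟩ := exists_schwartz_fracSymbol s g hg hc h0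
  refine ⟨ψ, χ, fourier_mem_lizorkinSpace ψ h3, fourier_mem_lizorkinSpace χ h4, h1, h2, ?_⟩
  refine huv _ _ ?_
  rw [unitaryFourier_eq_mul_iff]
  intro ξ
  -- Two forward transforms amount to a reflection, so the symbol appears at `-ξ`; it is even.
  have key : ∀ η : 𝓢(RSpace d, ℂ), 𝓕 (⇑(𝓕 η : 𝓢(RSpace d, ℂ))) ξ = η (-ξ) := by
    intro η
    have := SchwartzMap.fourierInv_apply_eq_fourier_neg (𝓕 η) (-ξ)
    rw [FourierTransform.fourierInv_fourier_eq, neg_neg] at this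
    rw [this]
    exact (congrFun (SchwartzMap.fourier_coe (𝓕 η)) ξ).symm
  change 𝓕 (⇑(𝓕 χ : 𝓢(RSpace d, ℂ))) ξ = _ * 𝓕 (⇑(𝓕 ψ : 𝓢(RSpace d, ℂ))) ξ
  rw [key, key, h1, h2, fracSymbol_neg]

theorem locallyIntegrable_Lp_two {d : ℕ} (f : Lp ℂ 2 (volume : Measure (RSpace d))) :
    LocallyIntegrable (f : RSpace d → ℂ) :=
  (Lp.memLp f).locallyIntegrable (by norm_num)

/-- Converse of `isFracLaplacian_of_fourier`. Pairing with `𝓕 ψ`, `ψ` supported off the origin,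
determines a locally integrable function on the complement of `0`, and that complement has full
measure since `d ≥ 1`. -/
theorem fourier_eq_of_isFracLaplacian {d : ℕ} (hd : 1 ≤ d) {s : ℝ} (hs : 0 ≤ s)
    {f h : Lp ℂ 2 (volume : Measure (RSpace d))}
    (hfh : IsFracLaplacian s (L2toLizorkin f) (L2toLizorkin h)) :
    ∀ᵐ ξ, (𝓕 h : Lp ℂ 2 (volume : Measure (RSpace d))) ξ =
      (fracSymbol s ξ : ℂ) * (𝓕 f : Lp ℂ 2 (volume : Measure (RSpace d))) ξ := by
  have : Nonempty (Fin d) := ⟨⟨0, hd⟩⟩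
  have hw : Continuous (fun ξ : RSpace d => (fracSymbol s ξ : ℂ)) :=
    Complex.continuous_ofReal.comp (continuous_fracSymbol hs)
  have hloc1 := locallyIntegrable_Lp_two (𝓕 h : Lp ℂ 2 (volume : Measure (RSpace d)))
  have hloc2 : LocallyIntegrable (fun ξ => (fracSymbol s ξ : ℂ) *
      (𝓕 f : Lp ℂ 2 (volume : Measure (RSpace d))) ξ) :=
    (locallyIntegrable_Lp_two (𝓕 f : Lp ℂ 2 (volume : Measure (RSpace d)))).continuous_mul hw
  have hae := IsOpen.ae_eq_zero_of_integral_contDiff_smul_eq_zero (μ := volume)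
    (isOpen_compl_singleton (x := (0 : RSpace d)))
    ((hloc1.sub hloc2).locallyIntegrableOn _) ?_
  · have h0 : ∀ᵐ ξ : RSpace d, ξ ≠ 0 := by
      simp [ae_iff]
    filter_upwards [hae, h0] with ξ h1 h2
    exact sub_eq_zero.1 (h1 h2)
  · intro g hg hc hsub
    have hg' : ContDiff ℝ ∞ (fun ξ => (g ξ : ℂ)) := Complex.ofRealCLM.contDiff.comp hg
    have hc' : HasCompactSupport (fun ξ => (g ξ : ℂ)) := hc.comp_left Complex.ofReal_zero
    have h0' : (0 : RSpace d) ∉ tsupport (fun ξ => (g ξ : ℂ)) := by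
      intro hmem
      have : (0 : RSpace d) ∈ tsupport g := by
        refine closure_mono ?_ hmem
        intro x hx
        simpa using hx
      exact hsub this rfl
    obtain ⟨ψ, χ, hψ, hχ, e1, e2, e3⟩ := hfh.exists_test _ hg' hc' h0'
    rw [L2toLizorkin_apply, L2toLizorkin_apply] at e3
    simp only [← integral_schwartz_mul_fourier_Lp, e1, e2] at e3
    have i1 : Integrable (fun ξ => g ξ • (𝓕 h : Lp ℂ 2 (volume : Measure (RSpace d))) ξ) :=
      hloc1.integrable_smul_left_of_hasCompactSupport hg.continuous hc
    have i2 := hloc2.integrable_smul_left_of_hasCompactSupport hg.continuous hc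
    simp only [Pi.sub_apply, smul_sub]
    rw [integral_sub i1 i2, sub_eq_zero]
    simp only [Complex.real_smul]
    rw [e3]
    refine integral_congr_ae (Eventually.of_forall fun ξ => ?_)
    simp only
    ring

/-- The inverse Fourier transform of an integrable function, as an element of `C₀`. -/
noncomputable def fourierInvC0 {d : ℕ} (G : RSpace d → ℂ) (hG : Integrable G) :
    C₀(RSpace d, ℂ) where
  toFun := 𝓕⁻ G
  continuous_toFun := by
    have : (𝓕⁻ G : RSpace d → ℂ) = fun x => 𝓕 G (-x) :=
      funext fun x => Real.fourierInv_eq_fourier_neg G x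
    rw [this]
    exact (VectorFourier.fourierIntegral_continuous Real.continuous_fourierChar
      (innerSL ℝ).continuous₂ hG).comp continuous_neg
  zero_at_infty' := by
    have : (𝓕⁻ G : RSpace d → ℂ) = fun x => 𝓕 G (-x) :=
      funext fun x => Real.fourierInv_eq_fourier_neg G x
    rw [this]
    exact (tendsto_integral_exp_inner_smul_cocompact G).comp
      (Homeomorph.neg (RSpace d)).isClosedEmbedding.tendsto_cocompact

theorem fourierInvC0_apply {d : ℕ} (G : RSpace d → ℂ) (hG : Integrable G) (x : RSpace d) :
    fourierInvC0 G hG x = 𝓕⁻ G x := rfl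

theorem norm_fourierInvC0_le {d : ℕ} (G : RSpace d → ℂ) (hG : Integrable G) :
    ‖fourierInvC0 G hG‖ ≤ ∫ ξ, ‖G ξ‖ := by
  rw [← ZeroAtInftyContinuousMap.norm_toBCF_eq_norm, BoundedContinuousFunction.norm_le (by positivity)]
  intro x
  change ‖𝓕⁻ G x‖ ≤ _
  rw [Real.fourierInv_eq]
  refine (norm_integral_le_integral_norm _).trans (le_of_eq ?_)
  simp_rw [Circle.norm_smul]

/-- The multiplication formula `∫ φ · 𝓕 G = ∫ 𝓕 φ · G`, with a change of variable `ξ ↦ -ξ` to pass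
to inverse transforms. -/
theorem integral_schwartz_mul_fourierInv {d : ℕ} (φ : 𝓢(RSpace d, ℂ)) (G : RSpace d → ℂ)
    (hG : Integrable G) : ∫ x, φ x * 𝓕⁻ G x = ∫ ξ, 𝓕⁻ φ ξ * G ξ := by
  have h1 : (𝓕⁻ G : RSpace d → ℂ) = 𝓕 (fun x => G (-x)) :=
    Real.fourierInv_eq_fourier_comp_neg G
  have h2 := VectorFourier.integral_bilin_fourierIntegral_eq_flip (ContinuousLinearMap.mul ℂ ℂ)
    (μ := (volume : Measure (RSpace d))) (ν := (volume : Measure (RSpace d)))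
    (L := innerₗ (RSpace d)) Real.continuous_fourierChar continuous_inner φ.integrable hG.comp_neg
  simp only [ContinuousLinearMap.mul_apply', flip_innerₗ] at h2
  rw [h1]
  refine h2.symm.trans ?_
  rw [← integral_neg_eq_self]
  refine integral_congr_ae (Eventually.of_forall fun ξ => ?_)
  simp only [neg_neg]
  rw [SchwartzMap.fourierInv_apply_eq_fourier_neg, SchwartzMap.fourier_coe]
  rfl

theorem isFracLaplacian_fourierInvC0 {d : ℕ} {s : ℝ} {f : Lp ℂ 2 (volume : Measure (RSpace d))}
    {G : RSpace d → ℂ} (hG : Integrable G)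
    (hfG : ∀ᵐ ξ, G ξ =
      (fracSymbol s ξ : ℂ) * (𝓕 f : Lp ℂ 2 (volume : Measure (RSpace d))) ξ) :
    IsFracLaplacian s (L2toLizorkin f) (C0toLizorkin (fourierInvC0 G hG)) := by
  intro φ χ hφχ
  rw [unitaryFourier_eq_mul_iff] at hφχ
  rw [L2toLizorkin_apply, C0toLizorkin_apply, ← integral_fourierInv_schwartz_mul_fourier_Lp]
  simp only [fourierInvC0_apply]
  rw [integral_schwartz_mul_fourierInv _ _ hG]
  refine integral_congr_ae ?_
  filter_upwards [hfG] with ξ hξ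
  rw [hξ, SchwartzMap.fourierInv_apply_eq_fourier_neg, SchwartzMap.fourierInv_apply_eq_fourier_neg,
    SchwartzMap.fourier_coe (χ : 𝓢(RSpace d, ℂ)), hφχ, fracSymbol_neg, SchwartzMap.fourier_coe]
  ring

end

/-! ### Uniqueness of `D^s u` in `C₀` -/

section

open scoped ContDiff FourierTransform LineDeriv

/-- A function in `C₀` that annihilates the Fourier transforms of all test functions supported away
from the origin is zero. -/
theorem C0_eq_zero_of_integral_fourier_mul {d : ℕ} (hd : 1 ≤ d) (u : C₀(RSpace d, ℂ))
    (hu : ∀ η : RSpace d → ℂ, ContDiff ℝ ∞ η → HasCompactSupport η → (0 : RSpace d) ∉ tsupport η →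
      ∫ x, 𝓕 η x * u x = 0) : u = 0 := by
  have : Nonempty (Fin d) := ⟨⟨0, hd⟩⟩
  ext x₀
  let θ : ContDiffBump (0 : RSpace d) := ⟨1, 2, one_pos, one_lt_two⟩
  let Θ : RSpace d → ℂ := fun ξ => (θ ξ : ℂ)
  have hΘd : ContDiff ℝ ∞ Θ := Complex.ofRealCLM.contDiff.comp θ.contDiff
  have hΘc : HasCompactSupport Θ := θ.hasCompactSupport.comp_left Complex.ofReal_zero
  have hΘ1 : ∀ ξ : RSpace d, ‖ξ‖ ≤ 1 → Θ ξ = 1 := by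
    intro ξ hξ
    have : θ ξ = 1 := θ.one_of_mem_closedBall (by simpa using hξ)
    simp [Θ, this]
  let T : 𝓢(RSpace d, ℂ) := hΘc.toSchwartzMap hΘd
  have hT : (𝓕 T : 𝓢(RSpace d, ℂ)) = (𝓕 Θ : RSpace d → ℂ) := rfl
  have hTint : Integrable (𝓕 Θ) := hT ▸ (𝓕 T).integrable
  have hT1 : ∫ z, 𝓕 Θ z = 1 := by
    have h2 : 𝓕⁻ (𝓕 T : 𝓢(RSpace d, ℂ)) 0 = ∫ x, 𝓕 T x := by
      rw [SchwartzMap.fourierInv_coe, Real.fourierInv_eq']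
      simp
    rw [FourierTransform.fourierInv_fourier_eq] at h2
    rw [← hT, ← h2]
    exact hΘ1 0 (by simp)
  -- `J a` averages `u` around `x₀` at scale `a`, with the kernel `𝓕 Θ` of integral `1`. It will
  -- turn out not to depend on `a`. It tends to `u x₀` as `a → 0` and to `0` as `a → ∞`, because `u`
  -- vanishes at infinity; hence `u x₀ = 0`.
  let J : ℝ → ℂ := fun a => ∫ z, 𝓕 Θ z * u (x₀ + a • z)
  -- Modulation by `E` translates the transform to the centre `x₀`.
  let E : RSpace d → ℂ := fun ξ => Complex.exp (2 * Real.pi * (inner ℝ ξ x₀ : ℝ) * Complex.I)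
  have hE : ContDiff ℝ ∞ E := by
    refine Complex.contDiff_exp.comp ?_
    refine (contDiff_const.mul (Complex.ofRealCLM.contDiff.comp ?_)).mul contDiff_const
    exact contDiff_id.inner ℝ contDiff_const
  let η : ℝ → RSpace d → ℂ := fun a ξ => E ξ * Θ (a • ξ)
  have hηd : ∀ a, ContDiff ℝ ∞ (η a) := fun a =>
    hE.mul (hΘd.comp (contDiff_const_smul a))
  have hηc : ∀ a : ℝ, 0 < a → HasCompactSupport (η a) := fun a ha =>
    (hΘc.comp_smul ha.ne').mul_left
  have hηF : ∀ a : ℝ, 0 < a → ∀ z, 𝓕 (η a) (x₀ + a • z) = ((a ^ d)⁻¹ : ℝ) * 𝓕 Θ z := by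
    intro a ha z
    have h := Measure.integral_comp_smul (volume : Measure (RSpace d))
      (fun ξ => Complex.exp (((-2 * Real.pi * inner ℝ ξ z : ℝ) : ℂ) * Complex.I) • Θ ξ) a
    rw [finrank_euclideanSpace_fin, abs_of_pos (by positivity), Complex.real_smul] at h
    rw [Real.fourier_eq', Real.fourier_eq', ← h]
    refine integral_congr_ae (Eventually.of_forall fun ξ => ?_)
    simp only [η, E, smul_eq_mul]
    rw [← mul_assoc, ← Complex.exp_add]
    congr 2
    rw [inner_add_right, inner_smul_right, inner_smul_left]
    push_cast
    simp
    ring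
  have hηJ : ∀ a : ℝ, 0 < a → ∫ x, 𝓕 (η a) x * u x = J a := by
    intro a ha
    rw [← integral_add_left_eq_self _ x₀]
    have h := Measure.integral_comp_smul (volume : Measure (RSpace d))
      (fun x => 𝓕 (η a) (x₀ + x) * u (x₀ + x)) a
    rw [finrank_euclideanSpace_fin, abs_of_pos (by positivity), Complex.real_smul] at h
    simp_rw [hηF a ha, mul_assoc, integral_const_mul] at h
    have hne : (((a ^ d)⁻¹ : ℝ) : ℂ) ≠ 0 := by
      exact_mod_cast (by positivity : (0 : ℝ) < (a ^ d)⁻¹).ne'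
    exact (mul_left_cancel₀ hne h).symm
  have hJ : ∀ a b : ℝ, 0 < a → 0 < b → J a = J b := by
    intro a b ha hb
    -- Both cut-offs equal `1` near the origin, so the difference is an admissible test function
    -- although neither term is.
    have hsupp : (0 : RSpace d) ∉ tsupport (fun ξ => η a ξ - η b ξ) := by
      rw [notMem_tsupport_iff_eventuallyEq]
      have h1 : ∀ c : ℝ, ∀ᶠ ξ : RSpace d in 𝓝 0, Θ (c • ξ) = 1 := by
        intro c
        have : Tendsto (fun ξ : RSpace d => ‖c • ξ‖) (𝓝 0) (𝓝 0) := by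
          have : Continuous (fun ξ : RSpace d => ‖c • ξ‖) := by fun_prop
          simpa using this.tendsto 0
        filter_upwards [this.eventually (gt_mem_nhds one_pos)] with ξ hξ using hΘ1 _ hξ.le
      filter_upwards [h1 a, h1 b] with ξ h2 h3
      simp [η, h2, h3]
    have hz := hu _ ((hηd a).sub (hηd b)) ((hηc a ha).sub (hηc b hb)) hsupp
    let Sa : 𝓢(RSpace d, ℂ) := (hηc a ha).toSchwartzMap (hηd a)
    let Sb : 𝓢(RSpace d, ℂ) := (hηc b hb).toSchwartzMap (hηd b)
    have hF : ∀ x, 𝓕 (fun ξ => η a ξ - η b ξ) x = 𝓕 Sa x - 𝓕 Sb x := by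
      intro x
      have h4 := congrArg (fun S : 𝓢(RSpace d, ℂ) => S x) (map_sub (FourierTransform.fourierCLM ℂ 𝓢(RSpace d, ℂ)) Sa Sb)
      exact h4
    have hbd : ∀ x, ‖u x‖ ≤ ‖u‖ := fun x => u.toBCF.norm_coe_le_norm x
    have hi : ∀ S : 𝓢(RSpace d, ℂ), Integrable (fun x => 𝓕 S x * u x) := fun S =>
      (𝓕 S).integrable.mul_bdd (c := ‖u‖) (map_continuous u).aestronglyMeasurable
        (Eventually.of_forall hbd)
    simp only [hF, sub_mul] at hz
    rw [integral_sub (hi _) (hi _), sub_eq_zero] at hz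
    rw [← hηJ a ha, ← hηJ b hb]
    exact hz
  have hmeas : ∀ a : ℝ, AEStronglyMeasurable (fun z => 𝓕 Θ z * u (x₀ + a • z)) := fun a =>
    hTint.aestronglyMeasurable.mul
      ((map_continuous u).comp (by fun_prop)).aestronglyMeasurable
  have hbound : ∀ a : ℝ, ∀ z, ‖𝓕 Θ z * u (x₀ + a • z)‖ ≤ ‖𝓕 Θ z‖ * ‖u‖ := by
    intro a z
    rw [norm_mul]
    exact mul_le_mul_of_nonneg_left (u.toBCF.norm_coe_le_norm _) (norm_nonneg _)
  have lim0 : Tendsto J (𝓝[>] 0) (𝓝 (u x₀)) := by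
    have := tendsto_integral_filter_of_dominated_convergence (l := 𝓝[>] (0 : ℝ))
      (F := fun a z => 𝓕 Θ z * u (x₀ + a • z)) (f := fun z => 𝓕 Θ z * u x₀)
      (fun z => ‖𝓕 Θ z‖ * ‖u‖) (Eventually.of_forall hmeas)
      (Eventually.of_forall fun a => Eventually.of_forall (hbound a))
      (hTint.norm.mul_const _) (Eventually.of_forall fun z => ?_)
    · rwa [integral_mul_const, hT1, one_mul] at this
    · refine Tendsto.const_mul _ ?_
      have hc : Continuous (fun a : ℝ => u (x₀ + a • z)) :=
        (map_continuous u).comp (by fun_prop)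
      have := hc.tendsto 0
      simp only [zero_smul, add_zero] at this
      exact this.mono_left nhdsWithin_le_nhds
  have limInf : Tendsto J atTop (𝓝 0) := by
    have := tendsto_integral_filter_of_dominated_convergence (l := (atTop : Filter ℝ))
      (F := fun a z => 𝓕 Θ z * u (x₀ + a • z)) (f := fun z => 0)
      (fun z => ‖𝓕 Θ z‖ * ‖u‖) (Eventually.of_forall hmeas)
      (Eventually.of_forall fun a => Eventually.of_forall (hbound a))
      (hTint.norm.mul_const _) ?_
    · simpa using this
    · have h0 : ∀ᵐ z : RSpace d, z ≠ 0 := by simp [ae_iff]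
      filter_upwards [h0] with z hz
      rw [← mul_zero (𝓕 Θ z)]
      refine Tendsto.const_mul _ ((zero_at_infty u).comp ?_)
      rw [← Metric.cobounded_eq_cocompact, ← tendsto_norm_atTop_iff_cobounded]
      have h1 : Tendsto (fun a : ℝ => a * ‖z‖ - ‖x₀‖) atTop atTop :=
        tendsto_atTop_add_const_right _ _ (tendsto_id.atTop_mul_const (norm_pos_iff.2 hz))
      refine tendsto_atTop_mono' _ ?_ h1
      filter_upwards [eventually_ge_atTop 0] with a ha
      have h2 := norm_sub_norm_le (a • z) (-x₀)
      rw [norm_neg, sub_neg_eq_add, norm_smul, Real.norm_of_nonneg ha, add_comm] at h2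
      exact h2
  have c0 : Tendsto J (𝓝[>] 0) (𝓝 (J 1)) := by
    refine tendsto_const_nhds.congr' ?_
    filter_upwards [self_mem_nhdsWithin] with a ha using hJ 1 a one_pos ha
  have c1 : Tendsto J atTop (𝓝 (J 1)) := by
    refine tendsto_const_nhds.congr' ?_
    filter_upwards [eventually_gt_atTop 0] with a ha using hJ 1 a one_pos ha
  rw [tendsto_nhds_unique lim0 c0, tendsto_nhds_unique c1 limInf]
  rfl

/-- `D^s` of a Lizorkin distribution is represented by at most one function in `C₀`. -/
theorem IsFracLaplacian.C0_unique {d : ℕ} (hd : 1 ≤ d) {s : ℝ} {u : LizorkinDistribution d}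
    {g g' : C₀(RSpace d, ℂ)} (h : IsFracLaplacian s u (C0toLizorkin g))
    (h' : IsFracLaplacian s u (C0toLizorkin g')) : g = g' := by
  rw [← sub_eq_zero]
  refine C0_eq_zero_of_integral_fourier_mul hd _ fun η h1 h2 h3 => ?_
  obtain ⟨ψ, χ, hψ, hχ, e1, e2, e3⟩ := h.exists_test η h1 h2 h3
  obtain ⟨ψ', χ', hψ', hχ', e1', e2', e3'⟩ := h'.exists_test η h1 h2 h3
  obtain rfl : ψ = ψ' := by ext x; rw [e1, e1']
  obtain rfl : χ = χ' := by ext x; rw [e2, e2']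
  have e4 := e3.trans e3'.symm
  rw [C0toLizorkin_apply, C0toLizorkin_apply] at e4
  have hη : 𝓕 η = ⇑(𝓕 ψ : 𝓢(RSpace d, ℂ)) := by
    rw [SchwartzMap.fourier_coe, show (ψ : RSpace d → ℂ) = η from funext e1]
  have hi : ∀ g : C₀(RSpace d, ℂ), Integrable (fun x => 𝓕 ψ x * g x) := fun g =>
    (𝓕 ψ).integrable.mul_bdd (c := ‖g‖) (map_continuous g).aestronglyMeasurable
      (Eventually.of_forall fun x => g.toBCF.norm_coe_le_norm x)
  simp only [hη, ZeroAtInftyContinuousMap.coe_sub, Pi.sub_apply, mul_sub]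
  rw [integral_sub (hi g) (hi g'), sub_eq_zero]
  exact e4

end

/-! ### The Sobolev inequality by Cauchy–Schwarz, and its maximizer -/

section

open scoped ContDiff FourierTransform LineDeriv

theorem Lp_two_norm_sq_eq_integral {d : ℕ} (f : Lp ℂ 2 (volume : Measure (RSpace d))) :
    ‖f‖ ^ 2 = ∫ x, ‖f x‖ ^ 2 := by
  have h := L2.inner_def (𝕜 := ℂ) f f
  rw [inner_self_eq_norm_sq_to_K] at h
  simp only [inner_self_eq_norm_sq_to_K] at h
  have h2 : ∫ a, ((‖f a‖ : ℝ) : ℂ) ^ 2 = ((∫ a, ‖f a‖ ^ 2 : ℝ) : ℂ) := by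
    rw [← integral_complex_ofReal]
    simp
  refine Complex.ofReal_injective ?_
  rw [Complex.ofReal_pow]
  exact h.trans h2

theorem integrable_norm_sq_Lp_two {d : ℕ} (f : Lp ℂ 2 (volume : Measure (RSpace d))) :
    Integrable (fun x => ‖f x‖ ^ 2) :=
  (memLp_two_iff_integrable_sq_norm (Lp.memLp f).1).1 (Lp.memLp f)

/-- The weight whose integral is the square of the sharp Sobolev constant. -/
noncomputable def sobolevWeight (d : ℕ) (j n : ℝ) (ξ : RSpace d) : ℝ :=
  fracSymbol j ξ ^ 2 / (1 + fracSymbol n ξ ^ 2)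

/-- Cauchy–Schwarz for the factorization `fracSymbol j · |F| = A · B`, where the weight `√(1 +
fracSymbol n ^ 2)` is moved from one factor to the other: `A²` is `sobolevWeight`, and `B²` is `|F|²
+ |H|²` almost everywhere. -/
theorem integrable_fracSymbol_mul_and_integral_le {d : ℕ} {j n : ℝ} (hj : 0 ≤ j) (hn : 0 < n)
    (hW : Integrable (sobolevWeight d j n)) {F H : Lp ℂ 2 (volume : Measure (RSpace d))}
    (hFH : ∀ᵐ ξ, H ξ = (fracSymbol n ξ : ℂ) * F ξ) :
    Integrable (fun ξ => (fracSymbol j ξ : ℂ) * F ξ) ∧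
      ∫ ξ, ‖(fracSymbol j ξ : ℂ) * F ξ‖ ≤
        Real.sqrt (∫ ξ, sobolevWeight d j n ξ) * Real.sqrt (‖F‖ ^ 2 + ‖H‖ ^ 2) := by
  have hcj := continuous_fracSymbol (d := d) hj
  have hcn := continuous_fracSymbol (d := d) hn.le
  have hpos : ∀ ξ : RSpace d, 0 < 1 + fracSymbol n ξ ^ 2 := fun ξ => by positivity
  let A : RSpace d → ℝ := fun ξ => fracSymbol j ξ / Real.sqrt (1 + fracSymbol n ξ ^ 2)
  let B : RSpace d → ℝ := fun ξ => Real.sqrt (1 + fracSymbol n ξ ^ 2) * ‖F ξ‖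
  have hA0 : ∀ ξ, 0 ≤ A ξ := fun ξ => div_nonneg (fracSymbol_nonneg _ _) (Real.sqrt_nonneg _)
  have hB0 : ∀ ξ, 0 ≤ B ξ := fun ξ => by positivity
  have hA2 : ∀ ξ, A ξ ^ 2 = sobolevWeight d j n ξ := fun ξ => by
    simp only [A, sobolevWeight, div_pow, Real.sq_sqrt (hpos ξ).le]
  have hB2 : (fun ξ => B ξ ^ 2) =ᵐ[volume] fun ξ => ‖F ξ‖ ^ 2 + ‖H ξ‖ ^ 2 := by
    filter_upwards [hFH] with ξ hξ
    simp only [B, mul_pow, Real.sq_sqrt (hpos ξ).le, hξ, norm_mul, Complex.norm_real,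
      Real.norm_of_nonneg (fracSymbol_nonneg n ξ)]
    ring
  have hFm : AEStronglyMeasurable (F : RSpace d → ℂ) := (Lp.memLp F).1
  have hsq : Continuous (fun ξ : RSpace d => Real.sqrt (1 + fracSymbol n ξ ^ 2)) := by fun_prop
  have hAm : AEStronglyMeasurable A :=
    (hcj.div hsq fun ξ => (Real.sqrt_pos.2 (hpos ξ)).ne').aestronglyMeasurable
  have hBm : AEStronglyMeasurable B := hsq.aestronglyMeasurable.mul hFm.norm
  have hBi : Integrable (fun ξ => B ξ ^ 2) :=
    ((integrable_norm_sq_Lp_two F).add (integrable_norm_sq_Lp_two H)).congr hB2.symm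
  have hAL : MemLp A 2 := (memLp_two_iff_integrable_sq hAm).2 (by simpa only [hA2] using hW)
  have hBL : MemLp B 2 := (memLp_two_iff_integrable_sq hBm).2 hBi
  have hAB : ∀ ξ, A ξ * B ξ = ‖(fracSymbol j ξ : ℂ) * F ξ‖ := fun ξ => by
    have := (Real.sqrt_pos.2 (hpos ξ)).ne'
    simp only [A, B, norm_mul, Complex.norm_real, Real.norm_of_nonneg (fracSymbol_nonneg j ξ)]
    field_simp
  constructor
  · have hi : Integrable (fun ξ => A ξ * B ξ) := hAL.integrable_mul hBL
    refine hi.mono' ((Complex.continuous_ofReal.comp hcj).aestronglyMeasurable.mul hFm)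
      (Eventually.of_forall fun ξ => (hAB ξ).ge)
  · have h := integral_mul_le_Lp_mul_Lq_of_nonneg (μ := (volume : Measure (RSpace d)))
      Real.HolderConjugate.two_two (Eventually.of_forall hA0) (Eventually.of_forall hB0)
      (by simpa using hAL) (by simpa using hBL)
    simp only [Real.rpow_two, ← Real.sqrt_eq_rpow, hA2, hAB] at h
    rwa [integral_congr_ae hB2, integral_add (integrable_norm_sq_Lp_two F)
      (integrable_norm_sq_Lp_two H), ← Lp_two_norm_sq_eq_integral,
      ← Lp_two_norm_sq_eq_integral] at h

/-- An inverse transform is bounded by the `L¹` norm of its symbol, and Plancherel replaces the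
norms of the transforms by those of `f` and `h`. -/
theorem sobolevInequality_sqrt_integral {d : ℕ} (hd : 1 ≤ d) {j n : ℝ} (hj : 0 ≤ j) (hn : 0 < n)
    (hW : Integrable (sobolevWeight d j n)) :
    SobolevInequality d j n (Real.sqrt (∫ ξ, sobolevWeight d j n ξ)) := by
  intro f h hfh
  obtain ⟨hi, hle⟩ := integrable_fracSymbol_mul_and_integral_le hj hn hW
    (fourier_eq_of_isFracLaplacian hd hn.le hfh)
  refine ⟨fourierInvC0 _ hi, isFracLaplacian_fourierInvC0 hi (Eventually.of_forall fun _ => rfl),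
    (norm_fourierInvC0_le _ hi).trans ?_⟩
  rwa [Lp.norm_fourier_eq, Lp.norm_fourier_eq] at hle

/-- A square-integrable and integrable function has the same inverse Fourier transform in both
senses. -/
theorem fourierInv_toLp_ae_eq {d : ℕ} (G : RSpace d → ℂ) (h1 : Integrable G) (h2 : MemLp G 2) :
    (𝓕⁻ h2.toLp : Lp ℂ 2 (volume : Measure (RSpace d))) =ᵐ[volume] 𝓕⁻ G := by
  refine ae_eq_of_integral_contDiff_smul_eq (locallyIntegrable_Lp_two _)
    (map_continuous (fourierInvC0 G h1)).locallyIntegrable fun g hg hc => ?_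
  have hg' : ContDiff ℝ ∞ (fun ξ => (g ξ : ℂ)) := Complex.ofRealCLM.contDiff.comp hg
  have hc' : HasCompactSupport (fun ξ => (g ξ : ℂ)) := hc.comp_left Complex.ofReal_zero
  let φ : 𝓢(RSpace d, ℂ) := hc'.toSchwartzMap hg'
  have e1 := integral_fourierInv_schwartz_mul_fourier_Lp (𝓕⁻ h2.toLp) φ
  rw [FourierTransform.fourier_fourierInv_eq] at e1
  have e2 := integral_schwartz_mul_fourierInv φ G h1
  simp only [Complex.real_smul]
  refine e1.symm.trans (Eq.trans (integral_congr_ae ?_) e2.symm)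
  filter_upwards [h2.coeFn_toLp] with ξ hξ
  rw [hξ]

/-- The Fourier transform of the maximizer, up to a constant factor. -/
noncomputable def maximizerFourier (d : ℕ) (j n : ℝ) (ξ : RSpace d) : ℂ :=
  (((2 * Real.pi) ^ ((d : ℝ) / 2) * (fracSymbol j ξ / (1 + fracSymbol n ξ ^ 2)) : ℝ) : ℂ)

theorem maximizerFourier_eq (d : ℕ) (j n : ℝ) (ξ : RSpace d) :
    maximizerFourier d j n ξ =
      (((2 * Real.pi) ^ ((d : ℝ) / 2) : ℝ) : ℂ) * maximizerSymbol d j n ((2 * Real.pi) • ξ) := by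
  have h2 : (0 : ℝ) < 2 * Real.pi := by positivity
  rw [maximizerFourier, maximizerSymbol, norm_smul, Real.norm_of_nonneg h2.le, fracSymbol,
    fracSymbol, ← Complex.ofReal_mul, mul_comm 2 n, Real.rpow_mul (by positivity), Real.rpow_two]

theorem maximizerFun_eq (d : ℕ) (j n : ℝ) :
    maximizerFun d j n = 𝓕⁻ (maximizerFourier d j n) := by
  ext x
  rw [maximizerFun, unitaryFourierInv_eq_fourierInv, Real.fourierInv_eq', Real.fourierInv_eq',
    ← integral_const_mul]
  refine integral_congr_ae (Eventually.of_forall fun ξ => ?_)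
  simp only [maximizerFourier_eq, smul_eq_mul]
  ring

theorem continuous_maximizerFourier (d : ℕ) {j n : ℝ} (hj : 0 ≤ j) (hn : 0 < n) :
    Continuous (maximizerFourier d j n) := by
  refine Complex.continuous_ofReal.comp (continuous_const.mul ?_)
  have hcn := continuous_fracSymbol (d := d) hn.le
  exact (continuous_fracSymbol hj).div (by fun_prop) fun ξ => by positivity

theorem integrable_maximizerFourier (d : ℕ) {j n : ℝ} (hm : Integrable (maximizerSymbol d j n)) :
    Integrable (maximizerFourier d j n) := by
  rw [show maximizerFourier d j n = fun ξ => _ from funext (maximizerFourier_eq d j n)]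
  exact (hm.comp_smul (by positivity : (2 * Real.pi) ≠ 0)).const_mul _

/-- For this `f` the factor `B` of the Cauchy–Schwarz step is a multiple of `A`, so that step is an
equality. Moreover `fracSymbol j · 𝓕 f` is nonnegative, so `D^j f` at the origin equals its `L¹`
norm. -/
theorem exists_isSobolevMaximizer {d : ℕ} {j n : ℝ} (hj : 0 ≤ j) (hn : 0 < n)
    (hW : Integrable (sobolevWeight d j n)) (hW0 : 0 < ∫ ξ, sobolevWeight d j n ξ)
    (hm : Integrable (maximizerSymbol d j n)) :
    ∃ f : Lp ℂ 2 (volume : Measure (RSpace d)), f =ᵐ[volume] maximizerFun d j n ∧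
      IsSobolevMaximizer d j n (Real.sqrt (∫ ξ, sobolevWeight d j n ξ)) f := by
  set I := ∫ ξ, sobolevWeight d j n ξ with hI
  set c : ℝ := (2 * Real.pi) ^ ((d : ℝ) / 2) with hc
  have hc0 : 0 < c := Real.rpow_pos_of_pos (by positivity) _
  have hpos : ∀ ξ : RSpace d, 0 < 1 + fracSymbol n ξ ^ 2 := fun ξ => by positivity
  have hcn : Continuous (fun ξ : RSpace d => (fracSymbol n ξ : ℂ)) :=
    Complex.continuous_ofReal.comp (continuous_fracSymbol hn.le)
  have hcm := continuous_maximizerFourier d hj hn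
  have hnorm : ∀ ξ : RSpace d, ‖maximizerFourier d j n ξ‖ ^ 2 +
      ‖(fracSymbol n ξ : ℂ) * maximizerFourier d j n ξ‖ ^ 2 = c ^ 2 * sobolevWeight d j n ξ := by
    intro ξ
    have := hpos ξ
    simp only [maximizerFourier, norm_mul, Complex.norm_real, mul_pow, Real.norm_eq_abs, sq_abs,
      sobolevWeight, ← hc]
    field_simp
  have hi : Integrable (fun ξ => c ^ 2 * sobolevWeight d j n ξ) := hW.const_mul _
  have hM : MemLp (maximizerFourier d j n) 2 := by
    rw [memLp_two_iff_integrable_sq_norm hcm.aestronglyMeasurable]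
    refine hi.mono' (by fun_prop) (Eventually.of_forall fun ξ => ?_)
    rw [Real.norm_of_nonneg (by positivity), ← hnorm]
    exact le_add_of_nonneg_right (by positivity)
  have hN : MemLp (fun ξ => (fracSymbol n ξ : ℂ) * maximizerFourier d j n ξ) 2 := by
    have hcnm : Continuous (fun ξ => (fracSymbol n ξ : ℂ) * maximizerFourier d j n ξ) :=
      hcn.mul hcm
    rw [memLp_two_iff_integrable_sq_norm hcnm.aestronglyMeasurable]
    refine hi.mono' (by fun_prop) (Eventually.of_forall fun ξ => ?_)
    rw [Real.norm_of_nonneg (by positivity), ← hnorm]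
    exact le_add_of_nonneg_left (by positivity)
  set f : Lp ℂ 2 (volume : Measure (RSpace d)) := 𝓕⁻ hM.toLp with hf
  set h : Lp ℂ 2 (volume : Measure (RSpace d)) := 𝓕⁻ hN.toLp with hh
  have hFf : (𝓕 f : Lp ℂ 2 (volume : Measure (RSpace d))) = hM.toLp :=
    FourierTransform.fourier_fourierInv_eq _
  have hFh : (𝓕 h : Lp ℂ 2 (volume : Measure (RSpace d))) = hN.toLp :=
    FourierTransform.fourier_fourierInv_eq _
  have hfh : ∀ᵐ ξ, (𝓕 h : Lp ℂ 2 (volume : Measure (RSpace d))) ξ =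
      (fracSymbol n ξ : ℂ) * (𝓕 f : Lp ℂ 2 (volume : Measure (RSpace d))) ξ := by
    rw [hFf, hFh]
    filter_upwards [hM.coeFn_toLp, hN.coeFn_toLp] with ξ h1 h2
    rw [h1, h2]
  have hsum : ‖f‖ ^ 2 + ‖h‖ ^ 2 = c ^ 2 * I := by
    rw [← Lp.norm_fourier_eq f, ← Lp.norm_fourier_eq h, hFf, hFh, Lp_two_norm_sq_eq_integral,
      Lp_two_norm_sq_eq_integral, ← integral_add (integrable_norm_sq_Lp_two _)
      (integrable_norm_sq_Lp_two _), hI, ← integral_const_mul]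
    refine integral_congr_ae ?_
    filter_upwards [hM.coeFn_toLp, hN.coeFn_toLp] with ξ h1 h2
    rw [h1, h2, hnorm]
  -- The right side of the Sobolev inequality for this `f` is `c * I`, which reappears below as the
  -- value of `D^j f` at the origin.
  have hsqrt : Real.sqrt I * Real.sqrt (‖f‖ ^ 2 + ‖h‖ ^ 2) = c * I := by
    rw [hsum, Real.sqrt_mul (by positivity), Real.sqrt_sq hc0.le, mul_left_comm,
      Real.mul_self_sqrt hW0.le]
  obtain ⟨hi, hle⟩ := integrable_fracSymbol_mul_and_integral_le hj hn hW hfh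
  rw [Lp.norm_fourier_eq, Lp.norm_fourier_eq, hsqrt] at hle
  refine ⟨f, ?_, ?_, h, isFracLaplacian_of_fourier hfh, fourierInvC0 _ hi,
    isFracLaplacian_fourierInvC0 hi (Eventually.of_forall fun _ => rfl), ?_⟩
  · rw [maximizerFun_eq]
    exact fourierInv_toLp_ae_eq _ (integrable_maximizerFourier d hm) hM
  -- If `f` were zero, so would be `h`, contradicting `‖f‖² + ‖h‖² = c² I > 0`.
  · intro h0
    have e1 : (𝓕 f : Lp ℂ 2 (volume : Measure (RSpace d))) = 0 := by
      rw [h0, FourierTransform.fourier_zero]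
    have e2 : ‖h‖ ^ 2 = 0 := by
      rw [← Lp.norm_fourier_eq, Lp_two_norm_sq_eq_integral, ← integral_zero (RSpace d) ℝ]
      refine integral_congr_ae ?_
      have e3 := Lp.coeFn_zero ℂ 2 (volume : Measure (RSpace d))
      rw [← e1] at e3
      filter_upwards [hfh, e3] with ξ h1 h2
      rw [h1, h2]
      simp
    rw [e2, h0, norm_zero] at hsum
    have : 0 < c ^ 2 * I := by positivity
    simp at hsum
    rcases hsum with h | h <;> linarith
  · rw [hsqrt]
    refine le_antisymm ((norm_fourierInvC0_le _ hi).trans hle) ?_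
    have e1 := (fourierInvC0 _ hi).toBCF.norm_coe_le_norm 0
    refine le_trans (le_of_eq ?_) e1
    have e2 : (fourierInvC0 _ hi).toBCF 0 = ((c * I : ℝ) : ℂ) := by
      refine (fourierInvC0_apply _ hi 0).trans ?_
      rw [Real.fourierInv_eq', hI, ← integral_const_mul, ← integral_complex_ofReal, hFf]
      refine integral_congr_ae ?_
      filter_upwards [hM.coeFn_toLp] with ξ h1
      rw [h1]
      simp only [inner_zero_right, mul_zero, Complex.ofReal_zero, zero_mul, Complex.exp_zero,
        one_smul, maximizerFourier, sobolevWeight, ← Complex.ofReal_mul]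
      congr 1
      rw [← hc]
      ring
    rw [e2, Complex.norm_real, Real.norm_of_nonneg (by positivity)]

/-- The inequality with a constant `C`, applied to the maximizer, furnishes some `g'` in `C₀`. By
`IsFracLaplacian.C0_unique` it is the `g` for which equality holds, so `C` cannot be smaller. -/
theorem isSharpSobolevConstant_sqrt_integral {d : ℕ} (hd : 1 ≤ d) {j n : ℝ} (hj : 0 ≤ j)
    (hn : 0 < n) (hW : Integrable (sobolevWeight d j n)) (hW0 : 0 < ∫ ξ, sobolevWeight d j n ξ)
    (hm : Integrable (maximizerSymbol d j n)) :
    IsSharpSobolevConstant d j n (Real.sqrt (∫ ξ, sobolevWeight d j n ξ)) := by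
  refine ⟨⟨Real.sqrt_nonneg _, sobolevInequality_sqrt_integral hd hj hn hW⟩, ?_⟩
  rintro C ⟨hC0, hC⟩
  obtain ⟨f, -, hf0, h, hfh, g, hg, hgn⟩ := exists_isSobolevMaximizer hj hn hW hW0 hm
  obtain ⟨g', hg', hle⟩ := hC f h hfh
  rw [← hg.C0_unique hd hg', hgn] at hle
  refine le_of_mul_le_mul_right hle (Real.sqrt_pos.2 ?_)
  have := norm_pos_iff.2 hf0
  positivity

end

/-! ### Euler's integral and the Mellin transform of `1 / (1 + r^(2n))` -/

theorem mellinConvergent_inv_one_add {w : ℂ} (h0 : 0 < w.re) (h1 : w.re < 1) :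
    MellinConvergent (fun x : ℝ => (1 + (x : ℂ))⁻¹) w := by
  have hne : ∀ x : ℝ, 0 ≤ x → (1 + (x : ℂ)) ≠ 0 := fun x hx => by
    exact_mod_cast (by positivity : (1 + x) ≠ 0)
  refine mellinConvergent_of_isBigO_rpow (a := 1) (b := 0) ?_ ?_ h1 ?_ h0
  · refine ContinuousOn.locallyIntegrableOn ?_ measurableSet_Ioi
    exact ContinuousOn.inv₀ (by fun_prop) fun x hx => hne x (le_of_lt hx)
  · refine Asymptotics.IsBigO.of_bound 1 ?_
    filter_upwards [eventually_gt_atTop 0] with x hx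
    have e : (1 + (x : ℂ)) = ((1 + x : ℝ) : ℂ) := by push_cast; rfl
    rw [e, norm_inv, Complex.norm_real, Real.rpow_neg_one, norm_inv, one_mul,
      Real.norm_of_nonneg hx.le, Real.norm_of_nonneg (by positivity)]
    exact inv_anti₀ hx (by linarith)
  · refine Asymptotics.IsBigO.of_bound 1 ?_
    filter_upwards [self_mem_nhdsWithin] with x hx
    have hx' : (0 : ℝ) < x := hx
    have e : (1 + (x : ℂ)) = ((1 + x : ℝ) : ℂ) := by push_cast; rfl
    rw [e, norm_inv, Complex.norm_real, Real.norm_of_nonneg (by positivity)]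
    simpa using inv_le_one_of_one_le₀ (by linarith : 1 ≤ 1 + x)

theorem integral_exp_neg_one_add_mul {x : ℝ} (hx : 0 < x) :
    ∫ y in Ioi (0 : ℝ), Real.exp (-(y * x)) * Real.exp (-y) = (1 + x)⁻¹ := by
  have h := integral_exp_mul_Ioi (a := -(1 + x)) (by linarith) 0
  rw [mul_zero, Real.exp_zero, neg_div_neg_eq, one_div] at h
  rw [← h]
  refine setIntegral_congr_fun measurableSet_Ioi fun y _ => ?_
  rw [← Real.exp_add]
  congr 1
  ring

/-- Euler's integral `∫ x^(w-1) / (1+x) dx = Γ(w) Γ(1-w)`. -/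
theorem mellin_inv_one_add {w : ℂ} (h0 : 0 < w.re) (h1 : w.re < 1) :
    mellin (fun x : ℝ => (1 + (x : ℂ))⁻¹) w = Complex.Gamma w * Complex.Gamma (1 - w) := by
  -- With `1/(1+x) = ∫ exp(-y(1+x)) dy`, exchanging the integrals yields `Γ(w)` from the variable
  -- `x` and `Γ(1-w)` from `y`.
  let G : ℝ → ℝ → ℂ := fun x y =>
    (x : ℂ) ^ (w - 1) * (((Real.exp (-(y * x)) * Real.exp (-y) : ℝ)) : ℂ)
  have hx : ∀ x ∈ Ioi (0 : ℝ), ∫ y in Ioi (0 : ℝ), G x y = (x : ℂ) ^ (w - 1) • (1 + (x : ℂ))⁻¹ := by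
    intro x hx
    simp only [G]
    rw [integral_const_mul, integral_complex_ofReal, integral_exp_neg_one_add_mul hx, smul_eq_mul]
    push_cast
    rfl
  have hy : ∀ y ∈ Ioi (0 : ℝ), ∫ x in Ioi (0 : ℝ), G x y =
      Complex.Gamma w * ((Real.exp (-y) : ℝ) * (y : ℂ) ^ ((1 - w) - 1)) := by
    intro y hy
    have hy' : (0 : ℝ) < y := hy
    have h := Complex.integral_cpow_mul_exp_neg_mul_Ioi h0 hy'
    have e : (1 / (y : ℂ)) ^ w = (y : ℂ) ^ ((1 - w) - 1) := by
      rw [one_div, Complex.inv_cpow _ _ (by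
        rw [Complex.arg_ofReal_of_nonneg hy'.le]; exact Real.pi_pos.ne), ← Complex.cpow_neg]
      congr 1
      ring
    rw [e] at h
    rw [mul_left_comm, mul_comm (Complex.Gamma w), ← h, ← integral_const_mul]
    refine setIntegral_congr_fun measurableSet_Ioi fun x _ => ?_
    simp only [G]
    push_cast
    ring
  have hmeas : AEStronglyMeasurable (Function.uncurry G)
      ((volume.restrict (Ioi (0 : ℝ))).prod (volume.restrict (Ioi (0 : ℝ)))) := by
    refine Measurable.aestronglyMeasurable ?_
    simp only [G, Function.uncurry_def]
    fun_prop
  have hint : Integrable (Function.uncurry G)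
      ((volume.restrict (Ioi (0 : ℝ))).prod (volume.restrict (Ioi (0 : ℝ)))) := by
    rw [integrable_prod_iff hmeas]
    constructor
    · filter_upwards [ae_restrict_mem measurableSet_Ioi] with x hx
      have hi : Integrable (fun y => Real.exp (-(y * x)) * Real.exp (-y))
          (volume.restrict (Ioi 0)) := by
        -- A non-integrable function has integral `0` by convention, whereas the value `(1+x)⁻¹` is
        -- positive.
        by_contra hcon
        have h := integral_exp_neg_one_add_mul hx
        rw [integral_undef hcon] at h
        have hx' : (0 : ℝ) < x := hx
        have : (0 : ℝ) < (1 + x)⁻¹ := by positivity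
        linarith
      exact (hi.ofReal (𝕜 := ℂ)).const_mul ((x : ℂ) ^ (w - 1))
    · refine (mellinConvergent_inv_one_add h0 h1).norm.congr ?_
      filter_upwards [ae_restrict_mem measurableSet_Ioi] with x hx
      simp only [Function.uncurry_apply_pair, G, norm_mul, Complex.norm_real]
      rw [integral_const_mul]
      have hx' : (0 : ℝ) < x := hx
      have e : (1 + (x : ℂ))⁻¹ = (((1 + x)⁻¹ : ℝ) : ℂ) := by push_cast; rfl
      rw [smul_eq_mul, norm_mul, e, Complex.norm_real, Real.norm_of_nonneg (by positivity),
        ← integral_exp_neg_one_add_mul hx]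
      congr 1
      refine setIntegral_congr_fun measurableSet_Ioi fun y _ => ?_
      simp only [Real.norm_of_nonneg (Real.exp_pos _).le]
  have hswap := integral_integral_swap hint
  rw [setIntegral_congr_fun measurableSet_Ioi hx, setIntegral_congr_fun measurableSet_Ioi hy,
    integral_const_mul] at hswap
  rw [mellin, hswap, Complex.Gamma_eq_integral (s := 1 - w) (by simpa using h1),
    Complex.GammaIntegral]

/-- The Mellin transform of `1 / (1 + r^(2n))` converges for `0 < Re u < 2n`. -/
theorem mellinConvergent_inv_one_add_rpow {n : ℝ} (hn : 0 < n) {u : ℂ} (h0 : 0 < u.re)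
    (h1 : u.re < 2 * n) :
    MellinConvergent (fun r : ℝ => (1 + ((r ^ (2 * n) : ℝ) : ℂ))⁻¹) u := by
  refine (MellinConvergent.comp_rpow (f := fun x : ℝ => (1 + (x : ℂ))⁻¹)
    (by positivity : (2 * n) ≠ 0)).2 ?_
  have e : (u / ((2 * n : ℝ) : ℂ)).re = u.re / (2 * n) := Complex.div_ofReal_re _ _
  refine mellinConvergent_inv_one_add ?_ ?_
  · rw [e]; positivity
  · rw [e, div_lt_one (by positivity)]; exact h1

theorem mellin_inv_one_add_rpow {n : ℝ} (hn : 0 < n) {u : ℂ} (h0 : 0 < u.re)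
    (h1 : u.re < 2 * n) :
    mellin (fun r : ℝ => (1 + ((r ^ (2 * n) : ℝ) : ℂ))⁻¹) u =
      (2 * n : ℂ)⁻¹ * (Complex.Gamma (u / (2 * n)) * Complex.Gamma (1 - u / (2 * n))) := by
  have e : (u / ((2 * n : ℝ) : ℂ)).re = u.re / (2 * n) := Complex.div_ofReal_re _ _
  rw [mellin_comp_rpow (fun x : ℝ => (1 + (x : ℂ))⁻¹), mellin_inv_one_add
    (by rw [e]; positivity) (by rw [e, div_lt_one (by positivity)]; exact h1),
    abs_of_pos (by positivity), Complex.real_smul]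
  push_cast
  rfl

theorem integrableOn_rpow_div_one_add_rpow {n a : ℝ} (hn : 0 < n) (h0 : 0 < a) (h1 : a < 2 * n) :
    IntegrableOn (fun r : ℝ => r ^ (a - 1) / (1 + r ^ (2 * n))) (Ioi 0) := by
  have h := mellinConvergent_inv_one_add_rpow hn (u := (a : ℂ)) (by simpa using h0)
    (by simpa using h1)
  refine (h.norm).congr ?_
  filter_upwards [ae_restrict_mem measurableSet_Ioi] with x hx
  have hx' : (0 : ℝ) < x := hx
  have e : (1 + ((x ^ (2 * n) : ℝ) : ℂ))⁻¹ = (((1 + x ^ (2 * n))⁻¹ : ℝ) : ℂ) := by push_cast; rfl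
  rw [e, norm_smul, Complex.norm_real, Complex.norm_cpow_eq_rpow_re_of_pos hx',
    Real.norm_of_nonneg (by positivity)]
  simp [div_eq_mul_inv]

theorem integral_rpow_div_one_add_rpow {n a : ℝ} (hn : 0 < n) (h0 : 0 < a) (h1 : a < 2 * n) :
    ∫ r in Ioi (0 : ℝ), r ^ (a - 1) / (1 + r ^ (2 * n)) =
      Real.pi / (2 * n * Real.sin (Real.pi * (a / (2 * n)))) := by
  have h := mellin_inv_one_add_rpow hn (u := (a : ℂ)) (by simpa using h0) (by simpa using h1)
  rw [Complex.Gamma_mul_Gamma_one_sub] at h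
  refine Complex.ofReal_injective ?_
  rw [← integral_complex_ofReal]
  refine Eq.trans (Eq.trans (setIntegral_congr_fun measurableSet_Ioi fun r hr => ?_) h) ?_
  · have hr' : (0 : ℝ) < r := hr
    simp only [smul_eq_mul]
    rw [show ((a : ℂ) - 1) = ((a - 1 : ℝ) : ℂ) by push_cast; rfl,
      ← Complex.ofReal_cpow hr'.le, div_eq_mul_inv]
    push_cast
    rfl
  · push_cast
    field_simp

/-! ### Radial integrals and the value of the sharp constant -/

theorem nontrivial_RSpace {d : ℕ} (hd : 1 ≤ d) : Nontrivial (RSpace d) := by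
  have : Nonempty (Fin d) := ⟨⟨0, hd⟩⟩
  infer_instance

/-- The surface area of the unit sphere of `ℝ^d`. -/
noncomputable def sphereArea (d : ℕ) : ℝ := 2 * Real.pi ^ ((d : ℝ) / 2) / Real.Gamma ((d : ℝ) / 2)

theorem sphereArea_pos {d : ℕ} (hd : 1 ≤ d) : 0 < sphereArea d := by
  have : (0 : ℝ) < (d : ℝ) / 2 := by positivity
  have := Real.Gamma_pos_of_pos this
  unfold sphereArea
  positivity

theorem nsmul_volume_ball_eq_sphereArea {d : ℕ} (hd : 1 ≤ d) :
    (d : ℝ) * volume.real (Metric.ball (0 : RSpace d) 1) = sphereArea d := by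
  have : Nonempty (Fin d) := ⟨⟨0, hd⟩⟩
  have h0 : (0 : ℝ) < (d : ℝ) / 2 := by positivity
  have hG := Real.Gamma_pos_of_pos h0
  have hG1 : Real.Gamma ((d : ℝ) / 2 + 1) = (d : ℝ) / 2 * Real.Gamma ((d : ℝ) / 2) :=
    Real.Gamma_add_one h0.ne'
  have hpi : Real.sqrt Real.pi ^ d = Real.pi ^ ((d : ℝ) / 2) := by
    rw [Real.sqrt_eq_rpow, ← Real.rpow_natCast, ← Real.rpow_mul Real.pi_pos.le]
    congr 1
    ring
  rw [Measure.real, EuclideanSpace.volume_ball]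
  simp only [ENNReal.ofReal_one, one_pow, one_mul, Fintype.card_fin]
  rw [ENNReal.toReal_ofReal (by rw [hG1]; positivity), hG1, hpi, sphereArea]
  have : (0 : ℝ) < d := by positivity
  field_simp

theorem integral_radial {d : ℕ} (hd : 1 ≤ d) {F : Type*} [NormedAddCommGroup F] [NormedSpace ℝ F]
    (f : ℝ → F) :
    ∫ x : RSpace d, f ‖x‖ = sphereArea d • ∫ r in Ioi (0 : ℝ), r ^ (d - 1) • f r := by
  have := nontrivial_RSpace hd
  rw [integral_fun_norm_addHaar, ← Nat.cast_smul_eq_nsmul ℝ, smul_smul, finrank_euclideanSpace_fin,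
    nsmul_volume_ball_eq_sphereArea hd]

theorem integrable_radial {d : ℕ} (hd : 1 ≤ d) {F : Type*} [NormedAddCommGroup F]
    [NormedSpace ℝ F] {f : ℝ → F} : Integrable (fun x : RSpace d => f ‖x‖) ↔
      IntegrableOn (fun r : ℝ => r ^ (d - 1) • f r) (Ioi 0) := by
  have := nontrivial_RSpace hd
  rw [integrable_fun_norm_addHaar, finrank_euclideanSpace_fin]

theorem pow_mul_rpow_div_eq {d : ℕ} (hd : 1 ≤ d) (j n : ℝ) {r : ℝ} (hr : 0 < r) :
    r ^ (d - 1) • (r ^ j / (1 + r ^ (2 * n))) = r ^ ((j + d) - 1) / (1 + r ^ (2 * n)) := by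
  rw [smul_eq_mul, ← mul_div_assoc, ← Real.rpow_natCast, ← Real.rpow_add hr, Nat.cast_sub hd]
  congr 2
  push_cast
  ring

theorem integrable_norm_rpow_div {d : ℕ} (hd : 1 ≤ d) {j n : ℝ} (hn : 0 < n) (h0 : 0 < j + d)
    (h1 : j + d < 2 * n) :
    Integrable (fun x : RSpace d => ‖x‖ ^ j / (1 + ‖x‖ ^ (2 * n))) := by
  rw [integrable_radial hd (f := fun r => r ^ j / (1 + r ^ (2 * n)))]
  exact (integrableOn_rpow_div_one_add_rpow hn h0 h1).congr_fun
    (fun r hr => (pow_mul_rpow_div_eq hd j n hr).symm) measurableSet_Ioi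

theorem integral_norm_rpow_div {d : ℕ} (hd : 1 ≤ d) {j n : ℝ} (hn : 0 < n) (h0 : 0 < j + d)
    (h1 : j + d < 2 * n) :
    ∫ x : RSpace d, ‖x‖ ^ j / (1 + ‖x‖ ^ (2 * n)) =
      sphereArea d * (Real.pi / (2 * n * Real.sin (Real.pi * ((j + d) / (2 * n))))) := by
  rw [integral_radial hd (fun r => r ^ j / (1 + r ^ (2 * n))),
    setIntegral_congr_fun measurableSet_Ioi (fun r hr => pow_mul_rpow_div_eq hd j n hr),
    integral_rpow_div_one_add_rpow hn h0 h1, smul_eq_mul]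

theorem integrable_maximizerSymbol {d : ℕ} (hd : 1 ≤ d) {j n : ℝ} (hn : 0 < n) (hj : 0 ≤ j)
    (h1 : j + d < 2 * n) : Integrable (maximizerSymbol d j n) :=
  (integrable_norm_rpow_div hd hn (by positivity) h1).ofReal (𝕜 := ℂ)

theorem sobolevWeight_eq (d : ℕ) (j n : ℝ) (ξ : RSpace d) :
    sobolevWeight d j n ξ = ‖(2 * Real.pi) • ξ‖ ^ (2 * j) / (1 + ‖(2 * Real.pi) • ξ‖ ^ (2 * n)) := by
  have h2 : (0 : ℝ) < 2 * Real.pi := by positivity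
  rw [sobolevWeight, norm_smul, Real.norm_of_nonneg h2.le, fracSymbol, fracSymbol, mul_comm 2 j,
    mul_comm 2 n, Real.rpow_mul (by positivity), Real.rpow_mul (by positivity), Real.rpow_two,
    Real.rpow_two]

theorem integrable_sobolevWeight {d : ℕ} (hd : 1 ≤ d) {j n : ℝ} (hn : 0 < n) (hj : 0 ≤ j)
    (h1 : 2 * j + d < 2 * n) : Integrable (sobolevWeight d j n) := by
  have h := (integrable_norm_rpow_div hd (j := 2 * j) hn (by positivity) h1).comp_smul
    (by positivity : (2 * Real.pi) ≠ 0)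
  exact h.congr (Eventually.of_forall fun ξ => (sobolevWeight_eq d j n ξ).symm)

theorem integral_sobolevWeight {d : ℕ} (hd : 1 ≤ d) {j n : ℝ} (hn : 0 < n) (hj : 0 ≤ j)
    (h1 : 2 * j + d < 2 * n) :
    ∫ ξ, sobolevWeight d j n ξ = ((2 * Real.pi) ^ (d : ℝ))⁻¹ *
      (sphereArea d * (Real.pi / (2 * n * Real.sin (Real.pi * ((2 * j + d) / (2 * n)))))) := by
  rw [integral_congr_ae (Eventually.of_forall (sobolevWeight_eq d j n)),
    Measure.integral_comp_smul volume (fun k : RSpace d => ‖k‖ ^ (2 * j) / (1 + ‖k‖ ^ (2 * n))),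
    integral_norm_rpow_div hd hn (by positivity) h1, finrank_euclideanSpace_fin,
    abs_of_pos (by positivity), smul_eq_mul, Real.rpow_natCast]

theorem sin_pi_mul_pos {a b : ℝ} (h0 : 0 < a) (h1 : a < b) :
    0 < Real.sin (Real.pi * (a / b)) := by
  have hb := h0.trans h1
  refine Real.sin_pos_of_pos_of_lt_pi (by positivity) ?_
  exact mul_lt_of_lt_one_right Real.pi_pos ((div_lt_one hb).2 h1)

theorem integral_sobolevWeight_pos {d : ℕ} (hd : 1 ≤ d) {j n : ℝ} (hn : 0 < n) (hj : 0 ≤ j)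
    (h1 : 2 * j + d < 2 * n) : 0 < ∫ ξ, sobolevWeight d j n ξ := by
  rw [integral_sobolevWeight hd hn hj h1]
  have := sphereArea_pos hd
  have := sin_pi_mul_pos (by positivity : 0 < 2 * j + d) h1
  positivity

theorem sqrt_integral_sobolevWeight {d : ℕ} (hd : 1 ≤ d) {j n : ℝ} (hn : 0 < n) (hj : 0 ≤ j)
    (h1 : 2 * j + d < 2 * n) :
    Real.sqrt (∫ ξ, sobolevWeight d j n ξ) = sharpSobolevValue d j n := by
  have hs := sin_pi_mul_pos (by positivity : 0 < 2 * j + d) h1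
  have hd2 : (0 : ℝ) < (d : ℝ) / 2 := by positivity
  have hG := Real.Gamma_pos_of_pos hd2
  have e : j / n + d / (2 * n) = (2 * j + d) / (2 * n) := by field_simp
  rw [sharpSobolevValue, e, Real.sqrt_eq_iff_mul_self_eq (integral_sobolevWeight_pos hd hn hj h1).le
    (by positivity), integral_sobolevWeight hd hn hj h1, sphereArea]
  have hp : Real.pi ^ (d : ℝ) = Real.pi ^ ((d : ℝ) / 2) * Real.pi ^ ((d : ℝ) / 2) := by
    rw [← Real.rpow_add Real.pi_pos]; congr 1; ring
  have h2 : (2 : ℝ) ^ (d : ℝ) = 2 ^ ((d : ℝ) / 2) * 2 ^ ((d : ℝ) / 2) := by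
    rw [← Real.rpow_add two_pos]; congr 1; ring
  -- The power is split so as to exhibit the square of the factor `π^(d/4-1/2)` of the stated
  -- constant.
  have hq : Real.pi ^ ((d : ℝ) / 2) =
      Real.pi ^ ((d : ℝ) / 4 - 1 / 2) * Real.pi ^ ((d : ℝ) / 4 - 1 / 2) * Real.pi := by
    rw [← Real.rpow_add Real.pi_pos, ← Real.rpow_add_one Real.pi_pos.ne']; congr 1; ring
  have hS := Real.mul_self_sqrt (by positivity : 0 ≤ Real.Gamma ((d : ℝ) / 2) * n *
    Real.sin (Real.pi * ((2 * j + d) / (2 * n))))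
  rw [Real.mul_rpow two_pos.le Real.pi_pos.le, hp, h2, hq]
  set A := (2 : ℝ) ^ ((d : ℝ) / 2)
  set B := Real.pi ^ ((d : ℝ) / 4 - 1 / 2)
  set C := Real.sqrt (Real.Gamma ((d : ℝ) / 2) * n * Real.sin (Real.pi * ((2 * j + d) / (2 * n))))
  have hA : 0 < A := by positivity
  have hB : 0 < B := by positivity
  have e2 : 1 / (A * B * C) * (1 / (A * B * C)) = 1 / (A * A * (B * B) * (C * C)) := by
    field_simp
  rw [e2, hS]
  field_simp

/-! ### Polar coordinates and moments of the sphere -/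

/-- The surface measure on the unit sphere of `ℝ^d`. -/
noncomputable abbrev sphereMeasure (d : ℕ) : Measure (Metric.sphere (0 : RSpace d) 1) :=
  (volume : Measure (RSpace d)).toSphere

theorem integral_volumeIoiPow {F : Type*} [NormedAddCommGroup F] [NormedSpace ℝ F] (m : ℕ)
    (f : ℝ → F) :
    ∫ r : Ioi (0 : ℝ), f r ∂(Measure.volumeIoiPow m) = ∫ r in Ioi (0 : ℝ), r ^ m • f r := by
  simp only [Measure.volumeIoiPow, ENNReal.ofReal]
  rw [integral_withDensity_eq_integral_smul
    (measurable_subtype_coe.pow_const _).real_toNNReal,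
    integral_subtype_comap measurableSet_Ioi fun a => Real.toNNReal (a ^ m) • f a,
    setIntegral_congr_fun measurableSet_Ioi fun x hx => ?_]
  rw [NNReal.smul_def, Real.coe_toNNReal _ (pow_nonneg (le_of_lt hx) _)]

section polar
variable {d : ℕ} {F : Type*} [NormedAddCommGroup F]

theorem integral_eq_integral_polar [NormedSpace ℝ F] (hd : 1 ≤ d) (f : RSpace d → F) :
    ∫ x, f x = ∫ p : Metric.sphere (0 : RSpace d) 1 × Ioi (0 : ℝ), f (p.2.1 • p.1.1)
      ∂((sphereMeasure d).prod (Measure.volumeIoiPow (d - 1))) := by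
  have := nontrivial_RSpace hd
  have h := (volume : Measure (RSpace d)).measurePreserving_homeomorphUnitSphereProd.integral_comp
    (Homeomorph.measurableEmbedding _)
    (fun p : Metric.sphere (0 : RSpace d) 1 × Ioi (0 : ℝ) => f (p.2.1 • p.1.1))
  rw [finrank_euclideanSpace_fin] at h
  rw [← h]
  have e : ∀ x : ({(0)}ᶜ : Set (RSpace d)),
      f ((homeomorphUnitSphereProd (RSpace d) x).2.1 • (homeomorphUnitSphereProd (RSpace d) x).1.1)
        = f x := by
    intro x
    have hx : ‖(x : RSpace d)‖ ≠ 0 := norm_ne_zero_iff.2 x.2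
    simp [smul_inv_smul₀ hx]
  simp only [e]
  rw [integral_subtype_comap (measurableSet_singleton _).compl fun x => f x,
    restrict_compl_singleton]

theorem integrable_polar (hd : 1 ≤ d) {f : RSpace d → F} (hf : Integrable f) :
    Integrable (fun p : Metric.sphere (0 : RSpace d) 1 × Ioi (0 : ℝ) => f (p.2.1 • p.1.1))
      ((sphereMeasure d).prod (Measure.volumeIoiPow (d - 1))) := by
  have := nontrivial_RSpace hd
  have h := (volume : Measure (RSpace d)).measurePreserving_homeomorphUnitSphereProd.integrable_comp_emb
    (Homeomorph.measurableEmbedding _)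
    (g := fun p : Metric.sphere (0 : RSpace d) 1 × Ioi (0 : ℝ) => f (p.2.1 • p.1.1))
  rw [finrank_euclideanSpace_fin] at h
  rw [← h]
  have e : ((fun p : Metric.sphere (0 : RSpace d) 1 × Ioi (0 : ℝ) => f (p.2.1 • p.1.1)) ∘
      homeomorphUnitSphereProd (RSpace d)) = f ∘ (Subtype.val : ({(0)}ᶜ : Set (RSpace d)) → _) := by
    ext x
    have hx : ‖(x : RSpace d)‖ ≠ 0 := norm_ne_zero_iff.2 x.2
    simp [smul_inv_smul₀ hx]
  rw [e, ← integrableOn_iff_comap_subtypeVal (measurableSet_singleton _).compl]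
  exact hf.integrableOn

/-- Polar coordinates. -/
theorem integral_polar [NormedSpace ℝ F] (hd : 1 ≤ d) {f : RSpace d → F}
    (hf : Integrable f) :
    ∫ x, f x = ∫ r in Ioi (0 : ℝ), r ^ (d - 1) • ∫ θ, f (r • (θ : RSpace d)) ∂(sphereMeasure d) := by
  rw [integral_eq_integral_polar hd, integral_prod_symm _ (integrable_polar hd hf),
    ← integral_volumeIoiPow]

/-- No integrability is required: the integral of a product of functions of separate variables
factorizes also when integrals take the default value `0`. -/
theorem integral_polar_mul {𝕜 : Type*} [RCLike 𝕜] (hd : 1 ≤ d) {f : RSpace d → 𝕜}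
    {g : RSpace d → 𝕜} {h : ℝ → 𝕜}
    (hf : ∀ (r : ℝ) (θ : RSpace d), 0 < r → ‖θ‖ = 1 → f (r • θ) = g θ * h r) :
    ∫ x, f x = (∫ θ, g (θ : RSpace d) ∂(sphereMeasure d)) * ∫ r in Ioi (0 : ℝ), r ^ (d - 1) • h r := by
  rw [integral_eq_integral_polar hd, ← integral_volumeIoiPow, ← integral_prod_mul]
  refine integral_congr_ae (Eventually.of_forall fun p => ?_)
  exact hf _ _ p.2.2 (by simp)

end polar

theorem exists_linearIsometryEquiv_map_eq {d : ℕ} {v w : RSpace d} (h : ‖v‖ = ‖w‖) :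
    ∃ R : RSpace d ≃ₗᵢ[ℝ] RSpace d, R v = w :=
  ⟨(Submodule.span ℝ {v - w})ᗮ.reflection, Submodule.reflection_sub h⟩

theorem integral_pow_mul_exp_neg_sq (k : ℕ) :
    ∫ t : ℝ, t ^ (2 * k) * Real.exp (-t ^ 2) = Real.Gamma (k + 1 / 2) := by
  have h := integral_comp_abs (f := fun t : ℝ => t ^ (2 * k) * Real.exp (-t ^ 2))
  simp only [sq_abs, pow_mul] at h
  have h2 := integral_rpow_mul_exp_neg_rpow (p := 2) (q := 2 * k) two_pos (by linarith [Nat.cast_nonneg (α := ℝ) k])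
  have e : ∫ t in Ioi (0 : ℝ), (t ^ 2) ^ k * Real.exp (-t ^ 2) = 1 / 2 * Real.Gamma ((2 * k + 1) / 2) := by
    rw [← h2]
    refine setIntegral_congr_fun measurableSet_Ioi fun t _ => ?_
    rw [Real.rpow_two, ← pow_mul, ← Real.rpow_natCast]
    push_cast
    rfl
  simp only [pow_mul]
  rw [h, e, ← mul_assoc, mul_one_div_cancel two_ne_zero, one_mul]
  congr 1
  ring


theorem integral_Ioi_pow_mul_exp_neg_sq {d : ℕ} (hd : 1 ≤ d) (m : ℕ) :
    ∫ r in Ioi (0 : ℝ), r ^ (d - 1) • (r ^ m * Real.exp (-r ^ 2)) =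
      1 / 2 * Real.Gamma ((d + m) / 2) := by
  have h2 := integral_rpow_mul_exp_neg_rpow (p := 2) (q := (d - 1 + m : ℕ)) two_pos
    (by linarith [Nat.cast_nonneg (α := ℝ) (d - 1 + m)])
  rw [show (((d + m) / 2 : ℝ)) = ((d - 1 + m : ℕ) + 1) / 2 by push_cast [Nat.cast_sub hd]; ring,
    ← h2]
  refine setIntegral_congr_fun measurableSet_Ioi fun r _ => ?_
  rw [Real.rpow_two, Real.rpow_natCast, pow_add, smul_eq_mul, mul_assoc]

theorem integral_coord_pow_mul_gaussian {d : ℕ} (hd : 1 ≤ d) (i₀ : Fin d) (k : ℕ) :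
    ∫ x : RSpace d, x i₀ ^ (2 * k) * Real.exp (-‖x‖ ^ 2) =
      Real.Gamma (k + 1 / 2) * Real.pi ^ (((d : ℝ) - 1) / 2) := by
  have h := (EuclideanSpace.volume_preserving_symm_measurableEquiv_toLp (Fin d)).symm.integral_comp
    (MeasurableEquiv.measurableEmbedding _)
    (fun x : RSpace d => x i₀ ^ (2 * k) * Real.exp (-‖x‖ ^ 2))
  rw [← h]
  let f : Fin d → ℝ → ℝ := fun i t => (if i = i₀ then t ^ (2 * k) else 1) * Real.exp (-t ^ 2)
  have e : ∀ y : Fin d → ℝ, (fun x : RSpace d => x i₀ ^ (2 * k) * Real.exp (-‖x‖ ^ 2))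
      ((MeasurableEquiv.toLp 2 (Fin d → ℝ)) y) = ∏ i, f i (y i) := by
    intro y
    simp only [f, Finset.prod_mul_distrib, Finset.prod_ite_eq', Finset.mem_univ, if_true,
      ← Real.exp_sum, Finset.sum_neg_distrib]
    congr 2
    rw [EuclideanSpace.norm_sq_eq]
    simp
  refine (integral_congr_ae (Eventually.of_forall e)).trans ?_
  rw [integral_fintype_prod_volume_eq_prod f, ← Finset.mul_prod_erase _ _ (Finset.mem_univ i₀)]
  have e1 : ∫ t, f i₀ t = Real.Gamma (k + 1 / 2) := by
    simp only [f, if_true]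
    exact integral_pow_mul_exp_neg_sq k
  have e2 : ∀ i ∈ Finset.univ.erase i₀, ∫ t, f i t = Real.sqrt Real.pi := by
    intro i hi
    have := integral_gaussian 1
    simp only [f, (Finset.mem_erase.1 hi).1, if_false, one_mul]
    simpa using this
  rw [e1, Finset.prod_congr rfl e2, Finset.prod_const, Finset.card_erase_of_mem (Finset.mem_univ _),
    Finset.card_univ, Fintype.card_fin, Real.sqrt_eq_rpow, ← Real.rpow_natCast,
    ← Real.rpow_mul Real.pi_pos.le, Nat.cast_sub hd]
  congr 2
  push_cast
  ring

/-- The Gaussian is invariant under isometries, so `e` may be moved to a coordinate vector by a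
reflection. -/
theorem integral_inner_pow_mul_gaussian {d : ℕ} (hd : 1 ≤ d) {e : RSpace d} (he : ‖e‖ = 1) (k : ℕ) :
    ∫ x : RSpace d, inner ℝ x e ^ (2 * k) * Real.exp (-‖x‖ ^ 2) =
      Real.Gamma (k + 1 / 2) * Real.pi ^ (((d : ℝ) - 1) / 2) := by
  let i₀ : Fin d := ⟨0, hd⟩
  obtain ⟨R, hR⟩ := exists_linearIsometryEquiv_map_eq
    (v := e) (w := EuclideanSpace.single i₀ 1) (by simp [he])
  rw [← integral_coord_pow_mul_gaussian hd i₀ k,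
    ← R.symm.measurePreserving.integral_comp (MeasurableEquiv.measurableEmbedding
      R.symm.toHomeomorph.toMeasurableEquiv)]
  refine integral_congr_ae (Eventually.of_forall fun x => ?_)
  simp only
  rw [LinearIsometryEquiv.norm_map, ← LinearIsometryEquiv.inner_map_map R, hR,
    LinearIsometryEquiv.apply_symm_apply, EuclideanSpace.inner_single_right]
  simp

/-- The even moments of the surface measure of the sphere. -/
theorem integral_sphere_inner_pow_even {d : ℕ} (hd : 1 ≤ d) {e : RSpace d} (he : ‖e‖ = 1) (k : ℕ) :
    ∫ θ, inner ℝ (θ : RSpace d) e ^ (2 * k) ∂(sphereMeasure d) =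
      2 * Real.pi ^ (((d : ℝ) - 1) / 2) * Real.Gamma (k + 1 / 2) / Real.Gamma (d / 2 + k) := by
  -- The same Gaussian integral is known in Cartesian coordinates; in polar coordinates it is the
  -- spherical moment times a radial Gamma integral, so the moment is their quotient.
  have h := integral_polar_mul hd (f := fun x : RSpace d => inner ℝ x e ^ (2 * k) * Real.exp (-‖x‖ ^ 2))
    (g := fun θ => inner ℝ θ e ^ (2 * k)) (h := fun r => r ^ (2 * k) * Real.exp (-r ^ 2)) (by
      intro r θ hr hθ
      simp only [norm_smul, hθ, mul_one, inner_smul_left, Real.norm_eq_abs, sq_abs, mul_pow]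
      simp
      ring)
  rw [integral_inner_pow_mul_gaussian hd he, integral_Ioi_pow_mul_exp_neg_sq hd,
    show ((d + (2 * k : ℕ)) / 2 : ℝ) = d / 2 + k by push_cast; ring] at h
  have hG : 0 < Real.Gamma ((d : ℝ) / 2 + k) := Real.Gamma_pos_of_pos (by positivity)
  rw [eq_div_iff hG.ne']
  linarith

/-- The Gaussian integral vanishes by oddness, while its radial factor is positive. -/
theorem integral_sphere_inner_pow_odd {d : ℕ} (hd : 1 ≤ d) {e : RSpace d} (k : ℕ) :
    ∫ θ, inner ℝ (θ : RSpace d) e ^ (2 * k + 1) ∂(sphereMeasure d) = 0 := by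
  have h := integral_polar_mul hd
    (f := fun x : RSpace d => inner ℝ x e ^ (2 * k + 1) * Real.exp (-‖x‖ ^ 2))
    (g := fun θ => inner ℝ θ e ^ (2 * k + 1)) (h := fun r => r ^ (2 * k + 1) * Real.exp (-r ^ 2)) (by
      intro r θ hr hθ
      simp only [norm_smul, hθ, mul_one, inner_smul_left, Real.norm_eq_abs, sq_abs, mul_pow]
      simp
      ring)
  have h0 : ∫ x : RSpace d, inner ℝ x e ^ (2 * k + 1) * Real.exp (-‖x‖ ^ 2) = 0 := by
    have := integral_neg_eq_self (fun x : RSpace d => inner ℝ x e ^ (2 * k + 1) * Real.exp (-‖x‖ ^ 2))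
      volume
    simp only [inner_neg_left, norm_neg, Odd.neg_pow (odd_two_mul_add_one k), neg_mul,
      integral_neg] at this
    linarith
  rw [h0, integral_Ioi_pow_mul_exp_neg_sq hd] at h
  have hG : 0 < Real.Gamma ((d + (2 * k + 1 : ℕ)) / 2 : ℝ) := Real.Gamma_pos_of_pos (by positivity)
  rcases mul_eq_zero.1 h.symm with h | h
  · exact h
  · linarith

/-! ### The Fourier transform of the sphere as a Bessel function -/

section

open scoped Nat

/-- The Fourier transform of the surface measure of the sphere. -/
noncomputable def sphereExp {d : ℕ} (x : RSpace d) : ℂ :=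
  ∫ θ, Complex.exp (Complex.I * ((inner ℝ (θ : RSpace d) x : ℝ) : ℂ)) ∂(sphereMeasure d)

theorem norm_exp_I_mul_ofReal' (t : ℝ) : ‖Complex.exp (Complex.I * (t : ℂ))‖ = 1 := by
  rw [mul_comm]
  exact Complex.norm_exp_ofReal_mul_I t

theorem continuous_sphereExp {d : ℕ} : Continuous (sphereExp : RSpace d → ℂ) := by
  refine continuous_of_dominated (bound := fun _ => 1) (fun x => ?_) (fun x => ?_)
    (integrable_const _) (Eventually.of_forall fun θ => ?_)
  · refine Continuous.aestronglyMeasurable ?_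
    fun_prop
  · exact Eventually.of_forall fun θ => (norm_exp_I_mul_ofReal' _).le
  · fun_prop

theorem norm_sphereExp_le {d : ℕ} (x : RSpace d) :
    ‖sphereExp x‖ ≤ (sphereMeasure d).real univ := by
  refine (norm_integral_le_integral_norm _).trans (le_of_eq ?_)
  simp only [norm_exp_I_mul_ofReal']
  simp

theorem abs_inner_sphere_le {d : ℕ} (θ : Metric.sphere (0 : RSpace d) 1) (x : RSpace d) :
    |inner ℝ (θ : RSpace d) x| ≤ ‖x‖ := by
  have h := abs_real_inner_le_norm (θ : RSpace d) x
  have hθ : ‖(θ : RSpace d)‖ = 1 := by simp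
  rwa [hθ, one_mul] at h

/-- The exponential series may be integrated term by term, being dominated on the unit sphere by the
series of `exp ‖x‖`. -/
theorem hasSum_sphereExp {d : ℕ} (x : RSpace d) :
    HasSum (fun m : ℕ => ∫ θ, (Complex.I * ((inner ℝ (θ : RSpace d) x : ℝ) : ℂ)) ^ m / (m ! : ℂ)
      ∂(sphereMeasure d)) (sphereExp x) := by
  refine hasSum_integral_of_dominated_convergence (fun m _ => ‖x‖ ^ m / (m ! : ℝ)) (fun m => ?_)
    (fun m => Eventually.of_forall fun θ => ?_) (Eventually.of_forall fun θ => ?_)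
    (integrable_const _) (Eventually.of_forall fun θ => ?_)
  · refine Continuous.aestronglyMeasurable ?_
    fun_prop
  · rw [norm_div, norm_pow, norm_mul, Complex.norm_I, one_mul, Complex.norm_real, Complex.norm_natCast]
    gcongr
    exact abs_inner_sphere_le θ x
  · exact Real.summable_pow_div_factorial _
  · rw [Complex.exp_eq_exp_ℂ]
    exact NormedSpace.expSeries_div_hasSum_exp _

/-- Absorbs the `(2k)!` of the exponential series into the half-integer Gamma value of the moment,
leaving the `k!` of the Bessel series. -/
theorem Gamma_nat_add_half_div_factorial (k : ℕ) :
    Real.Gamma (k + 1 / 2) / ((2 * k)! : ℝ) = Real.sqrt Real.pi / (4 ^ k * (k ! : ℝ)) := by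
  induction k with
  | zero => simp [-one_div, Real.Gamma_one_half_eq]
  | succ k ih =>
    have h : Real.Gamma (((k + 1 : ℕ) : ℝ) + 1 / 2) = (k + 1 / 2) * Real.Gamma (k + 1 / 2) := by
      rw [← Real.Gamma_add_one (by positivity)]
      congr 1
      push_cast
      ring
    rw [div_eq_div_iff (by positivity) (by positivity)] at ih ⊢
    rw [h, show 2 * (k + 1) = 2 * k + 1 + 1 by ring, Nat.factorial_succ, Nat.factorial_succ,
      Nat.factorial_succ, pow_succ]
    push_cast
    linear_combination (4 * (k + 1 / 2) * (k + 1) : ℝ) * ih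

/-- Odd moments vanish, and the even ones give, term by term, the series of `J_(d/2-1)`. -/
theorem sphereExp_eq_besselJ {d : ℕ} (hd : 1 ≤ d) {x : RSpace d} (hx : x ≠ 0) :
    sphereExp x = (((2 * Real.pi) ^ ((d : ℝ) / 2) *
      (besselJ ((d : ℝ) / 2 - 1) ‖x‖ / ‖x‖ ^ ((d : ℝ) / 2 - 1)) : ℝ) : ℂ) := by
  have hρ : 0 < ‖x‖ := norm_pos_iff.2 hx
  set ρ := ‖x‖ with hρdef
  set e : RSpace d := ρ⁻¹ • x with he
  have he1 : ‖e‖ = 1 := by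
    rw [he, norm_smul, norm_inv, norm_norm, inv_mul_cancel₀ hρ.ne']
  have hxe : x = ρ • e := by rw [he, smul_inv_smul₀ hρ.ne']
  have hterm : ∀ m : ℕ, ∫ θ, (Complex.I * ((inner ℝ (θ : RSpace d) x : ℝ) : ℂ)) ^ m / (m ! : ℂ)
      ∂(sphereMeasure d) = Complex.I ^ m * ((ρ ^ m / (m ! : ℝ) *
        ∫ θ, inner ℝ (θ : RSpace d) e ^ m ∂(sphereMeasure d) : ℝ) : ℂ) := by
    intro m
    rw [← integral_const_mul, ← integral_complex_ofReal, ← integral_const_mul]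
    refine integral_congr_ae (Eventually.of_forall fun θ => ?_)
    simp only
    rw [hxe, inner_smul_right]
    push_cast
    ring
  have hs := hasSum_sphereExp x
  simp only [hterm] at hs
  have hodd : ∀ m ∉ range (fun k : ℕ => 2 * k), Complex.I ^ m * ((ρ ^ m / (m ! : ℝ) *
        ∫ θ, inner ℝ (θ : RSpace d) e ^ m ∂(sphereMeasure d) : ℝ) : ℂ) = 0 := by
    intro m hm
    obtain ⟨k, rfl⟩ : ∃ k, m = 2 * k + 1 := by
      rcases Nat.even_or_odd' m with ⟨k, h | h⟩
      · exact absurd ⟨k, h.symm⟩ hm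
      · exact ⟨k, h⟩
    rw [integral_sphere_inner_pow_odd hd]
    simp
  rw [← Function.Injective.hasSum_iff (fun a b h => by simpa using h) hodd] at hs
  have hν : (0 : ℝ) < (d : ℝ) / 2 := by positivity
  have hev : ∀ k : ℕ, ((fun m : ℕ => Complex.I ^ m * ((ρ ^ m / (m ! : ℝ) *
        ∫ θ, inner ℝ (θ : RSpace d) e ^ m ∂(sphereMeasure d) : ℝ) : ℂ)) ∘ fun k : ℕ => 2 * k) k =
      (((2 * Real.pi) ^ ((d : ℝ) / 2) / ρ ^ ((d : ℝ) / 2 - 1) *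
        ((-1 : ℝ) ^ k / ((k ! : ℝ) * Real.Gamma ((k : ℝ) + ((d : ℝ) / 2 - 1) + 1)) *
          (ρ / 2) ^ (2 * (k : ℝ) + ((d : ℝ) / 2 - 1))) : ℝ) : ℂ) := by
    intro k
    simp only [Function.comp]
    rw [pow_mul, Complex.I_sq, integral_sphere_inner_pow_even hd he1]
    have e1 : ((-1 : ℂ)) ^ k = (((-1 : ℝ) ^ k : ℝ) : ℂ) := by push_cast; rfl
    rw [e1, ← Complex.ofReal_mul]
    congr 1
    have e2 : Real.Gamma ((k : ℝ) + ((d : ℝ) / 2 - 1) + 1) = Real.Gamma ((d : ℝ) / 2 + k) := by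
      congr 1; ring
    have hG : 0 < Real.Gamma ((d : ℝ) / 2 + k) := Real.Gamma_pos_of_pos (by positivity)
    have e3 : (ρ / 2) ^ (2 * (k : ℝ) + ((d : ℝ) / 2 - 1)) =
        ρ ^ (2 * k) / 4 ^ k * (ρ ^ ((d : ℝ) / 2 - 1) / 2 ^ ((d : ℝ) / 2 - 1)) := by
      rw [Real.rpow_add (by positivity), Real.div_rpow hρ.le two_pos.le,
        Real.div_rpow hρ.le two_pos.le, Real.rpow_mul hρ.le, Real.rpow_mul two_pos.le,
        Real.rpow_natCast, Real.rpow_natCast, Real.rpow_two, Real.rpow_two, pow_mul]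
      norm_num
    have e4 : (2 * Real.pi) ^ ((d : ℝ) / 2) =
        2 * 2 ^ ((d : ℝ) / 2 - 1) * (Real.pi ^ (((d : ℝ) - 1) / 2) * Real.sqrt Real.pi) := by
      rw [Real.mul_rpow two_pos.le Real.pi_pos.le, Real.sqrt_eq_rpow, ← Real.rpow_add Real.pi_pos,
        mul_comm 2 ((2 : ℝ) ^ _), ← Real.rpow_add_one two_ne_zero]
      congr 2 <;> ring
    have e5 := Gamma_nat_add_half_div_factorial k
    have e6 : 0 < ρ ^ ((d : ℝ) / 2 - 1) := by positivity
    have e7 : (0 : ℝ) < 2 ^ ((d : ℝ) / 2 - 1) := by positivity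
    have e8 : ρ ^ (2 * k) / ((2 * k)! : ℝ) *
        (2 * Real.pi ^ (((d : ℝ) - 1) / 2) * Real.Gamma (k + 1 / 2) / Real.Gamma (d / 2 + k)) =
        ρ ^ (2 * k) * 2 * Real.pi ^ (((d : ℝ) - 1) / 2) / Real.Gamma (d / 2 + k) *
          (Real.Gamma (k + 1 / 2) / ((2 * k)! : ℝ)) := by
      field_simp
    rw [e2, e3, e4, e8, e5]
    field_simp
  rw [funext hev] at hs
  have him : (sphereExp x).im = 0 := by
    have := Complex.hasSum_im hs
    simp only [Complex.ofReal_im] at this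
    exact (hasSum_zero.unique this).symm
  have hre : (sphereExp x).re = (2 * Real.pi) ^ ((d : ℝ) / 2) *
      (besselJ ((d : ℝ) / 2 - 1) ρ / ρ ^ ((d : ℝ) / 2 - 1)) := by
    have hs' := Complex.hasSum_re hs
    simp only [Complex.ofReal_re] at hs'
    rw [← hs'.tsum_eq, tsum_mul_left, besselJ]
    ring
  exact Complex.ext (by rw [hre, Complex.ofReal_re]) (by rw [him, Complex.ofReal_im])

end

/-! ### The Bessel representation of the maximizer -/

section

open scoped FourierTransform Nat

theorem sphereExp_smul_eq {d : ℕ} (hd : 1 ≤ d) {x : RSpace d} (hx : x ≠ 0) {r : ℝ} (hr : 0 < r) :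
    sphereExp (r • x) = (((2 * Real.pi) ^ ((d : ℝ) / 2) *
      (besselJ ((d : ℝ) / 2 - 1) (‖x‖ * r) / (‖x‖ * r) ^ ((d : ℝ) / 2 - 1)) : ℝ) : ℂ) := by
  rw [sphereExp_eq_besselJ hd (smul_ne_zero hr.ne' hx), norm_smul, Real.norm_of_nonneg hr.le,
    mul_comm r]

theorem RSpace.exists_norm_eq {d : ℕ} (hd : 1 ≤ d) {ρ : ℝ} (hρ : 0 ≤ ρ) : ∃ x : RSpace d, ‖x‖ = ρ :=
  ⟨EuclideanSpace.single ⟨0, hd⟩ ρ, by simp [abs_of_nonneg hρ]⟩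

/-- Up to a constant the Bessel factor is the Fourier transform of a finite measure, hence bounded.
Absolute convergence follows from that of `∫ r^(j+d-1) / (1 + r^(2n))`, without asymptotics of `J`.
-/
theorem integrableOn_besselIntegrand {d : ℕ} (hd : 1 ≤ d) {j n : ℝ} (hn : 0 < n) (hj : 0 ≤ j)
    (h1 : j + d < 2 * n) {ρ : ℝ} (hρ : 0 < ρ) :
    IntegrableOn (besselIntegrand d j n ρ) (Ioi 0) := by
  obtain ⟨x, hx⟩ := RSpace.exists_norm_eq hd hρ.le
  have hx0 : x ≠ 0 := by rw [← norm_pos_iff, hx]; exact hρ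
  have hc : (0 : ℝ) < (2 * Real.pi) ^ ((d : ℝ) / 2) := by positivity
  have h := integrableOn_rpow_div_one_add_rpow hn (a := j + d) (by positivity) h1
  have hb := h.bdd_mul (f := fun r => (((2 * Real.pi) ^ ((d : ℝ) / 2))⁻¹ * (sphereExp (r • x)).re))
    (c := ((2 * Real.pi) ^ ((d : ℝ) / 2))⁻¹ * (sphereMeasure d).real univ) ?_ ?_
  · refine IntegrableOn.congr_fun hb (fun r hr => ?_) measurableSet_Ioi
    rw [sphereExp_smul_eq hd hx0 hr, Complex.ofReal_re, inv_mul_cancel_left₀ hc.ne', hx,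
      besselIntegrand, show j + d - 1 = (d : ℝ) + j - 1 by ring]
  · refine Continuous.aestronglyMeasurable ?_
    exact continuous_const.mul (Complex.continuous_re.comp (continuous_sphereExp.comp (by fun_prop)))
  · refine Eventually.of_forall fun r => ?_
    rw [norm_mul, Real.norm_of_nonneg (inv_nonneg.2 hc.le)]
    refine mul_le_mul_of_nonneg_left ?_ (inv_nonneg.2 hc.le)
    exact (Complex.abs_re_le_norm _).trans (norm_sphereExp_le _)

theorem maximizerFun_zero {d : ℕ} (hd : 1 ≤ d) {j n : ℝ} (hn : 0 < n) (hj : 0 ≤ j)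
    (h1 : j + d < 2 * n) : maximizerFun d j n 0 = ((radialProfile d j n 0 : ℝ) : ℂ) := by
  have hs := sin_pi_mul_pos (by positivity : 0 < j + d) h1
  have hG := Real.Gamma_pos_of_pos (by positivity : (0 : ℝ) < (d : ℝ) / 2)
  have h2 : ∫ k : RSpace d, maximizerSymbol d j n k = ((∫ k : RSpace d, ‖k‖ ^ j / (1 + ‖k‖ ^ (2 * n)) : ℝ) : ℂ) := by
    rw [← integral_complex_ofReal]
    rfl
  rw [maximizerFun, unitaryFourierInv]
  simp only [inner_zero_right, Complex.ofReal_zero, mul_zero, Complex.exp_zero, one_mul]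
  rw [h2, integral_norm_rpow_div hd hn (by positivity) h1, ← Complex.ofReal_mul, radialProfile,
    if_pos rfl, sphereArea, neg_div, Real.rpow_neg (by positivity),
    Real.mul_rpow two_pos.le Real.pi_pos.le]
  congr 1
  field_simp

/-- In polar coordinates the symbol is constant on spheres, and the angular integral of the
exponential is `sphereExp (r • x)`. -/
theorem maximizerFun_eq_radialProfile {d : ℕ} (hd : 1 ≤ d) {j n : ℝ} (hn : 0 < n) (hj : 0 ≤ j)
    (h1 : j + d < 2 * n) (x : RSpace d) :
    maximizerFun d j n x = ((radialProfile d j n ‖x‖ : ℝ) : ℂ) := by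
  by_cases hx : x = 0
  · rw [hx, norm_zero, maximizerFun_zero hd hn hj h1]
  have hc : (0 : ℝ) < (2 * Real.pi) ^ ((d : ℝ) / 2) := by positivity
  have hm := integrable_maximizerSymbol hd hn hj h1
  have hi : Integrable (fun k : RSpace d =>
      Complex.exp (Complex.I * ((inner ℝ k x : ℝ) : ℂ)) * maximizerSymbol d j n k) := by
    refine hm.bdd_mul (c := 1) (Continuous.aestronglyMeasurable (by fun_prop)) ?_
    exact Eventually.of_forall fun k => (norm_exp_I_mul_ofReal' _).le
  rw [maximizerFun, unitaryFourierInv, integral_polar hd hi, radialProfile,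
    if_neg (norm_ne_zero_iff.2 hx), ← integral_complex_ofReal, ← integral_const_mul]
  refine setIntegral_congr_fun measurableSet_Ioi fun r hr => ?_
  have hr' : (0 : ℝ) < r := hr
  have e1 : ∫ θ, Complex.exp (Complex.I * ((inner ℝ (r • (θ : RSpace d)) x : ℝ) : ℂ)) *
      maximizerSymbol d j n (r • (θ : RSpace d)) ∂(sphereMeasure d) =
      sphereExp (r • x) * ((r ^ j / (1 + r ^ (2 * n)) : ℝ) : ℂ) := by
    rw [sphereExp, ← integral_mul_const]
    refine integral_congr_ae (Eventually.of_forall fun θ => ?_)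
    have hθ : ‖r • (θ : RSpace d)‖ = r := by
      rw [norm_smul, Real.norm_of_nonneg hr'.le]; simp
    simp only [maximizerSymbol, hθ, inner_smul_left, inner_smul_right]
    simp
  rw [e1, sphereExp_smul_eq hd hx hr', ← Complex.ofReal_mul, Complex.real_smul, ← Complex.ofReal_mul,
    ← Complex.ofReal_mul, besselIntegrand, neg_div, Real.rpow_neg (by positivity)]
  congr 1
  have e2 := pow_mul_rpow_div_eq hd j n hr'
  rw [show j + d - 1 = (d : ℝ) + j - 1 by ring, smul_eq_mul] at e2
  rw [← e2]
  field_simp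

/-- Continuity, including at `0`, is inherited from the inverse transform of an integrable function,
restricted to a half-line. -/
theorem continuousOn_radialProfile {d : ℕ} (hd : 1 ≤ d) {j n : ℝ} (hn : 0 < n) (hj : 0 ≤ j)
    (h1 : j + d < 2 * n) : ContinuousOn (radialProfile d j n) (Ici 0) := by
  have hm := integrable_maximizerFourier d (integrable_maximizerSymbol hd hn hj h1)
  have hc : Continuous (maximizerFun d j n) := by
    rw [maximizerFun_eq]
    exact map_continuous (fourierInvC0 _ hm)
  have hc2 : Continuous (fun ρ : ℝ => (maximizerFun d j n (EuclideanSpace.single ⟨0, hd⟩ ρ)).re) := by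
    refine Complex.continuous_re.comp (hc.comp ?_)
    have : (fun ρ : ℝ => (EuclideanSpace.single ⟨0, hd⟩ ρ : RSpace d)) =
        fun ρ : ℝ => ρ • (EuclideanSpace.single ⟨0, hd⟩ 1 : RSpace d) := by
      ext ρ i
      simp
    change Continuous (fun ρ : ℝ => (EuclideanSpace.single ⟨0, hd⟩ ρ : RSpace d))
    rw [this]
    fun_prop
  refine hc2.continuousOn.congr fun ρ hρ => ?_
  simp only [maximizerFun_eq_radialProfile hd hn hj h1, Complex.ofReal_re]
  simp [abs_of_nonneg (show (0 : ℝ) ≤ ρ from hρ)]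

/-- The maximizer as an element of `C₀`. -/
theorem exists_C0_maximizerFun {d : ℕ} (hd : 1 ≤ d) {j n : ℝ} (hn : 0 < n) (hj : 0 ≤ j)
    (h1 : j + d < 2 * n) : ∃ f : C₀(RSpace d, ℂ), ∀ x, f x = maximizerFun d j n x :=
  ⟨fourierInvC0 _ (integrable_maximizerFourier d (integrable_maximizerSymbol hd hn hj h1)),
    fun x => by rw [fourierInvC0_apply, maximizerFun_eq]⟩

end

/-! ### Growth and decay of `Γ` in vertical strips -/

section

open scoped Nat

/-- The Beta integral at `(s, δ)` is bounded in modulus by the one at `(Re s, δ)`. Since it equals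
`Γ(s)Γ(δ)/Γ(s+δ)`, the quotient `|Γ(s)| / |Γ(s+δ)|` is largest at the real point of the vertical
line. -/
theorem norm_Gamma_mul_le {s : ℂ} (hs : 0 < s.re) {δ : ℝ} (hδ : 0 < δ) :
    ‖Complex.Gamma s‖ * Real.Gamma (s.re + δ) ≤ ‖Complex.Gamma (s + δ)‖ * Real.Gamma s.re := by
  have hδ' : 0 < ((δ : ℝ) : ℂ).re := by simpa using hδ
  have h1 := Complex.Gamma_mul_Gamma_eq_betaIntegral hs hδ'
  have hsr : 0 < ((s.re : ℝ) : ℂ).re := by simpa using hs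
  have h2 := Complex.Gamma_mul_Gamma_eq_betaIntegral hsr hδ'
  have hGδ := Real.Gamma_pos_of_pos hδ
  have hGs := Real.Gamma_pos_of_pos hs
  have hGsd := Real.Gamma_pos_of_pos (by positivity : 0 < s.re + δ)
  set R : ℝ := ∫ x in (0 : ℝ)..1, x ^ (s.re - 1) * (1 - x) ^ (δ - 1) with hR
  have hbR : Complex.betaIntegral (s.re : ℂ) (δ : ℂ) = (R : ℂ) := by
    rw [Complex.betaIntegral, hR, ← intervalIntegral.integral_ofReal]
    refine intervalIntegral.integral_congr fun x hx => ?_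
    rw [uIcc_of_le zero_le_one] at hx
    rw [Complex.ofReal_mul, Complex.ofReal_cpow hx.1, Complex.ofReal_cpow (by linarith [hx.2])]
    push_cast
    rfl
  have hb : ‖Complex.betaIntegral s (δ : ℂ)‖ ≤ R := by
    rw [Complex.betaIntegral, hR]
    refine (intervalIntegral.norm_integral_le_integral_norm zero_le_one).trans (le_of_eq ?_)
    refine intervalIntegral.integral_congr_Ioo_of_le zero_le_one fun x hx => ?_
    have e : (1 : ℂ) - x = ((1 - x : ℝ) : ℂ) := by push_cast; rfl
    rw [norm_mul, e, Complex.norm_cpow_eq_rpow_re_of_pos hx.1,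
      Complex.norm_cpow_eq_rpow_re_of_pos (by linarith [hx.2])]
    simp
  rw [hbR, Complex.Gamma_ofReal, ← Complex.ofReal_add, Complex.Gamma_ofReal, Complex.Gamma_ofReal,
    ← Complex.ofReal_mul, ← Complex.ofReal_mul] at h2
  have h2' := Complex.ofReal_injective h2
  have h3 := congrArg norm h1
  rw [norm_mul, norm_mul, Complex.Gamma_ofReal, Complex.norm_real, Real.norm_of_nonneg hGδ.le] at h3
  have h4 : ‖Complex.Gamma s‖ * Real.Gamma δ ≤ ‖Complex.Gamma (s + δ)‖ * R :=
    h3.le.trans (mul_le_mul_of_nonneg_left hb (norm_nonneg _))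
  refine le_of_mul_le_mul_right ?_ hGδ
  calc ‖Complex.Gamma s‖ * Real.Gamma (s.re + δ) * Real.Gamma δ
      = (‖Complex.Gamma s‖ * Real.Gamma δ) * Real.Gamma (s.re + δ) := by ring
    _ ≤ (‖Complex.Gamma (s + δ)‖ * R) * Real.Gamma (s.re + δ) :=
        mul_le_mul_of_nonneg_right h4 hGsd.le
    _ = ‖Complex.Gamma (s + δ)‖ * (Real.Gamma (s.re + δ) * R) := by ring
    _ = _ := by rw [← h2']; ring

theorem Gamma_add_nat_eq_prod {s : ℂ} (hs : s.im ≠ 0) (N : ℕ) :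
    Complex.Gamma (s + N) = (∏ l ∈ Finset.range N, (s + l)) * Complex.Gamma s := by
  induction N with
  | zero => simp
  | succ N ih =>
    have hne : s + N ≠ 0 := by
      intro h
      apply hs
      have := congrArg Complex.im h
      simpa using this
    rw [Nat.cast_succ, ← add_assoc, Complex.Gamma_add_one _ hne, ih, Finset.prod_range_succ]
    ring

/-- In a vertical strip, the quotient of two values of `Γ` at points with the same imaginary part
grows at most polynomially. -/
theorem exists_norm_Gamma_le_mul_norm_Gamma {K : ℝ} (hK : 0 ≤ K) : ∃ (C : ℝ) (m : ℕ), 0 < C ∧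
    ∀ s s' : ℂ, |s.re| ≤ K → |s'.re| ≤ K → s.im = s'.im → 1 ≤ |s.im| →
      ‖Complex.Gamma s‖ ≤ C * |s.im| ^ m * ‖Complex.Gamma s'‖ := by
  obtain ⟨N, hN⟩ := exists_nat_ge (K + 2)
  -- As `N ≥ K + 2`, the point `s + N` has real part at least `2`, in the range where the real `Γ`
  -- is increasing. The choice `3 * N` puts `s' + M` to the right of `s + N`, so `norm_Gamma_mul_le`
  -- compares the two.
  set M : ℕ := 3 * N with hM
  have hG0 : 0 < Real.Gamma (N + K) := Real.Gamma_pos_of_pos (by linarith)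
  refine ⟨Real.Gamma (N + K) * (K + M + 1) ^ M, M, by positivity, ?_⟩
  intro s s' hs hs' him ht
  have hs1 := abs_le.1 hs
  have hs2 := abs_le.1 hs'
  have h0 : s.im ≠ 0 := by
    intro h; rw [h, abs_zero] at ht; linarith
  have h0' : s'.im ≠ 0 := him ▸ h0
  have e1 : ‖Complex.Gamma s‖ ≤ ‖Complex.Gamma (s + N)‖ := by
    rw [Gamma_add_nat_eq_prod h0, norm_mul, norm_prod]
    refine le_mul_of_one_le_left (norm_nonneg _) (Finset.one_le_prod fun l _ => ?_)
    refine ht.trans ?_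
    have := Complex.abs_im_le_norm (s + l)
    simpa using this
  have hre : (s + N).re = s.re + N := by simp
  have hre' : (s' + M).re = s'.re + M := by simp
  have hMr : (M : ℝ) = 3 * N := by rw [hM]; push_cast; ring
  have e2 := norm_Gamma_mul_le (s := s + N) (by rw [hre]; linarith)
    (δ := (s'.re + M) - (s.re + N)) (by rw [hMr]; linarith)
  have e3 : s + N + (((s'.re + M) - (s.re + N) : ℝ) : ℂ) = s' + M := by
    apply Complex.ext
    · simp
    · simp [him]
  rw [e3, hre, add_sub_cancel] at e2
  have e4 : 1 ≤ Real.Gamma (s'.re + M) := by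
    rw [← Real.Gamma_two]
    exact Real.Gamma_strictMonoOn_Ici.monotoneOn (by simp)
      (by simp only [mem_Ici]; rw [hMr]; linarith) (by rw [hMr]; linarith)
  have e5 : Real.Gamma (s.re + N) ≤ Real.Gamma (N + K) :=
    Real.Gamma_strictMonoOn_Ici.monotoneOn (by simp only [mem_Ici]; linarith)
      (by simp only [mem_Ici]; linarith) (by linarith)
  have e6 : ‖Complex.Gamma (s + N)‖ ≤ ‖Complex.Gamma (s' + M)‖ * Real.Gamma (N + K) :=
    ((le_mul_of_one_le_right (norm_nonneg _) e4).trans e2).trans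
      (mul_le_mul_of_nonneg_left e5 (norm_nonneg _))
  have e7 : ‖Complex.Gamma (s' + M)‖ ≤ ((K + M + 1) * |s.im|) ^ M * ‖Complex.Gamma s'‖ := by
    rw [Gamma_add_nat_eq_prod h0', norm_mul, norm_prod]
    refine mul_le_mul_of_nonneg_right ?_ (norm_nonneg _)
    refine (Finset.prod_le_prod (fun _ _ => norm_nonneg _) fun l hl => ?_).trans
      (le_of_eq (by rw [Finset.prod_const, Finset.card_range]))
    have hl' : (l : ℝ) ≤ M := by exact_mod_cast (Finset.mem_range.1 hl).le
    refine (Complex.norm_le_abs_re_add_abs_im _).trans ?_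
    simp only [Complex.add_re, Complex.natCast_re, Complex.add_im, Complex.natCast_im, add_zero,
      ← him]
    have hl0 : (0 : ℝ) ≤ l := Nat.cast_nonneg l
    have hM0 : (0 : ℝ) ≤ M := Nat.cast_nonneg M
    have : |s'.re + l| ≤ K + M := abs_le.2 ⟨by linarith, by linarith⟩
    nlinarith
  calc ‖Complex.Gamma s‖ ≤ ‖Complex.Gamma (s' + M)‖ * Real.Gamma (N + K) := e1.trans e6
    _ ≤ (((K + M + 1) * |s.im|) ^ M * ‖Complex.Gamma s'‖) * Real.Gamma (N + K) :=
        mul_le_mul_of_nonneg_right e7 hG0.le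
    _ = _ := by rw [mul_pow]; ring

/-- The sine is half the difference of two exponentials, up to a unimodular factor, and their moduli
are `exp (Im z)` and `exp (-Im z)`. -/
theorem abs_sinh_im_le_norm_sin (z : ℂ) : |Real.sinh z.im| ≤ ‖Complex.sin z‖ := by
  have h : ‖Complex.sin z‖ = ‖Complex.exp (-z * Complex.I) - Complex.exp (z * Complex.I)‖ / 2 := by
    rw [Complex.sin, norm_div, norm_mul, Complex.norm_I, mul_one]
    simp
  rw [h, Real.sinh_eq, abs_div, abs_two]
  have h2 := abs_norm_sub_norm_le (Complex.exp (-z * Complex.I)) (Complex.exp (z * Complex.I))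
  rw [Complex.norm_exp, Complex.norm_exp] at h2
  have e1 : (-z * Complex.I).re = z.im := by simp
  have e2 : (z * Complex.I).re = -z.im := by simp
  rw [e1, e2] at h2
  linarith

theorem pow_div_factorial_le_sinh {x : ℝ} (hx : 0 ≤ x) (k : ℕ) :
    x ^ (k + 1) / (2 * ((k + 1)! : ℝ)) ≤ Real.sinh x := by
  have h1 := Real.sum_le_exp_of_nonneg hx (k + 2)
  have h2 : 1 + x ^ (k + 1) / ((k + 1)! : ℝ) ≤ ∑ i ∈ Finset.range (k + 2), x ^ i / (i ! : ℝ) := by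
    rw [Finset.sum_range_succ]
    refine add_le_add_left ?_ _
    have := Finset.single_le_sum (f := fun i => x ^ i / (i ! : ℝ)) (s := Finset.range (k + 1))
      (fun i _ => by positivity) (Finset.mem_range.2 (Nat.succ_pos k))
    simpa using this
  have h3 : Real.exp (-x) ≤ 1 := Real.exp_le_one_iff.2 (by linarith)
  rw [Real.sinh_eq, mul_comm, ← div_div]
  linarith

/-- On vertical lines, `Γ(w) Γ(1-w)` decays faster than any power. -/
theorem norm_Gamma_mul_Gamma_one_sub_le (k : ℕ) {w : ℂ} (hw : w.im ≠ 0) :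
    ‖Complex.Gamma w * Complex.Gamma (1 - w)‖ ≤
      2 * Real.pi * ((k + 1)! : ℝ) / (Real.pi * |w.im|) ^ (k + 1) := by
  rw [Complex.Gamma_mul_Gamma_one_sub, norm_div, Complex.norm_real, Real.norm_of_nonneg Real.pi_pos.le]
  have h1 := abs_sinh_im_le_norm_sin (Real.pi * w)
  have e : ((Real.pi : ℂ) * w).im = Real.pi * w.im := by simp
  rw [e, Real.abs_sinh, abs_mul, abs_of_pos Real.pi_pos] at h1
  have h2 := (pow_div_factorial_le_sinh (by positivity : 0 ≤ Real.pi * |w.im|) k).trans h1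
  have hp : 0 < |w.im| := abs_pos.2 hw
  have h3 : 0 < (Real.pi * |w.im|) ^ (k + 1) / (2 * ((k + 1)! : ℝ)) := by positivity
  refine (div_le_div_of_nonneg_left Real.pi_pos.le h3 h2).trans (le_of_eq ?_)
  field_simp

/-- On vertical strips, `Γ` decays faster than `|Im s|^(-2)`. -/
theorem exists_norm_Gamma_le_inv_sq {K : ℝ} (hK : 0 ≤ K) : ∃ C : ℝ, 0 < C ∧
    ∀ s : ℂ, |s.re| ≤ K → 1 ≤ |s.im| → ‖Complex.Gamma s‖ ≤ C / s.im ^ 2 := by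
  obtain ⟨C, m, hC, h⟩ := exists_norm_Gamma_le_mul_norm_Gamma (K := K + 1) (by linarith)
  -- The power `2(m+2)` becomes `m+2` after a square root; the loss `|Im s|^m` from changing the
  -- real part then leaves `|Im s|^(-2)`.
  obtain ⟨k, hk⟩ : ∃ k, k + 1 = 2 * (m + 2) := ⟨2 * m + 3, by ring⟩
  set D : ℝ := 2 * Real.pi * ((k + 1)! : ℝ) / Real.pi ^ (k + 1) with hD
  have hD0 : 0 < D := by positivity
  refine ⟨C * Real.sqrt D, by positivity, fun s hs ht => ?_⟩
  have hp : 0 < |s.im| := by linarith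
  -- On `Re w = 1/2` one has `1 - w = conj w`, so the reflection product is `|Γ w|²` in modulus.
  set w : ℂ := 1 / 2 + s.im * Complex.I with hw
  have hwre : w.re = 1 / 2 := by simp [hw]
  have hwim : w.im = s.im := by simp [hw]
  have h1 := h s w (by linarith) (by rw [hwre, abs_of_pos] <;> linarith) hwim.symm ht
  have h2 := norm_Gamma_mul_Gamma_one_sub_le k (w := w) (by rw [hwim]; exact abs_pos.1 hp)
  have hconj : 1 - w = (starRingEnd ℂ) w := by
    apply Complex.ext
    · rw [Complex.sub_re, Complex.conj_re, hwre, Complex.one_re]; norm_num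
    · rw [Complex.sub_im, Complex.conj_im, Complex.one_im, zero_sub]
  rw [hconj, Complex.Gamma_conj, norm_mul, Complex.norm_conj, ← sq, mul_pow, ← div_div, ← hD,
    hwim] at h2
  have h3 : ‖Complex.Gamma w‖ ≤ Real.sqrt D / |s.im| ^ (m + 2) := by
    refine Real.le_sqrt_of_sq_le h2 |>.trans (le_of_eq ?_)
    rw [Real.sqrt_div hD0.le, hk, mul_comm 2, pow_mul, Real.sqrt_sq (by positivity)]
  calc ‖Complex.Gamma s‖ ≤ C * |s.im| ^ m * ‖Complex.Gamma w‖ := h1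
    _ ≤ C * |s.im| ^ m * (Real.sqrt D / |s.im| ^ (m + 2)) := by gcongr
    _ = C * Real.sqrt D / s.im ^ 2 := by
        rw [← sq_abs s.im, pow_add]
        field_simp

end

/-! ### Gauss's multiplication formula and the product formula for sines -/

section

open scoped Nat

/-- Each factor is `(N u + (N l + h)) / N`, and by division with remainder `N l + h` runs once
through `0, …, N m - 1`. -/
theorem prod_range_prod_range_add_div (N : ℕ) (hN : 1 ≤ N) (u : ℂ) (m : ℕ) :
    ∏ h ∈ Finset.range N, ∏ l ∈ Finset.range m, (u + h / N + l) =
      ((N : ℂ) ^ (N * m))⁻¹ * ∏ l ∈ Finset.range (N * m), (N * u + l) := by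
  have hN' : (N : ℂ) ≠ 0 := by exact_mod_cast (by omega : N ≠ 0)
  rw [Finset.prod_comm]
  induction m with
  | zero => simp
  | succ m ih =>
    rw [Finset.prod_range_succ, ih, Nat.mul_succ, Finset.prod_range_add]
    have : ∏ h ∈ Finset.range N, (u + h / N + m) =
        ((N : ℂ) ^ N)⁻¹ * ∏ h ∈ Finset.range N, (N * u + ((N * m + h : ℕ) : ℂ)) := by
      rw [eq_inv_mul_iff_mul_eq₀ (pow_ne_zero _ hN')]
      have e : (N : ℂ) ^ N = ∏ _h ∈ Finset.range N, (N : ℂ) := by simp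
      rw [e, ← Finset.prod_mul_distrib]
      refine Finset.prod_congr rfl fun h _ => ?_
      push_cast
      field_simp
      ring
    rw [this, pow_add, mul_inv]
    ring

/-- The finite form of the multiplication formula of Gauss for `Γ`. -/
theorem exists_prod_GammaSeq {N : ℕ} (hN : 1 ≤ N) {n : ℕ} (hn : n ≠ 0) : ∃ c : ℂ, c ≠ 0 ∧ ∀ u : ℂ,
    (∏ h ∈ Finset.range N, Complex.GammaSeq (u + h / N) n) *
      ((N * (n + 1) - 1 : ℕ) : ℂ) ^ (N * u) =
      c * (n : ℂ) ^ (N * u) * Complex.GammaSeq (N * u) (N * (n + 1) - 1) := by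
  have hN' : (N : ℂ) ≠ 0 := by exact_mod_cast (by omega : N ≠ 0)
  have hn' : (n : ℂ) ≠ 0 := by exact_mod_cast hn
  -- `GammaSeq · n` has `n + 1` factors in its denominator, so `N` of them merge into `GammaSeq` of
  -- index `N (n+1) - 1`.
  have hL : N * (n + 1) - 1 + 1 = N * (n + 1) := Nat.sub_add_cancel (by nlinarith)
  refine ⟨(∏ h ∈ Finset.range N, ((n : ℂ) ^ ((h : ℂ) / N) * (n ! : ℂ))) *
    (N : ℂ) ^ (N * (n + 1)) / ((N * (n + 1) - 1)! : ℂ), ?_, fun u => ?_⟩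
  · refine div_ne_zero (mul_ne_zero (Finset.prod_ne_zero_iff.2 fun h _ => ?_) (pow_ne_zero _ hN')) ?_
    · exact mul_ne_zero (by simp [Complex.cpow_eq_zero_iff, hn']) (by exact_mod_cast n.factorial_ne_zero)
    · exact_mod_cast Nat.factorial_ne_zero _
  · have hp : (n : ℂ) ^ (N * u) = ∏ _h ∈ Finset.range N, (n : ℂ) ^ u := by
      rw [Finset.prod_const, Finset.card_range, ← Complex.cpow_nat_mul]
    have e1 : ∀ h ∈ Finset.range N, Complex.GammaSeq (u + h / N) n =
        (n : ℂ) ^ u * ((n : ℂ) ^ ((h : ℂ) / N) * (n ! : ℂ)) *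
          (∏ l ∈ Finset.range (n + 1), (u + h / N + l))⁻¹ := by
      intro h _
      rw [Complex.GammaSeq, Complex.cpow_add _ _ hn', div_eq_mul_inv]
      ring
    rw [Finset.prod_congr rfl e1, Finset.prod_mul_distrib, Finset.prod_mul_distrib, ← hp,
      Finset.prod_inv_distrib, prod_range_prod_range_add_div N hN, Complex.GammaSeq, hL,
      mul_inv, inv_inv]
    have hf : (((N * (n + 1) - 1)! : ℕ) : ℂ) ≠ 0 := by exact_mod_cast Nat.factorial_ne_zero _
    have hNm : (N : ℂ) ^ (N * (n + 1)) ≠ 0 := pow_ne_zero _ hN'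
    generalize (N : ℂ) ^ (N * (n + 1)) = X at *
    generalize (((N * (n + 1) - 1)! : ℕ) : ℂ) = Y at *
    generalize ((N * (n + 1) - 1 : ℕ) : ℂ) ^ (N * u) = A
    generalize (n : ℂ) ^ (N * u) = B
    generalize ∏ h ∈ Finset.range N, ((n : ℂ) ^ ((h : ℂ) / N) * (n ! : ℂ)) = Q
    generalize (∏ l ∈ Finset.range (N * (n + 1)), (N * u + (l : ℂ)))= R
    simp only [div_eq_mul_inv]
    field_simp

/-- The multiplication formula of Gauss, in a form without the constant factor. -/
theorem prod_Gamma_mul_eq {N : ℕ} (hN : 1 ≤ N) (u v : ℂ) :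
    (∏ h ∈ Finset.range N, Complex.Gamma (u + h / N)) * (Complex.Gamma (N * v) * (N : ℂ) ^ (N * u)) =
      (∏ h ∈ Finset.range N, Complex.Gamma (v + h / N)) *
        (Complex.Gamma (N * u) * (N : ℂ) ^ (N * v)) := by
  -- The finite formula has the same constant `c` at `u` and at `v`, so it drops out when the two
  -- are compared; the powers converge because `L n / n → N`.
  let L : ℕ → ℕ := fun n => N * (n + 1) - 1
  have hNpos : (0 : ℝ) < N := by exact_mod_cast hN
  have hLt : Tendsto L atTop atTop := by
    refine tendsto_atTop_mono (fun n => ?_) tendsto_id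
    have : 1 * (n + 1) ≤ N * (n + 1) := Nat.mul_le_mul_right _ hN
    simp only [L, id]
    omega
  have hquot : Tendsto (fun n : ℕ => (((L n : ℝ) / n : ℝ) : ℂ)) atTop (𝓝 (((N : ℝ)) : ℂ)) := by
    refine (Complex.continuous_ofReal.tendsto _).comp ?_
    have h1 : Tendsto (fun n : ℕ => (N : ℝ) + ((N : ℝ) - 1) / n) atTop (𝓝 ((N : ℝ) + 0)) :=
      tendsto_const_nhds.add (tendsto_const_div_atTop_nhds_zero_nat _)
    rw [add_zero] at h1
    refine h1.congr' ?_
    filter_upwards [eventually_gt_atTop 0] with n hn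
    have hn' : (n : ℝ) ≠ 0 := by exact_mod_cast hn.ne'
    have : 1 ≤ N * (n + 1) := by nlinarith
    simp only [L]
    rw [Nat.cast_sub this]
    push_cast
    field_simp
    ring
  have hpow : ∀ w : ℂ, Tendsto (fun n : ℕ => (((L n : ℝ) / n : ℝ) : ℂ) ^ (N * w)) atTop
      (𝓝 ((N : ℂ) ^ (N * w))) := by
    intro w
    have hc : ContinuousAt (fun z : ℂ => z ^ (N * w)) (((N : ℝ)) : ℂ) :=
      continuousAt_cpow_const (Or.inl (by simpa using hNpos))
    simpa [Function.comp_def] using hc.tendsto.comp hquot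
  have hG : ∀ w : ℂ, Tendsto (fun n => ∏ h ∈ Finset.range N, Complex.GammaSeq (w + h / N) n) atTop
      (𝓝 (∏ h ∈ Finset.range N, Complex.Gamma (w + h / N))) := fun w =>
    tendsto_finsetProd _ fun h _ => Complex.GammaSeq_tendsto_Gamma _
  have hGN : ∀ w : ℂ, Tendsto (fun n => Complex.GammaSeq (N * w) (L n)) atTop
      (𝓝 (Complex.Gamma (N * w))) := fun w => (Complex.GammaSeq_tendsto_Gamma _).comp hLt
  refine tendsto_nhds_unique ((hG u).mul ((hGN v).mul (hpow u))) ?_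
  refine Tendsto.congr' ?_ ((hG v).mul ((hGN u).mul (hpow v)))
  filter_upwards [eventually_gt_atTop 0] with n hn
  obtain ⟨c, hc, h⟩ := exists_prod_GammaSeq hN hn.ne'
  have hn' : (n : ℂ) ≠ 0 := by exact_mod_cast hn.ne'
  have hq : ∀ w : ℂ, (((L n : ℝ) / n : ℝ) : ℂ) ^ (N * w) = (L n : ℂ) ^ (N * w) / (n : ℂ) ^ (N * w) := by
    intro w
    rw [div_eq_mul_inv, Complex.ofReal_mul, Complex.mul_cpow_ofReal_nonneg (by positivity)
      (by positivity), Complex.ofReal_inv, Complex.inv_cpow _ _ (by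
        rw [Complex.arg_ofReal_of_nonneg (by positivity)]; exact Real.pi_pos.ne), div_eq_mul_inv]
    simp
  have hne : ∀ w : ℂ, (n : ℂ) ^ (N * w) ≠ 0 := fun w => by simp [Complex.cpow_eq_zero_iff, hn']
  have hu := h u
  have hv := h v
  change _ * (L n : ℂ) ^ (N * u) = _ * Complex.GammaSeq (N * u) (L n) at hu
  change _ * (L n : ℂ) ^ (N * v) = _ * Complex.GammaSeq (N * v) (L n) at hv
  rw [hq, hq]
  have h1 := hne u
  have h2 := hne v
  generalize (n : ℂ) ^ (N * u) = a at *
  generalize (n : ℂ) ^ (N * v) = b at *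
  generalize (L n : ℂ) ^ (N * u) = a' at *
  generalize (L n : ℂ) ^ (N * v) = b' at *
  generalize Complex.GammaSeq (N * u) (L n) = G at *
  generalize Complex.GammaSeq (N * v) (L n) = G' at *
  generalize ∏ h ∈ Finset.range N, Complex.GammaSeq (u + h / N) n = P at *
  generalize ∏ h ∈ Finset.range N, Complex.GammaSeq (v + h / N) n = P' at *
  field_simp
  refine mul_left_cancel₀ hc ?_
  linear_combination (G * c * a) * hv - (G' * c * b) * hu

/-- With `x = exp(iπw)` and `y = x⁻¹`, the sines are, up to phases and factors `2i`, the factors of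
`x^M - y^M` over the `M`-th roots of unity. The phases multiply to `I^(M-1)`. -/
theorem prod_sin_add_div {M : ℕ} (hM : 1 ≤ M) (w : ℂ) :
    ∏ l ∈ Finset.range M, Complex.sin (Real.pi * (w + l / M)) =
      Complex.sin (Real.pi * (M * w)) / 2 ^ (M - 1) := by
  have hM0 : M ≠ 0 := by omega
  have hM' : (M : ℂ) ≠ 0 := by exact_mod_cast hM0
  set x : ℂ := Complex.exp (Real.pi * w * Complex.I) with hx
  set y : ℂ := Complex.exp (-(Real.pi * w * Complex.I)) with hy
  set η : ℂ := Complex.exp (Real.pi * Complex.I / M) with hη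
  have hζ := (Complex.isPrimitiveRoot_exp M hM0).inv
  set ζ : ℂ := (Complex.exp (2 * Real.pi * Complex.I / M))⁻¹ with hζdef
  have h1 : x ^ M - y ^ M = ∏ l ∈ Finset.range M, (x - ζ ^ l * y) := by
    rw [hζ.pow_sub_pow_eq_prod_sub_mul x y (by omega)]
    symm
    refine Finset.prod_nbij (fun l => ζ ^ l) ?_ ?_ ?_ (fun _ _ => rfl)
    · intro l _
      rw [Polynomial.mem_nthRootsFinset (by omega), ← pow_mul, mul_comm, pow_mul, hζ.pow_eq_one, one_pow]
    · intro a ha b hb hab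
      exact hζ.pow_inj (by simpa using ha) (by simpa using hb) hab
    · intro z hz
      rw [Finset.mem_coe, Polynomial.mem_nthRootsFinset (by omega)] at hz
      have : NeZero M := ⟨hM0⟩
      obtain ⟨i, hi, rfl⟩ := hζ.eq_pow_of_pow_eq_one hz
      exact ⟨i, by simpa using hi, rfl⟩
  have h2 : ∀ l ∈ Finset.range M, Complex.sin (Real.pi * (w + l / M)) =
      η ^ l * (x - ζ ^ l * y) * (2 * Complex.I)⁻¹ := by
    intro l _
    have e : ζ ^ l = Complex.exp (-(l * (2 * Real.pi * Complex.I / M))) := by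
      rw [hζdef, ← Complex.exp_neg, ← Complex.exp_nat_mul]
      congr 1
      ring
    have e2 : η ^ l = Complex.exp (l * (Real.pi * Complex.I / M)) := by
      rw [hη, ← Complex.exp_nat_mul]
    rw [e, e2, mul_sub, hx, hy, ← Complex.exp_add, ← Complex.exp_add, ← Complex.exp_add, Complex.sin,
      mul_inv, Complex.inv_I]
    have a1 : l * (Real.pi * Complex.I / M) + Real.pi * w * Complex.I =
        Real.pi * (w + l / M) * Complex.I := by ring
    have a2 : l * (Real.pi * Complex.I / M) + (-(l * (2 * Real.pi * Complex.I / M)) +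
        -(Real.pi * w * Complex.I)) = -(Real.pi * (w + l / M)) * Complex.I := by ring
    rw [a1, a2]
    ring
  have h3 : ∏ l ∈ Finset.range M, η ^ l = Complex.I ^ (M - 1) := by
    rw [Finset.prod_pow_eq_pow_sum, hη, ← Complex.exp_nat_mul]
    have hs : ((∑ i ∈ Finset.range M, i : ℕ) : ℂ) = M * ((M - 1 : ℕ) : ℂ) / 2 := by
      rw [eq_div_iff two_ne_zero]
      exact_mod_cast Finset.sum_range_id_mul_two M
    rw [hs]
    have hI : Complex.I = Complex.exp (Real.pi / 2 * Complex.I) := Complex.exp_pi_div_two_mul_I.symm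
    conv_rhs => rw [hI, ← Complex.exp_nat_mul]
    congr 1
    field_simp
  rw [Finset.prod_congr rfl h2, Finset.prod_mul_distrib, Finset.prod_mul_distrib, h3, ← h1,
    Finset.prod_const, Finset.card_range]
  have hxM : x ^ M = Complex.exp (Real.pi * (M * w) * Complex.I) := by
    rw [hx, ← Complex.exp_nat_mul]; congr 1; ring
  have hyM : y ^ M = Complex.exp (-(Real.pi * (M * w)) * Complex.I) := by
    rw [hy, ← Complex.exp_nat_mul]; congr 1; ring
  obtain ⟨m, rfl⟩ : ∃ m, M = m + 1 := ⟨M - 1, by omega⟩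
  rw [hxM, hyM, Complex.sin, Nat.add_sub_cancel, mul_inv, mul_pow, pow_succ, pow_succ, Complex.inv_I,
    neg_pow Complex.I m]
  have hI2 : Complex.I ^ m * ((-1) ^ m * Complex.I ^ m) = 1 := by
    rw [mul_left_comm, ← mul_pow, ← mul_pow, Complex.I_mul_I]
    norm_num
  generalize Complex.exp (-(Real.pi * ((m + 1 : ℕ) * w)) * Complex.I) = X
  generalize Complex.exp (Real.pi * ((m + 1 : ℕ) * w) * Complex.I) = Y
  rw [inv_pow]
  have h2m : (2 : ℂ) ^ m ≠ 0 := pow_ne_zero _ two_ne_zero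
  generalize (2 : ℂ) ^ m = Z at *
  field_simp
  linear_combination (X - Y) * hI2

end

/-! ### Paths in vertical strips and deformation of contours -/

/-- A `C^1` path at bounded distance from a vertical line, with bounded derivative. -/
structure IsStripPath (γ : ℝ → ℂ) (c B : ℝ) : Prop where
  contDiff : ContDiff ℝ 1 γ
  norm_sub_le : ∀ t, ‖γ t - (c + t * Complex.I)‖ ≤ B
  norm_deriv_le : ∀ t, ‖deriv γ t‖ ≤ B

/-- A continuous function which is `O(1/t)` belongs to `C₀`, hence is bounded. Only this boundedness
of the deviation from a line is used in the deformation argument. -/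
theorem exists_norm_le_of_isBigO_inv {u : ℝ → ℂ} (hu : Continuous u)
    (h : u =O[cocompact ℝ] fun t : ℝ => t⁻¹) : ∃ B, ∀ t, ‖u t‖ ≤ B := by
  have h0 : Tendsto u (cocompact ℝ) (𝓝 0) := by
    refine h.trans_tendsto ?_
    rw [← Metric.cobounded_eq_cocompact]
    exact tendsto_inv₀_cobounded
  let g : C₀(ℝ, ℂ) := ⟨⟨u, hu⟩, h0⟩
  exact ⟨‖g‖, fun t => g.toBCF.norm_coe_le_norm t⟩

theorem IsVerticalPath.exists_isStripPath {γ : ℝ → ℂ} {c : ℝ} (h : IsVerticalPath γ c) :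
    ∃ B, IsStripPath γ c B := by
  have h1 : Continuous (fun t : ℝ => γ t - (c + t * Complex.I)) :=
    h.contDiff.continuous.sub (by fun_prop)
  have h2 : Continuous (fun t : ℝ => deriv γ t - Complex.I) :=
    (h.contDiff.continuous_deriv le_rfl).sub continuous_const
  obtain ⟨B₁, hB₁⟩ := exists_norm_le_of_isBigO_inv h1 h.asymp
  obtain ⟨B₂, hB₂⟩ := exists_norm_le_of_isBigO_inv h2 h.asymp_deriv
  refine ⟨max B₁ (B₂ + 1), h.contDiff, fun t => (hB₁ t).trans (le_max_left _ _), fun t => ?_⟩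
  refine le_trans ?_ (le_max_right _ _)
  calc ‖deriv γ t‖ = ‖(deriv γ t - Complex.I) + Complex.I‖ := by rw [sub_add_cancel]
    _ ≤ ‖deriv γ t - Complex.I‖ + ‖Complex.I‖ := norm_add_le _ _
    _ ≤ B₂ + 1 := by rw [Complex.norm_I]; linarith [hB₂ t]

namespace IsStripPath

variable {γ : ℝ → ℂ} {c B : ℝ}

theorem abs_re_sub_le (h : IsStripPath γ c B) (t : ℝ) : |(γ t).re - c| ≤ B := by
  have := (Complex.abs_re_le_norm _).trans (h.norm_sub_le t)
  simpa using this

theorem abs_im_sub_le (h : IsStripPath γ c B) (t : ℝ) : |(γ t).im - t| ≤ B := by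
  have := (Complex.abs_im_le_norm _).trans (h.norm_sub_le t)
  simpa using this

theorem abs_re_le (h : IsStripPath γ c B) (t : ℝ) : |(γ t).re| ≤ |c| + B := by
  have h1 := h.abs_re_sub_le t
  have h2 := abs_add_le ((γ t).re - c) c
  rw [sub_add_cancel] at h2
  linarith

theorem continuous_deriv (h : IsStripPath γ c B) : Continuous (deriv γ) :=
  h.contDiff.continuous_deriv le_rfl

theorem hasDerivAt (h : IsStripPath γ c B) (t : ℝ) : HasDerivAt γ (deriv γ t) t :=
  (h.contDiff.differentiable one_ne_zero t).hasDerivAt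

theorem tendsto_norm (h : IsStripPath γ c B) (σ : ℂ) : Tendsto (fun t => ‖γ t - σ‖) (cocompact ℝ) atTop := by
  have h1 : Tendsto (fun t : ℝ => |t| + (-(B + ‖σ‖))) (cocompact ℝ) atTop :=
    tendsto_atTop_add_const_right _ _ (tendsto_norm_cocompact_atTop (E := ℝ))
  refine tendsto_atTop_mono (fun t => ?_) h1
  have h2 := (Complex.abs_im_le_norm (γ t))
  have h3 := norm_le_norm_sub_add (γ t) σ
  have h4 := h.abs_im_sub_le t
  have h5 := abs_sub_abs_le_abs_sub t (γ t).im
  rw [abs_sub_comm] at h5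
  linarith

/-- An integrand which decays quadratically in a strip is integrable along a path in this strip. -/
theorem integrable (h : IsStripPath γ c B) {f : ℂ → ℂ} (hf : Continuous fun t => f (γ t)) {C : ℝ}
    (hC : ∀ s : ℂ, |s.re| ≤ |c| + B → 1 ≤ |s.im| → ‖f s‖ ≤ C / s.im ^ 2) :
    Integrable fun t => deriv γ t * f (γ t) := by
  have hB : 0 ≤ B := (norm_nonneg _).trans (h.norm_sub_le 0)
  refine LocallyIntegrable.integrable_of_isBigO_cocompact (g := fun t : ℝ => (1 + t ^ 2)⁻¹)
    (h.continuous_deriv.mul hf).locallyIntegrable ?_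
    (integrable_inv_one_add_sq.integrableAtFilter _)
  -- For `|t| ≥ 2B + 2` one has `|Im γ t| ≥ |t|/2`, hence `(1 + t²)/8 ≤ (Im γ t)²`.
  refine Asymptotics.IsBigO.of_bound (B * (|C| * 8)) ?_
  have := (tendsto_norm_cocompact_atTop (E := ℝ)).eventually_ge_atTop (2 * B + 2)
  filter_upwards [this] with t ht
  rw [Real.norm_eq_abs] at ht
  have h4 := h.abs_im_sub_le t
  have h5 := abs_sub_abs_le_abs_sub t (γ t).im
  rw [abs_sub_comm] at h5
  have h6 : |t| / 2 ≤ |(γ t).im| := by linarith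
  have h7 := hC (γ t) (h.abs_re_le t) (by linarith)
  have h8 : (1 + t ^ 2) / 8 ≤ (γ t).im ^ 2 := by
    rw [← sq_abs (γ t).im, ← sq_abs t]
    nlinarith [abs_nonneg t]
  have h9 : 0 < 1 + t ^ 2 := by positivity
  rw [norm_mul, norm_inv, Real.norm_of_nonneg h9.le, mul_assoc]
  refine mul_le_mul (h.norm_deriv_le t) (h7.trans ?_) (norm_nonneg _) hB
  calc C / (γ t).im ^ 2 ≤ |C| / (γ t).im ^ 2 := div_le_div_of_nonneg_right (le_abs_self _) (sq_nonneg _)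
    _ ≤ |C| / ((1 + t ^ 2) / 8) := div_le_div_of_nonneg_left (abs_nonneg _) (by positivity) h8
    _ = |C| * 8 * (1 + t ^ 2)⁻¹ := by field_simp

/-- Inverse powers of order at least `2` have a single-valued primitive vanishing at both ends of
the path, so they do not feel on which side `σ` lies. -/
theorem tendsto_integral_inv_pow (h : IsStripPath γ c B) {σ : ℂ} (hσ : σ ∉ range γ) {m : ℕ}
    (hm : 2 ≤ m) : Tendsto (fun T : ℝ => ∫ t in (-T)..T, deriv γ t * ((γ t - σ) ^ m)⁻¹) atTop (𝓝 0) := by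
  have hne : ∀ t, γ t - σ ≠ 0 := fun t h0 => hσ ⟨t, sub_eq_zero.1 h0⟩
  obtain ⟨k, rfl⟩ : ∃ k, m = k + 2 := ⟨m - 2, by omega⟩
  have hk : ((k : ℂ) + 1) ≠ 0 := by exact_mod_cast k.succ_ne_zero
  have hd : ∀ t, HasDerivAt (fun t => -((k : ℂ) + 1)⁻¹ * ((γ t - σ) ^ (k + 1))⁻¹)
      (deriv γ t * ((γ t - σ) ^ (k + 2))⁻¹) t := by
    intro t
    have h1 := ((((h.hasDerivAt t).sub_const σ).pow (k + 1)).inv (pow_ne_zero _ (hne t))).const_mul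
      (-((k : ℂ) + 1)⁻¹)
    refine h1.congr_deriv ?_
    have := hne t
    have e : ((fun x => γ x - σ) ^ (k + 1)) t = (γ t - σ) ^ (k + 1) := rfl
    rw [e]
    simp only [Nat.add_sub_cancel]
    push_cast
    field_simp
    ring
  have hcont : Continuous fun t => deriv γ t * ((γ t - σ) ^ (k + 2))⁻¹ :=
    h.continuous_deriv.mul (((h.contDiff.continuous.sub continuous_const).pow _).inv₀
      fun t => pow_ne_zero _ (hne t))
  have hI : ∀ T : ℝ, ∫ t in (-T)..T, deriv γ t * ((γ t - σ) ^ (k + 2))⁻¹ =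
      -((k : ℂ) + 1)⁻¹ * ((γ T - σ) ^ (k + 1))⁻¹ - -((k : ℂ) + 1)⁻¹ * ((γ (-T) - σ) ^ (k + 1))⁻¹ :=
    fun T => intervalIntegral.integral_eq_sub_of_hasDerivAt (fun t _ => hd t)
      (hcont.intervalIntegrable _ _)
  simp_rw [hI]
  have hz : Tendsto (fun t => -((k : ℂ) + 1)⁻¹ * ((γ t - σ) ^ (k + 1))⁻¹) (cocompact ℝ) (𝓝 0) := by
    rw [← mul_zero (-((k : ℂ) + 1)⁻¹)]
    refine tendsto_const_nhds.mul ?_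
    have : Tendsto (fun t => (γ t - σ)⁻¹ ^ (k + 1)) (cocompact ℝ) (𝓝 (0 ^ (k + 1))) := by
      refine Tendsto.pow ?_ _
      exact tendsto_inv₀_cobounded.comp (tendsto_norm_atTop_iff_cobounded.1 (h.tendsto_norm σ))
    simpa using this
  rw [cocompact_eq_atBot_atTop] at hz
  have ht := hz.mono_left le_sup_right
  have hb := hz.mono_left le_sup_left
  simpa using ht.sub (hb.comp tendsto_neg_atTop_atBot)

end IsStripPath

/-- Taylor expansion by iterating `dslope`. The remainder is holomorphic on all of `U`, not only
near `σ`, so it can serve in place of the original function when the other poles are treated. -/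
theorem exists_eq_sum_add_pow_mul {U : Set ℂ} (hU : IsOpen U) {σ : ℂ} (hσ : σ ∈ U) {g : ℂ → ℂ}
    (hg : DifferentiableOn ℂ g U) (N : ℕ) : ∃ (c : ℕ → ℂ) (h : ℂ → ℂ), DifferentiableOn ℂ h U ∧
      ∀ z, g z = ∑ k ∈ Finset.range N, c k * (z - σ) ^ k + (z - σ) ^ N * h z := by
  induction N with
  | zero => exact ⟨0, g, hg, fun z => by simp⟩
  | succ N ih =>
    obtain ⟨c, h, hh, e⟩ := ih
    refine ⟨Function.update c N (h σ), dslope h σ,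
      (Complex.differentiableOn_dslope (hU.mem_nhds hσ)).2 hh, fun z => ?_⟩
    have h1 := sub_smul_dslope h σ z
    rw [smul_eq_mul] at h1
    rw [e, Finset.sum_range_succ, Function.update_self]
    have h2 : ∑ k ∈ Finset.range N, Function.update c N (h σ) k * (z - σ) ^ k =
        ∑ k ∈ Finset.range N, c k * (z - σ) ^ k := by
      refine Finset.sum_congr rfl fun k hk => ?_
      rw [Function.update_of_ne (Finset.mem_range.1 hk).ne]
    rw [h2]
    linear_combination -(z - σ) ^ N * h1

/-- The open vertical strip `|re s| < K`. -/
def verticalStrip (K : ℝ) : Set ℂ := {s | |s.re| < K}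

theorem isOpen_verticalStrip (K : ℝ) : IsOpen (verticalStrip K) :=
  isOpen_lt (by fun_prop) continuous_const

theorem verticalStrip_eq (K : ℝ) : verticalStrip K = Complex.reLm ⁻¹' Ioo (-K) K := by
  ext s
  simp [verticalStrip, abs_lt]

theorem convex_verticalStrip (K : ℝ) : Convex ℝ (verticalStrip K) := by
  rw [verticalStrip_eq]
  exact (convex_Ioo _ _).linear_preimage _

/-- `f` tends to zero at infinity in a vertical strip. -/
def VanishesInStrip (K : ℝ) (f : ℂ → ℂ) : Prop :=
  ∀ ε > 0, ∃ Y : ℝ, 0 < Y ∧ ∀ s ∈ verticalStrip K, Y ≤ |s.im| → ‖f s‖ ≤ ε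

/-- The two paths stay at bounded distance from one another at equal times, while the derivative `f`
is small high up in the strip; the mean value inequality concludes. -/
theorem tendsto_sub_of_hasDerivAt {K : ℝ} {f G : ℂ → ℂ} (hf : VanishesInStrip K f)
    (hG : ∀ s ∈ verticalStrip K, HasDerivAt G (f s) s) {γ₁ γ₂ : ℝ → ℂ} {c₁ B₁ c₂ B₂ : ℝ}
    (h₁ : IsStripPath γ₁ c₁ B₁) (h₂ : IsStripPath γ₂ c₂ B₂) (hK₁ : |c₁| + B₁ < K)
    (hK₂ : |c₂| + B₂ < K) : Tendsto (fun t => G (γ₁ t) - G (γ₂ t)) (cocompact ℝ) (𝓝 0) := by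
  have hm₁ : ∀ t, γ₁ t ∈ verticalStrip K := fun t => (h₁.abs_re_le t).trans_lt hK₁
  have hm₂ : ∀ t, γ₂ t ∈ verticalStrip K := fun t => (h₂.abs_re_le t).trans_lt hK₂
  set D : ℝ := B₁ + B₂ + |c₁| + |c₂| + 1 with hD
  have hB₁ : 0 ≤ B₁ := (norm_nonneg _).trans (h₁.norm_sub_le 0)
  have hB₂ : 0 ≤ B₂ := (norm_nonneg _).trans (h₂.norm_sub_le 0)
  have hD0 : 0 < D := by positivity
  have hdist : ∀ t, ‖γ₁ t - γ₂ t‖ ≤ D := by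
    intro t
    have e : γ₁ t - γ₂ t = (γ₁ t - (c₁ + t * Complex.I)) - (γ₂ t - (c₂ + t * Complex.I)) +
        ((c₁ - c₂ : ℝ) : ℂ) := by push_cast; ring
    have h3 : ‖((c₁ - c₂ : ℝ) : ℂ)‖ ≤ |c₁| + |c₂| := by
      rw [Complex.norm_real]; exact abs_sub _ _
    rw [e]
    have h4 := norm_add_le ((γ₁ t - (c₁ + t * Complex.I)) - (γ₂ t - (c₂ + t * Complex.I)))
      ((c₁ - c₂ : ℝ) : ℂ)
    have h5 := norm_sub_le (γ₁ t - (c₁ + t * Complex.I)) (γ₂ t - (c₂ + t * Complex.I))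
    linarith [h₁.norm_sub_le t, h₂.norm_sub_le t]
  rw [Metric.tendsto_nhds]
  intro ε hε
  obtain ⟨Y, hY, hYf⟩ := hf (ε / (2 * D)) (by positivity)
  filter_upwards [(tendsto_norm_cocompact_atTop (E := ℝ)).eventually_ge_atTop (Y + B₁ + B₂)] with t ht
  rw [Real.norm_eq_abs] at ht
  rw [dist_zero_right]
  have key : ∀ W : Set ℂ, Convex ℝ W → γ₁ t ∈ W → γ₂ t ∈ W → (∀ s ∈ W, Y ≤ |s.im|) →
      ‖G (γ₁ t) - G (γ₂ t)‖ < ε := by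
    intro W hW hw₁ hw₂ hYW
    have hc := (convex_verticalStrip K).inter hW
    have := hc.norm_image_sub_le_of_norm_hasDerivWithin_le (f := G) (f' := f) (C := ε / (2 * D))
      (fun s hs => (hG s hs.1).hasDerivWithinAt) (fun s hs => hYf s hs.1 (hYW s hs.2))
      (⟨hm₂ t, hw₂⟩ : γ₂ t ∈ verticalStrip K ∩ W) ⟨hm₁ t, hw₁⟩
    calc _ ≤ ε / (2 * D) * ‖γ₁ t - γ₂ t‖ := this
      _ ≤ ε / (2 * D) * D := mul_le_mul_of_nonneg_left (hdist t) (by positivity)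
      _ = ε / 2 := by field_simp
      _ < ε := by linarith
  have a₁ := abs_le.1 (h₁.abs_im_sub_le t)
  have a₂ := abs_le.1 (h₂.abs_im_sub_le t)
  -- The parts of the strip above `Y` and below `-Y` are convex, so the segment joining the two
  -- points stays where `f` is small.
  rcases le_total 0 t with h0 | h0
  · rw [abs_of_nonneg h0] at ht
    refine key (Complex.imLm ⁻¹' Ici Y) ((convex_Ici _).linear_preimage _) ?_ ?_ fun s hs => ?_
    · simp only [mem_preimage, Complex.imLm_coe, mem_Ici]; linarith
    · simp only [mem_preimage, Complex.imLm_coe, mem_Ici]; linarith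
    · exact le_trans (by simpa using hs) (le_abs_self _)
  · rw [abs_of_nonpos h0] at ht
    refine key (Complex.imLm ⁻¹' Iic (-Y)) ((convex_Iic _).linear_preimage _) ?_ ?_ fun s hs => ?_
    · simp only [mem_preimage, Complex.imLm_coe, mem_Iic]; linarith
    · simp only [mem_preimage, Complex.imLm_coe, mem_Iic]; linarith
    · have : s.im ≤ -Y := by simpa using hs
      exact le_trans (by linarith) (neg_le_abs _)

theorem vanishesInStrip_inv_pow (K : ℝ) (σ : ℂ) {m : ℕ} (hm : 1 ≤ m) :
    VanishesInStrip K fun s => ((s - σ) ^ m)⁻¹ := by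
  intro ε hε
  refine ⟨max 1 ε⁻¹ + |σ.im|, by positivity, fun s _ hs => ?_⟩
  have h1 : max 1 ε⁻¹ ≤ ‖s - σ‖ := by
    have h2 := Complex.abs_im_le_norm (s - σ)
    have h3 := abs_sub_abs_le_abs_sub s.im σ.im
    rw [Complex.sub_im] at h2
    linarith
  have h1' : 1 ≤ ‖s - σ‖ := (le_max_left _ _).trans h1
  rw [norm_inv, norm_pow]
  refine inv_le_of_inv_le₀ hε (((le_max_right _ _).trans h1).trans ?_)
  exact le_self_pow₀ h1' (by omega)

theorem VanishesInStrip.sub {K : ℝ} {f g : ℂ → ℂ} (hf : VanishesInStrip K f)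
    (hg : VanishesInStrip K g) : VanishesInStrip K fun s => f s - g s := by
  intro ε hε
  obtain ⟨Y₁, h₁, h₁'⟩ := hf (ε / 2) (by positivity)
  obtain ⟨Y₂, h₂, h₂'⟩ := hg (ε / 2) (by positivity)
  refine ⟨max Y₁ Y₂, lt_max_of_lt_left h₁, fun s hs hY => (norm_sub_le _ _).trans ?_⟩
  linarith [h₁' s hs ((le_max_left _ _).trans hY), h₂' s hs ((le_max_right _ _).trans hY)]

theorem VanishesInStrip.const_mul {K : ℝ} {f : ℂ → ℂ} (hf : VanishesInStrip K f) (c : ℂ) :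
    VanishesInStrip K fun s => c * f s := by
  intro ε hε
  obtain ⟨Y, h, h'⟩ := hf (ε / (‖c‖ + 1)) (by positivity)
  refine ⟨Y, h, fun s hs hY => ?_⟩
  rw [norm_mul]
  calc ‖c‖ * ‖f s‖ ≤ (‖c‖ + 1) * (ε / (‖c‖ + 1)) :=
        mul_le_mul (by linarith) (h' s hs hY) (norm_nonneg _) (by positivity)
    _ = ε := by field_simp

theorem vanishesInStrip_sum {K : ℝ} {ι : Type*} (S : Finset ι) {f : ι → ℂ → ℂ}
    (hf : ∀ i ∈ S, VanishesInStrip K (f i)) : VanishesInStrip K fun s => ∑ i ∈ S, f i s := by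
  classical
  induction S using Finset.induction_on with
  | empty => exact fun ε hε => ⟨1, one_pos, fun s _ _ => by simpa using hε.le⟩
  | insert i S hi ih =>
    have h1 := hf i (Finset.mem_insert_self _ _)
    have h2 := (ih fun k hk => hf k (Finset.mem_insert_of_mem hk)).const_mul (-1)
    have := h1.sub h2
    refine (congrArg (VanishesInStrip K) ?_).mp this
    funext s
    rw [Finset.sum_insert hi]
    ring

/-- Two paths have the same side relation to a point. -/
def SameSide (σ : ℂ) (γ₁ γ₂ : ℝ → ℂ) : Prop :=
  (LiesLeftOf σ γ₁ ∧ LiesLeftOf σ γ₂) ∨ (LiesRightOf σ γ₁ ∧ LiesRightOf σ γ₂)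

theorem SameSide.notMem_left {σ : ℂ} {γ₁ γ₂ : ℝ → ℂ} (h : SameSide σ γ₁ γ₂) : σ ∉ range γ₁ :=
  h.elim (fun h => h.1.1) fun h => h.1.1

theorem SameSide.notMem_right {σ : ℂ} {γ₁ γ₂ : ℝ → ℂ} (h : SameSide σ γ₁ γ₂) : σ ∉ range γ₂ :=
  h.elim (fun h => h.2.1) fun h => h.2.1

/-- For `m = 1` both integrals have the same limit `±πi`, by the definition of the sides; for `m ≥
2` both tend to zero. -/
theorem SameSide.tendsto_integral_inv_pow_sub {σ : ℂ} {γ₁ γ₂ : ℝ → ℂ} (h : SameSide σ γ₁ γ₂)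
    {c₁ B₁ c₂ B₂ : ℝ} (h₁ : IsStripPath γ₁ c₁ B₁) (h₂ : IsStripPath γ₂ c₂ B₂) {m : ℕ} (hm : 1 ≤ m) :
    Tendsto (fun T : ℝ => (∫ t in (-T)..T, deriv γ₁ t * ((γ₁ t - σ) ^ m)⁻¹) -
      ∫ t in (-T)..T, deriv γ₂ t * ((γ₂ t - σ) ^ m)⁻¹) atTop (𝓝 0) := by
  rcases hm.eq_or_lt with rfl | hm
  · simp only [pow_one, ← div_eq_mul_inv]
    rcases h with h | h
    · simpa using h.1.2.sub h.2.2
    · simpa using h.1.2.sub h.2.2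
  · simpa using (h₁.tendsto_integral_inv_pow h.notMem_left hm).sub
      (h₂.tendsto_integral_inv_pow h.notMem_right hm)

/-- Deformation of contours: integrals of a meromorphic function along two paths in a strip having
the same position with respect to its poles. -/
theorem tendsto_integral_sub_of_sameSide {K : ℝ} {γ₁ γ₂ : ℝ → ℂ} {c₁ B₁ c₂ B₂ : ℝ}
    (h₁ : IsStripPath γ₁ c₁ B₁) (h₂ : IsStripPath γ₂ c₂ B₂) (hK₁ : |c₁| + B₁ < K)
    (hK₂ : |c₂| + B₂ < K) (S : Finset ℂ) (hS : ∀ σ ∈ S, SameSide σ γ₁ γ₂) (f : ℂ → ℂ)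
    (hf : DifferentiableOn ℂ f (verticalStrip K \ S)) (hmer : ∀ σ ∈ S, MeromorphicAt f σ)
    (hv : VanishesInStrip K f) :
    Tendsto (fun T : ℝ => (∫ t in (-T)..T, deriv γ₁ t * f (γ₁ t)) -
      ∫ t in (-T)..T, deriv γ₂ t * f (γ₂ t)) atTop (𝓝 0) := by
  classical
  have hm₁ : ∀ t, γ₁ t ∈ verticalStrip K := fun t => (h₁.abs_re_le t).trans_lt hK₁
  have hm₂ : ∀ t, γ₂ t ∈ verticalStrip K := fun t => (h₂.abs_re_le t).trans_lt hK₂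
  have hopen : ∀ S : Finset ℂ, IsOpen (verticalStrip K \ S) := fun S =>
    (isOpen_verticalStrip K).sdiff S.finite_toSet.isClosed
  have hcont : ∀ {γ : ℝ → ℂ} {c B : ℝ} (_ : IsStripPath γ c B) (S : Finset ℂ) (g : ℂ → ℂ)
      (_ : DifferentiableOn ℂ g (verticalStrip K \ S)) (_ : ∀ t, γ t ∈ verticalStrip K)
      (_ : ∀ σ ∈ S, σ ∉ range γ), Continuous fun t => deriv γ t * g (γ t) := by
    intro γ c B h S g hg hm hS
    exact h.continuous_deriv.mul (hg.continuousOn.comp_continuous h.contDiff.continuous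
      fun t => ⟨hm t, fun h0 => hS _ h0 ⟨t, rfl⟩⟩)
  -- One pole is removed at a time: off `σ`, `f` is a principal part plus a function `h` with one
  -- pole fewer, and the principal part contributes nothing in the limit.
  induction S using Finset.induction_on generalizing f with
  | empty =>
    -- Without poles, `f` has a primitive in the convex strip.
    obtain ⟨G, hG⟩ := (convex_verticalStrip K).exists_forall_hasDerivWithinAt
      (hf.mono (by simp))
    have hG' : ∀ s ∈ verticalStrip K, HasDerivAt G (f s) s := fun s hs =>
      (hG s hs).hasDerivAt ((isOpen_verticalStrip K).mem_nhds hs)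
    have hI : ∀ {γ : ℝ → ℂ} {c B : ℝ} (_ : IsStripPath γ c B) (_ : ∀ t, γ t ∈ verticalStrip K)
        (T : ℝ), ∫ t in (-T)..T, deriv γ t * f (γ t) = G (γ T) - G (γ (-T)) := by
      intro γ c B h hm T
      refine intervalIntegral.integral_eq_sub_of_hasDerivAt (f := fun t => G (γ t)) (fun t _ => ?_)
        ((hcont h ∅ f hf hm (by simp)).intervalIntegrable _ _)
      rw [mul_comm]
      exact (hG' _ (hm t)).comp_of_eq t (h.hasDerivAt t) rfl
    have ht := tendsto_sub_of_hasDerivAt hv hG' h₁ h₂ hK₁ hK₂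
    rw [cocompact_eq_atBot_atTop] at ht
    have h3 := (ht.mono_left le_sup_right).sub
      ((ht.mono_left le_sup_left).comp tendsto_neg_atTop_atBot)
    rw [sub_zero] at h3
    refine h3.congr fun T => ?_
    rw [hI h₁ hm₁, hI h₂ hm₂]
    simp only [Function.comp_apply]
    ring
  | insert σ S hσS ih =>
    by_cases hσK : σ ∈ verticalStrip K
    swap
    · refine ih (fun τ hτ => hS τ (Finset.mem_insert_of_mem hτ)) f (hf.mono fun s hs => ⟨hs.1, ?_⟩)
        (fun τ hτ => hmer τ (Finset.mem_insert_of_mem hτ)) hv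
      rw [Finset.coe_insert]
      rintro (rfl | h0)
      · exact hσK hs.1
      · exact hs.2 h0
    have hσ := hS σ (Finset.mem_insert_self _ _)
    obtain ⟨N, hN⟩ := hmer σ (Finset.mem_insert_self _ _)
    simp only [smul_eq_mul] at hN
    have hins : ∀ z, z ∈ verticalStrip K \ (S : Set ℂ) → z ≠ σ →
        z ∈ verticalStrip K \ ((insert σ S : Finset ℂ) : Set ℂ) := by
      intro z hz hne
      refine ⟨hz.1, ?_⟩
      rw [Finset.coe_insert]
      rintro (h0 | h0)
      · exact hne h0
      · exact hz.2 h0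
    have hF : DifferentiableOn ℂ (fun z => (z - σ) ^ N * f z) (verticalStrip K \ S) := by
      intro z hz
      by_cases hne : z = σ
      · rw [hne]; exact hN.differentiableAt.differentiableWithinAt
      · refine DifferentiableAt.differentiableWithinAt ?_
        exact DifferentiableAt.mul (by fun_prop)
          (hf.differentiableAt ((hopen _).mem_nhds (hins z hz hne)))
    obtain ⟨c, h, hh, e⟩ := exists_eq_sum_add_pow_mul (hopen S) (⟨hσK, by simpa using hσS⟩ :
      σ ∈ verticalStrip K \ (S : Set ℂ)) hF N
    -- The Taylor expansion of `(z-σ)^N f`, divided by `(z-σ)^N`. The point `σ` is excluded since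
    -- the inverse powers take the default value `0` there.
    have e' : ∀ z, z ≠ σ → f z = h z + ∑ k ∈ Finset.range N, c k * ((z - σ) ^ (N - k))⁻¹ := by
      intro z hz
      have hz' : z - σ ≠ 0 := sub_ne_zero.2 hz
      refine mul_left_cancel₀ (pow_ne_zero N hz') ?_
      rw [e z, mul_add, Finset.mul_sum, add_comm]
      congr 1
      refine Finset.sum_congr rfl fun k hk => ?_
      have hk' := (Finset.mem_range.1 hk).le
      rw [← Nat.sub_add_cancel hk', pow_add, Nat.sub_add_cancel hk']
      field_simp
    have hvh : VanishesInStrip K h := by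
      have h3 := hv.sub (vanishesInStrip_sum (Finset.range N) fun k hk =>
        (vanishesInStrip_inv_pow K σ (m := N - k) (by have := Finset.mem_range.1 hk; omega)).const_mul
          (c k))
      intro ε hε
      obtain ⟨Y, hY, hY'⟩ := h3 ε hε
      refine ⟨Y + |σ.im|, by positivity, fun s hs hsY => ?_⟩
      have hne : s ≠ σ := by
        rintro rfl
        linarith
      have := hY' s hs (by linarith [abs_nonneg σ.im])
      beta_reduce at this
      rwa [e' s hne, add_sub_cancel_right] at this
    have hmh : ∀ τ ∈ S, MeromorphicAt h τ := by
      intro τ hτ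
      have hne : τ ≠ σ := fun h0 => hσS (h0 ▸ hτ)
      have h3 : MeromorphicAt (fun z => f z - ∑ k ∈ Finset.range N, c k * ((z - σ) ^ (N - k))⁻¹) τ := by
        refine (hmer τ (Finset.mem_insert_of_mem hτ)).sub ?_
        refine MeromorphicAt.fun_sum fun k => ?_
        fun_prop
      refine h3.congr ?_
      filter_upwards [nhdsWithin_le_nhds (isOpen_ne.mem_nhds hne)] with z hz
      rw [e' z hz, add_sub_cancel_right]
    have ihh := ih (fun τ hτ => hS τ (Finset.mem_insert_of_mem hτ)) h hh hmh hvh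
    have hI : ∀ {γ : ℝ → ℂ} {c' B : ℝ} (_ : IsStripPath γ c' B) (_ : ∀ t, γ t ∈ verticalStrip K)
        (_ : ∀ τ ∈ S, τ ∉ range γ) (_ : σ ∉ range γ) (T : ℝ), ∫ t in (-T)..T, deriv γ t * f (γ t) =
        (∫ t in (-T)..T, deriv γ t * h (γ t)) +
          ∑ k ∈ Finset.range N, c k * ∫ t in (-T)..T, deriv γ t * ((γ t - σ) ^ (N - k))⁻¹ := by
      intro γ c' B hγ hm hS hσ T
      have hne : ∀ t, γ t ≠ σ := fun t h0 => hσ ⟨t, h0⟩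
      have hci : ∀ k, Continuous fun t => deriv γ t * ((γ t - σ) ^ (N - k))⁻¹ := fun k =>
        hγ.continuous_deriv.mul (((hγ.contDiff.continuous.sub continuous_const).pow _).inv₀
          fun t => pow_ne_zero _ (sub_ne_zero.2 (hne t)))
      simp_rw [← intervalIntegral.integral_const_mul]
      rw [← intervalIntegral.integral_finsetSum fun k _ =>
        ((hci k).const_mul (c k)).intervalIntegrable _ _, ← intervalIntegral.integral_add
        ((hcont hγ S h hh hm hS).intervalIntegrable _ _)
        ((continuous_finsetSum _ fun k _ => (hci k).const_mul (c k)).intervalIntegrable _ _)]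
      refine intervalIntegral.integral_congr fun t _ => ?_
      rw [e' _ (hne t), mul_add, Finset.mul_sum]
      congr 1
      exact Finset.sum_congr rfl fun k _ => by ring
    have h4 := ihh.add (tendsto_finsetSum (Finset.range N) fun k hk =>
      (hσ.tendsto_integral_inv_pow_sub h₁ h₂ (m := N - k)
        (by have := Finset.mem_range.1 hk; omega)).const_mul (c k))
    simp only [mul_zero, Finset.sum_const_zero, add_zero] at h4
    refine h4.congr fun T => ?_
    rw [hI h₁ hm₁ (fun τ hτ => (hS τ (Finset.mem_insert_of_mem hτ)).notMem_left) hσ.notMem_left,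
      hI h₂ hm₂ (fun τ hτ => (hS τ (Finset.mem_insert_of_mem hτ)).notMem_right) hσ.notMem_right]
    simp only [mul_sub, Finset.sum_sub_distrib]
    ring

/-- The integral of a meromorphic function along a path going up in a vertical strip depends only on
the position of the path with respect to the poles. -/
theorem integral_eq_of_sameSide {γ₁ γ₂ : ℝ → ℂ} {c₁ B₁ c₂ B₂ : ℝ} (h₁ : IsStripPath γ₁ c₁ B₁)
    (h₂ : IsStripPath γ₂ c₂ B₂) {P : Set ℂ} (hP : ∀ σ ∈ P, SameSide σ γ₁ γ₂)
    (hfin : ∀ K, (P ∩ verticalStrip K).Finite) {f : ℂ → ℂ}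
    (hf : ∀ s ∉ P, DifferentiableAt ℂ f s) (hmer : ∀ σ ∈ P, MeromorphicAt f σ)
    (hdec : ∀ K : ℝ, 0 ≤ K → ∃ C : ℝ, ∀ s : ℂ, |s.re| ≤ K → 1 ≤ |s.im| → ‖f s‖ ≤ C / s.im ^ 2) :
    (Integrable fun t => deriv γ₁ t * f (γ₁ t)) ∧
      ∫ t, deriv γ₁ t * f (γ₁ t) = ∫ t, deriv γ₂ t * f (γ₂ t) := by
  have hB₁ : 0 ≤ B₁ := (norm_nonneg _).trans (h₁.norm_sub_le 0)
  have hB₂ : 0 ≤ B₂ := (norm_nonneg _).trans (h₂.norm_sub_le 0)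
  set K : ℝ := |c₁| + B₁ + (|c₂| + B₂) + 1 with hK
  have hK₁ : |c₁| + B₁ < K := by have := abs_nonneg c₂; linarith
  have hK₂ : |c₂| + B₂ < K := by have := abs_nonneg c₁; linarith
  obtain ⟨C, hC⟩ := hdec K (by positivity)
  have hi₁ : Integrable fun t => deriv γ₁ t * f (γ₁ t) := by
    refine h₁.integrable (C := C) ?_ fun s hs hs' => hC s (hs.trans hK₁.le) hs'
    refine continuous_iff_continuousAt.2 fun t => ?_
    exact ContinuousAt.comp (hf _ fun h0 => (hP _ h0).notMem_left ⟨t, rfl⟩).continuousAt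
      h₁.contDiff.continuous.continuousAt
  have hi₂ : Integrable fun t => deriv γ₂ t * f (γ₂ t) := by
    refine h₂.integrable (C := C) ?_ fun s hs hs' => hC s (hs.trans hK₂.le) hs'
    refine continuous_iff_continuousAt.2 fun t => ?_
    exact ContinuousAt.comp (hf _ fun h0 => (hP _ h0).notMem_right ⟨t, rfl⟩).continuousAt
      h₂.contDiff.continuous.continuousAt
  refine ⟨hi₁, ?_⟩
  have hv : VanishesInStrip K f := by
    intro ε hε
    refine ⟨max 1 (|C| / ε), by positivity, fun s hs hY => ?_⟩
    have h1 : 1 ≤ |s.im| := (le_max_left _ _).trans hY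
    have h2 : |C| / ε ≤ |s.im| := (le_max_right _ _).trans hY
    refine (hC s (le_of_lt hs) h1).trans ?_
    rw [div_le_iff₀ (by rw [← sq_abs]; positivity), ← sq_abs]
    rw [div_le_iff₀ hε] at h2
    have h3 : |s.im| * ε ≤ |s.im| ^ 2 * ε :=
      mul_le_mul_of_nonneg_right (le_self_pow₀ h1 two_ne_zero) hε.le
    linarith [le_abs_self C]
  have ht := tendsto_integral_sub_of_sameSide h₁ h₂ hK₁ hK₂ (hfin K).toFinset
    (fun σ hσ => hP σ ((hfin K).mem_toFinset.1 hσ).1) f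
    (fun s hs => (hf s fun h0 => hs.2 (by simpa using ⟨h0, hs.1⟩)).differentiableWithinAt)
    (fun σ hσ => hmer σ ((hfin K).mem_toFinset.1 hσ).1) hv
  have ht₁ := intervalIntegral_tendsto_integral hi₁ tendsto_neg_atTop_atBot tendsto_id
  have ht₂ := intervalIntegral_tendsto_integral hi₂ tendsto_neg_atTop_atBot tendsto_id
  exact sub_eq_zero.1 (tendsto_nhds_unique (ht₁.sub ht₂) ht)

/-! ### Vertical lines as contours -/

/-- The two logarithms are conjugate, so their difference is `2i arg(b + iT)`, and `arg(b + iT) =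
arg(b/T + i)` tends to `π/2`. -/
theorem tendsto_log_sub_log {b : ℝ} (hb : 0 < b) :
    Tendsto (fun T : ℝ => Complex.log (b + T * Complex.I) - Complex.log (b + (-T : ℝ) * Complex.I))
      atTop (𝓝 (Real.pi * Complex.I)) := by
  have h1 : ∀ T : ℝ, Complex.log (b + T * Complex.I) - Complex.log (b + (-T : ℝ) * Complex.I) =
      ((2 * Complex.arg (b + T * Complex.I) : ℝ) : ℂ) * Complex.I := by
    intro T
    have e : (b : ℂ) + (-T : ℝ) * Complex.I = (starRingEnd ℂ) (b + T * Complex.I) := by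
      simp
    have hs : (b + T * Complex.I : ℂ).arg ≠ Real.pi := by
      have : (b + T * Complex.I : ℂ) ∈ Complex.slitPlane := Or.inl (by simpa using hb)
      exact (Complex.mem_slitPlane_iff_arg.1 this).1
    rw [e, Complex.log_conj _ hs]
    apply Complex.ext <;> simp [Complex.log_re, Complex.log_im]
    ring
  simp_rw [h1]
  refine Tendsto.mul_const _ ?_
  refine (Complex.continuous_ofReal.tendsto _).comp ?_
  have h2 : Tendsto (fun T : ℝ => Complex.arg (((b / T : ℝ) : ℂ) + Complex.I)) atTop
      (𝓝 (Complex.arg Complex.I)) := by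
    have hc : ContinuousAt Complex.arg Complex.I := Complex.continuousAt_arg (by simp [Complex.mem_slitPlane_iff])
    refine hc.tendsto.comp ?_
    have h3 : Tendsto (fun T : ℝ => ((b / T : ℝ) : ℂ) + Complex.I) atTop (𝓝 (((0 : ℝ) : ℂ) + Complex.I)) :=
      ((Complex.continuous_ofReal.tendsto _).comp (tendsto_const_nhds.div_atTop tendsto_id)).add_const _
    simpa using h3
  rw [Complex.arg_I] at h2
  have h4 := h2.const_mul 2
  rw [mul_div_cancel₀ _ (two_ne_zero' ℝ)] at h4
  refine h4.congr' ?_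
  filter_upwards [eventually_gt_atTop 0] with T hT
  rw [← Complex.arg_real_mul _ hT]
  congr 3
  push_cast
  have : (T : ℂ) ≠ 0 := by exact_mod_cast hT.ne'
  field_simp

theorem hasDerivAt_line (c t : ℝ) : HasDerivAt (fun t : ℝ => (c : ℂ) + t * Complex.I) Complex.I t := by
  have := ((Complex.ofRealCLM.hasDerivAt (x := t)).mul_const Complex.I).const_add (c : ℂ)
  simpa using this

theorem deriv_line (c t : ℝ) : deriv (fun t : ℝ => (c : ℂ) + t * Complex.I) t = Complex.I :=
  (hasDerivAt_line c t).deriv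

theorem isVerticalPath_line (c : ℝ) : IsVerticalPath (fun t : ℝ => (c : ℂ) + t * Complex.I) c where
  contDiff := by
    have : ContDiff ℝ 1 (fun t : ℝ => (t : ℂ)) := Complex.ofRealCLM.contDiff
    fun_prop
  asymp := by simp [Asymptotics.isBigO_zero]
  asymp_deriv := by simp [deriv_line, Asymptotics.isBigO_zero]

theorem liesLeftOf_line {c σ : ℝ} (h : σ < c) :
    LiesLeftOf (σ : ℂ) (fun t : ℝ => (c : ℂ) + t * Complex.I) := by
  constructor
  · rintro ⟨t, ht⟩
    have := congrArg Complex.re ht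
    simp at this
    exact h.ne' this
  · have hb : 0 < c - σ := by linarith
    refine (tendsto_log_sub_log hb).congr fun T => ?_
    have hm : ∀ t : ℝ, (((c - σ : ℝ) : ℂ) + t * Complex.I) ∈ Complex.slitPlane := fun t =>
      Or.inl (by simpa using hb)
    symm
    refine intervalIntegral.integral_eq_sub_of_hasDerivAt
      (f := fun t : ℝ => Complex.log (((c - σ : ℝ) : ℂ) + t * Complex.I)) (fun t _ => ?_) ?_
    · have := (hasDerivAt_line (c - σ) t).clog_real (hm t)
      refine this.congr_deriv ?_
      rw [deriv_line]
      congr 1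
      push_cast
      ring
    · refine Continuous.intervalIntegrable ?_ _ _
      simp_rw [deriv_line]
      refine continuous_const.div (by fun_prop) fun t h0 => ?_
      refine Complex.slitPlane_ne_zero (hm t) (Eq.trans ?_ h0)
      push_cast
      ring

/-- Here `c + it - σ` crosses the cut of the logarithm, so the primitive is the logarithm of the
opposite vector, which stays in the right half-plane. -/
theorem liesRightOf_line {c σ : ℝ} (h : c < σ) :
    LiesRightOf (σ : ℂ) (fun t : ℝ => (c : ℂ) + t * Complex.I) := by
  constructor
  · rintro ⟨t, ht⟩
    have := congrArg Complex.re ht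
    simp at this
    exact h.ne this
  · have hb : 0 < σ - c := by linarith
    refine (tendsto_log_sub_log hb).neg.congr fun T => ?_
    have hm : ∀ t : ℝ, (((σ - c : ℝ) : ℂ) + (-t : ℝ) * Complex.I) ∈ Complex.slitPlane := fun t =>
      Or.inl (by simpa using hb)
    symm
    have key := intervalIntegral.integral_eq_sub_of_hasDerivAt (a := -T) (b := T)
      (f := fun t : ℝ => Complex.log (((σ - c : ℝ) : ℂ) + (-t : ℝ) * Complex.I))
      (f' := fun t : ℝ => deriv (fun t : ℝ => (c : ℂ) + t * Complex.I) t / (c + t * Complex.I - σ))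
      (fun t _ => ?_) ?_
    · rw [key, neg_sub, neg_neg]
    · have := ((hasDerivAt_line (σ - c) (-t)).scomp t (hasDerivAt_neg t)).clog_real (hm t)
      refine this.congr_deriv ?_
      rw [deriv_line]
      have h0 := Complex.slitPlane_ne_zero (hm t)
      have h1 : (c : ℂ) + t * Complex.I - σ = -(((σ - c : ℝ) : ℂ) + (-t : ℝ) * Complex.I) := by
        push_cast; ring
      rw [h1, div_neg]
      simp [neg_div]
    · refine Continuous.intervalIntegrable ?_ _ _
      simp_rw [deriv_line]
      refine continuous_const.div (by fun_prop) fun t h0 => ?_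
      refine Complex.slitPlane_ne_zero (hm t) (Eq.trans ?_ (neg_eq_zero.2 h0))
      push_cast
      ring

/-! ### Fox kernels: meromorphy, poles, and values along a line -/

/-- `Γ` is the inverse of the entire function `1/Γ`, so nothing about the order of its poles is
needed. -/
theorem meromorphicAt_Gamma_add_mul (a A σ : ℂ) :
    MeromorphicAt (fun s => Complex.Gamma (a + A * s)) σ := by
  have h : Differentiable ℂ fun s => (Complex.Gamma (a + A * s))⁻¹ :=
    Complex.differentiable_one_div_Gamma.comp ((differentiable_id.const_mul A).const_add a)
  have h2 := (h.analyticAt σ).meromorphicAt.inv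
  refine (congrArg (MeromorphicAt · σ) ?_).mp h2
  funext s
  simp

theorem finite_nat_add_lt (A b K : ℝ) :
    {k : ℕ | (k : ℝ) + b < K * A}.Finite := by
  obtain ⟨N, hN⟩ := exists_nat_gt (K * A - b)
  refine (Set.finite_lt_nat N).subset fun k hk => ?_
  have : (k : ℝ) < N := by
    have : (k : ℝ) + b < K * A := hk
    linarith
  exact_mod_cast this

namespace FoxParameters

variable {n ns m ms : ℕ} {P : FoxParameters n ns m ms}

theorem kernel_eq_mul_inv (P : FoxParameters n ns m ms) (s : ℂ) : P.kernel s =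
    ((∏ l, Complex.Gamma (1 - P.a l + P.A l * s)) * ∏ l, Complex.Gamma (P.b l + -P.B l * s)) *
    ((∏ l, (Complex.Gamma (P.as l + -P.As l * s))⁻¹) *
      ∏ l, (Complex.Gamma (1 - P.bs l + P.Bs l * s))⁻¹) := by
  simp only [kernel, div_eq_mul_inv, mul_inv, Finset.prod_inv_distrib, neg_mul, ← sub_eq_add_neg]

theorem differentiable_inv_Gamma_add_mul (a A : ℂ) :
    Differentiable ℂ fun s => (Complex.Gamma (a + A * s))⁻¹ :=
  Complex.differentiable_one_div_Gamma.comp ((differentiable_id.const_mul A).const_add a)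

theorem meromorphicAt_kernel (P : FoxParameters n ns m ms) (σ : ℂ) : MeromorphicAt P.kernel σ := by
  refine (congrArg (MeromorphicAt · σ) (funext P.kernel_eq_mul_inv)).mpr ?_
  refine ((MeromorphicAt.fun_prod fun l _ => ?_).fun_mul (MeromorphicAt.fun_prod fun l _ => ?_)).fun_mul
    ((MeromorphicAt.fun_prod fun l _ => ?_).fun_mul (MeromorphicAt.fun_prod fun l _ => ?_))
  · exact meromorphicAt_Gamma_add_mul _ _ _
  · exact meromorphicAt_Gamma_add_mul _ _ _
  · exact ((differentiable_inv_Gamma_add_mul _ _).analyticAt σ).meromorphicAt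
  · exact ((differentiable_inv_Gamma_add_mul _ _).analyticAt σ).meromorphicAt

theorem differentiableAt_kernel (hA : ∀ l, 0 < P.A l) (hB : ∀ l, 0 < P.B l) {s : ℂ}
    (hs : s ∉ P.leftPoles ∪ P.rightPoles) : DifferentiableAt ℂ P.kernel s := by
  have e := funext P.kernel_eq_mul_inv
  rw [show P.kernel = _ from e]
  refine ((DifferentiableAt.fun_finsetProd fun l _ => ?_).fun_mul
    (DifferentiableAt.fun_finsetProd fun l _ => ?_)).fun_mul
    ((DifferentiableAt.fun_finsetProd fun l _ => ?_).fun_mul (DifferentiableAt.fun_finsetProd fun l _ => ?_))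
  · refine DifferentiableAt.comp (g := Complex.Gamma) s (Complex.differentiableAt_Gamma _ fun k hk => hs (Or.inl ⟨l, k, ?_⟩))
      (by fun_prop)
    have : (P.A l : ℂ) ≠ 0 := by exact_mod_cast (hA l).ne'
    rw [eq_div_iff this]
    linear_combination hk
  · refine DifferentiableAt.comp (g := Complex.Gamma) s (Complex.differentiableAt_Gamma _ fun k hk => hs (Or.inr ⟨l, k, ?_⟩))
      (by fun_prop)
    have : (P.B l : ℂ) ≠ 0 := by exact_mod_cast (hB l).ne'
    rw [eq_div_iff this]
    linear_combination -hk
  · exact (differentiable_inv_Gamma_add_mul _ _) s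
  · exact (differentiable_inv_Gamma_add_mul _ _) s

/-- The poles of each factor form a horizontal arithmetic progression of step `1/A` or `1/B`, which
leaves every strip. -/
theorem finite_poles_inter_strip (hA : ∀ l, 0 < P.A l) (hB : ∀ l, 0 < P.B l) (K : ℝ) :
    ((P.leftPoles ∪ P.rightPoles) ∩ verticalStrip K).Finite := by
  rw [union_inter_distrib_right]
  refine Finite.union ?_ ?_
  · refine (Set.finite_iUnion fun l : Fin n => ((finite_nat_add_lt (P.A l) (1 - (P.a l).re) K).image
      fun k : ℕ => (-1 + P.a l - k) / P.A l)).subset ?_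
    rintro σ ⟨⟨l, k, rfl⟩, hσ⟩
    refine mem_iUnion.2 ⟨l, k, ?_, rfl⟩
    have h1 := (abs_lt.1 (show |((-1 + P.a l - k) / (P.A l : ℂ)).re| < K from hσ)).1
    rw [Complex.div_ofReal_re, lt_div_iff₀ (hA l)] at h1
    simp only [Complex.sub_re, Complex.add_re, Complex.neg_re, Complex.one_re, Complex.natCast_re] at h1
    simp only [mem_ofPred_eq]
    linarith
  · refine (Set.finite_iUnion fun l : Fin m => ((finite_nat_add_lt (P.B l) (P.b l).re K).image
      fun k : ℕ => (P.b l + k) / P.B l)).subset ?_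
    rintro σ ⟨⟨l, k, rfl⟩, hσ⟩
    refine mem_iUnion.2 ⟨l, k, ?_, rfl⟩
    have h1 := (abs_lt.1 (show |((P.b l + k) / (P.B l : ℂ)).re| < K from hσ)).2
    rw [Complex.div_ofReal_re, div_lt_iff₀ (hB l)] at h1
    simp only [Complex.add_re, Complex.natCast_re] at h1
    simp only [mem_ofPred_eq]
    linarith

/-- The kernel decays quadratically in vertical strips. -/
def KernelDecays (P : FoxParameters n ns m ms) : Prop :=
  ∀ K : ℝ, 0 ≤ K → ∃ C : ℝ, ∀ s : ℂ, |s.re| ≤ K → 1 ≤ |s.im| → ‖P.kernel s‖ ≤ C / s.im ^ 2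

theorem norm_cpow_le_of_abs_re_le {z : ℝ} (hz : 0 < z) {K : ℝ} {s : ℂ} (hs : |s.re| ≤ K) :
    ‖(z : ℂ) ^ s‖ ≤ Real.exp (|Real.log z| * K) := by
  rw [Complex.norm_cpow_eq_rpow_re_of_pos hz, Real.rpow_def_of_pos hz]
  refine Real.exp_le_exp.2 ((le_abs_self _).trans ?_)
  rw [abs_mul]
  exact mul_le_mul_of_nonneg_left hs (abs_nonneg _)

/-- If a vertical line separates the poles, then the value of a Fox function is given by the
integral along this line. -/
theorem hasValuePos_of_line (hP : P.Admissible) (hdec : P.KernelDecays) {c : ℝ}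
    (hleft : ∀ σ ∈ P.leftPoles, ∃ x : ℝ, σ = x ∧ x < c)
    (hright : ∀ σ ∈ P.rightPoles, ∃ x : ℝ, σ = x ∧ c < x) {z : ℝ} (hz : 0 < z) :
    Integrable (fun t : ℝ => (z : ℂ) ^ (c + t * Complex.I) * P.kernel (c + t * Complex.I)) ∧
    P.HasValuePos z (1 / (2 * Real.pi) *
      ∫ t : ℝ, (z : ℂ) ^ (c + t * Complex.I) * P.kernel (c + t * Complex.I)) := by
  have hz' : (z : ℂ) ≠ 0 := by exact_mod_cast hz.ne'
  have hline : P.IsContour fun t : ℝ => (c : ℂ) + t * Complex.I := by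
    refine ⟨⟨c, isVerticalPath_line c⟩, fun σ hσ => ?_, fun σ hσ => ?_⟩
    · obtain ⟨x, rfl, hx⟩ := hleft σ hσ
      exact liesLeftOf_line hx
    · obtain ⟨x, rfl, hx⟩ := hright σ hσ
      exact liesRightOf_line hx
  -- Any admissible path has the same position as the line with respect to each pole, and `z^s` is
  -- bounded on strips, so `integral_eq_of_sameSide` gives integrability and independence together.
  have key : ∀ γ, P.IsContour γ →
      (Integrable fun t : ℝ => deriv γ t * ((z : ℂ) ^ γ t * P.kernel (γ t))) ∧
      ∫ t : ℝ, deriv γ t * ((z : ℂ) ^ γ t * P.kernel (γ t)) = ∫ t : ℝ, Complex.I *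
        ((z : ℂ) ^ (c + t * Complex.I) * P.kernel (c + t * Complex.I)) := by
    rintro γ ⟨⟨c', hγ⟩, hl, hr⟩
    obtain ⟨B, hB⟩ := hγ.exists_isStripPath
    obtain ⟨B', hB'⟩ := (isVerticalPath_line c).exists_isStripPath
    have := integral_eq_of_sameSide hB hB' (P := P.leftPoles ∪ P.rightPoles)
      (f := fun s => (z : ℂ) ^ s * P.kernel s)
      (fun σ hσ => hσ.elim (fun h => Or.inl ⟨hl σ h, hline.2.1 σ h⟩)
        fun h => Or.inr ⟨hr σ h, hline.2.2 σ h⟩)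
      (finite_poles_inter_strip hP.A_pos hP.B_pos)
      (fun s hs => DifferentiableAt.mul
        (differentiableAt_id.const_cpow (Or.inl hz'))
        (differentiableAt_kernel hP.A_pos hP.B_pos hs))
      (fun σ _ => by
        have h1 : Differentiable ℂ fun s : ℂ => (z : ℂ) ^ s :=
          fun s => differentiableAt_id.const_cpow (Or.inl hz')
        exact (h1.analyticAt σ).meromorphicAt.fun_mul (P.meromorphicAt_kernel σ))
      (fun K hK => by
        obtain ⟨C, hC⟩ := hdec K hK
        refine ⟨Real.exp (|Real.log z| * K) * C, fun s hs hs' => ?_⟩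
        rw [norm_mul, mul_div_assoc]
        exact mul_le_mul (norm_cpow_le_of_abs_re_le hz hs) (hC s hs hs') (norm_nonneg _)
          (Real.exp_pos _).le)
    simpa only [deriv_line] using this
  refine ⟨?_, hP, ⟨_, hline⟩, fun γ hγ => ⟨(key γ hγ).1, ?_⟩⟩
  · have := (key _ hline).1
    simp only [deriv_line] at this
    have h2 := this.const_mul (-Complex.I)
    refine h2.congr (Eventually.of_forall fun t => ?_)
    beta_reduce
    rw [← mul_assoc, neg_mul, Complex.I_mul_I, neg_neg, one_mul]
  · rw [(key γ hγ).2, integral_const_mul]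
    have : (Real.pi : ℂ) ≠ 0 := by exact_mod_cast Real.pi_ne_zero
    field_simp

end FoxParameters

/-! ### The kernel of the radial profile -/

/-- The kernel of the Fox function of the radial profile. -/
noncomputable def profileKernel (d : ℕ) (j n : ℝ) (s : ℂ) : ℂ :=
  Complex.Gamma ((j + d) / (2 * n) + s / n) * Complex.Gamma (1 - ((j + d) / (2 * n) + s / n)) *
    Complex.Gamma (-s) / Complex.Gamma (d / 2 + s)

theorem profileFoxParameters_kernel (d : ℕ) (j n : ℝ) :
    (profileFoxParameters d j n).kernel = profileKernel d j n := by
  funext s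
  simp only [FoxParameters.kernel, profileFoxParameters, profileKernel, Fin.prod_univ_succ,
    Finset.univ_eq_empty, Finset.prod_empty, Fin.succ_zero_eq_one, Matrix.cons_val_zero,
    Matrix.cons_val_one, mul_one, one_mul, Complex.ofReal_one, Complex.ofReal_div, zero_sub,
    sub_sub_cancel]
  have e1 : (1 : ℂ) / n * s = s / n := by ring
  rw [e1, sub_sub]
  ring

/-- In a strip `Γ(-s)/Γ(d/2+s)` grows at most like a power of `|Im s|`, and `Γ(w)Γ(1-w)` decays
faster than any power. -/
theorem exists_norm_profileKernel_le (d : ℕ) (j : ℝ) {n : ℝ} (hn : 0 < n) {K : ℝ} (hK : 0 ≤ K) :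
    ∃ C : ℝ, ∀ s : ℂ, |s.re| ≤ K → 1 ≤ |s.im| → ‖profileKernel d j n s‖ ≤ C / s.im ^ 2 := by
  obtain ⟨C, m, hC, h⟩ := exists_norm_Gamma_le_mul_norm_Gamma (K := K + d) (by positivity)
  set D : ℝ := 2 * Real.pi * (((m + 1 + 1).factorial : ℕ) : ℝ) with hD
  refine ⟨C * D * (n / Real.pi) ^ (m + 2), fun s hs ht => ?_⟩
  have ht0 : 0 < |s.im| := by linarith
  have him : s.im ≠ 0 := abs_pos.1 ht0
  -- `-conj s` has the imaginary part of `s`, as required for the comparison with `Γ(d/2+s)`.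
  have e1 : ‖Complex.Gamma (-s)‖ = ‖Complex.Gamma (-(starRingEnd ℂ) s)‖ := by
    rw [← map_neg, Complex.Gamma_conj, Complex.norm_conj]
  have hd0 : (0 : ℝ) ≤ d := Nat.cast_nonneg d
  have h1 := h (-(starRingEnd ℂ) s) (d / 2 + s) (by simpa using hs.trans (by linarith))
    (by
      have : ((d : ℂ) / 2 + s).re = d / 2 + s.re := by simp
      rw [this]
      refine (abs_add_le _ _).trans ?_
      rw [abs_of_nonneg (by positivity)]
      linarith) (by simp) (by simpa using ht)
  have e2 : (-(starRingEnd ℂ) s).im = s.im := by simp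
  rw [← e1, e2] at h1
  have hw : ((j + d) / (2 * n) + s / n : ℂ).im = s.im / n := by
    have : ((j + d) / (2 * n) : ℂ) = (((j + d) / (2 * n) : ℝ) : ℂ) := by push_cast; rfl
    rw [this, Complex.add_im, Complex.ofReal_im, Complex.div_ofReal_im, zero_add]
  have h2 := norm_Gamma_mul_Gamma_one_sub_le (m + 1) (w := (j + d) / (2 * n) + s / n)
    (by rw [hw]; exact div_ne_zero him hn.ne')
  rw [hw, abs_div, abs_of_pos hn] at h2
  have hne : Complex.Gamma (d / 2 + s) ≠ 0 := by
    refine Complex.Gamma_ne_zero fun k hk => him ?_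
    have := congrArg Complex.im hk
    simpa using this
  have h3 : ‖Complex.Gamma (-s)‖ / ‖Complex.Gamma (d / 2 + s)‖ ≤ C * |s.im| ^ m :=
    (div_le_iff₀ (norm_pos_iff.2 hne)).2 h1
  rw [profileKernel, mul_div_assoc, norm_mul, norm_div]
  refine (mul_le_mul h2 h3 (by positivity) (by positivity)).trans (le_of_eq ?_)
  rw [← sq_abs s.im, hD]
  have hp := Real.pi_pos
  rw [show m + 1 + 1 = m + 2 from rfl, mul_pow, div_pow, div_pow, pow_add |s.im| m 2]
  field_simp

theorem kernelDecays_profileFoxParameters (d : ℕ) (j : ℝ) {n : ℝ} (hn : 0 < n) :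
    (profileFoxParameters d j n).KernelDecays := by
  intro K hK
  rw [profileFoxParameters_kernel]
  exact exists_norm_profileKernel_le d j hn hK

theorem leftPoles_profileFoxParameters (d : ℕ) (j : ℝ) {n : ℝ} (hn : 0 < n) {σ : ℂ}
    (hσ : σ ∈ (profileFoxParameters d j n).leftPoles) :
    ∃ x : ℝ, σ = x ∧ x ≤ -((j + d) / 2) := by
  obtain ⟨l, k, rfl⟩ := hσ
  obtain rfl : l = 0 := Subsingleton.elim _ _
  refine ⟨-((j + d) / 2) - k * n, ?_, ?_⟩
  · have : (n : ℂ) ≠ 0 := by exact_mod_cast hn.ne'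
    simp only [profileFoxParameters, Matrix.cons_val_zero]
    push_cast
    field_simp
    ring
  · have : 0 ≤ (k : ℝ) * n := by positivity
    linarith

theorem rightPoles_profileFoxParameters (d : ℕ) {j n : ℝ} (hn : 0 < n) (h1 : j + d < 2 * n) {σ : ℂ}
    (hσ : σ ∈ (profileFoxParameters d j n).rightPoles) : ∃ x : ℝ, σ = x ∧ 0 ≤ x := by
  obtain ⟨l, k, rfl⟩ := hσ
  fin_cases l
  · exact ⟨k, by simp [profileFoxParameters], by positivity⟩
  · refine ⟨n - (j + d) / 2 + k * n, ?_, ?_⟩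
    · have : (n : ℂ) ≠ 0 := by exact_mod_cast hn.ne'
      simp only [profileFoxParameters, Fin.mk_one, Matrix.cons_val_one, Matrix.cons_val_zero]
      push_cast
      field_simp
    · have : 0 ≤ (k : ℝ) * n := by positivity
      linarith

theorem admissible_profileFoxParameters {d : ℕ} (hd : 1 ≤ d) {j n : ℝ} (hn : 0 < n) (hj : 0 ≤ j)
    (h1 : j + d < 2 * n) : (profileFoxParameters d j n).Admissible where
  A_pos l := by
    obtain rfl : l = 0 := Subsingleton.elim _ _
    simpa [profileFoxParameters] using hn
  As_pos l := l.elim0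
  B_pos l := by
    fin_cases l
    · simp [profileFoxParameters]
    · simpa [profileFoxParameters] using hn
  Bs_pos l := by
    obtain rfl : l = 0 := Subsingleton.elim _ _
    simp [profileFoxParameters]
  disjoint := by
    rw [Set.disjoint_left]
    intro σ hl hr
    obtain ⟨x, rfl, hx⟩ := leftPoles_profileFoxParameters d j hn hl
    obtain ⟨y, hxy, hy⟩ := rightPoles_profileFoxParameters d hn h1 hr
    have := Complex.ofReal_injective hxy
    have hd' : (1 : ℝ) ≤ d := by exact_mod_cast hd
    linarith
  alpha_pos := by
    simp [FoxParameters.alpha, profileFoxParameters, Fin.sum_univ_succ]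
    have := inv_pos.2 hn
    linarith

/-! ### Uniqueness from Gaussian moments, oscillatory integrals, the Cahen–Mellin integral -/

section

open scoped ContDiff

/-- The variable `q = exp(-r²/2)` compactifies the half-line to `[0,1]`. Near `q = 0` the argument
leaves the support of `ψ`; at `q = 0` the convention `Real.log 0 = 0` makes the value `ψ 0 = 0`, so
continuity holds there too. -/
theorem continuousOn_comp_sqrt_log {ψ : ℝ → ℝ} (hψ : Continuous ψ) (hc : HasCompactSupport ψ)
    (h0 : ψ 0 = 0) : ContinuousOn (fun q => ψ (Real.sqrt (-2 * Real.log q))) (Icc 0 1) := by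
  intro q hq
  rcases hq.1.eq_or_lt with rfl | hpos
  · obtain ⟨R, hR⟩ := hc.isCompact.isBounded.subset_closedBall 0
    have hR' : ∀ r, R < r → ψ r = 0 := by
      intro r hr
      by_contra hne
      have := hR (subset_tsupport _ (Function.mem_support.2 hne))
      rw [Metric.mem_closedBall, dist_zero_right] at this
      exact absurd ((le_abs_self r).trans this) (not_le.2 hr)
    have hz : ∀ᶠ q in 𝓝[Icc (0 : ℝ) 1] 0, ψ (Real.sqrt (-2 * Real.log q)) = 0 := by
      have h1 : Iio (Real.exp (-((|R| + 1) ^ 2 / 2))) ∈ 𝓝[Icc (0 : ℝ) 1] 0 :=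
        mem_nhdsWithin_of_mem_nhds (Iio_mem_nhds (Real.exp_pos _))
      filter_upwards [h1, self_mem_nhdsWithin] with q hq hq'
      rcases hq'.1.eq_or_lt with rfl | hpos
      · simpa using h0
      · refine hR' _ ((le_abs_self R).trans_lt ((lt_add_one _).trans_le ?_))
        refine Real.le_sqrt_of_sq_le ?_
        have := (Real.log_lt_iff_lt_exp hpos).2 hq
        linarith
    refine ContinuousWithinAt.congr_of_eventuallyEq (f := fun _ => (0 : ℝ)) continuousWithinAt_const hz ?_
    simpa using h0
  · refine ContinuousAt.continuousWithinAt ?_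
    exact hψ.continuousAt.comp (Real.continuous_sqrt.continuousAt.comp
      (continuousAt_const.mul (Real.continuousAt_log hpos.ne')))

/-- A continuous function on `(0, ∞)` is determined by its moments with respect to the powers of
`exp (-r^2 / 2)`. -/
theorem eq_zero_of_integral_exp_pow_smul {g : ℝ → ℂ} (hg : ContinuousOn g (Ioi 0))
    (hi : IntegrableOn (fun r => Real.exp (-(r ^ 2 / 2)) • g r) (Ioi 0))
    (h : ∀ m : ℕ, ∫ r in Ioi (0 : ℝ), Real.exp (-(r ^ 2 / 2)) ^ (m + 1) • g r = 0) {r : ℝ}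
    (hr : 0 < r) : g r = 0 := by
  set q : ℝ → ℝ := fun r => Real.exp (-(r ^ 2 / 2)) with hq
  have hq0 : ∀ r, 0 < q r := fun r => Real.exp_pos _
  have hq1 : ∀ r, q r ≤ 1 := fun r => Real.exp_le_one_iff.2 (by nlinarith [sq_nonneg r])
  have hqc : Continuous q := by fun_prop
  have hik : ∀ k : ℕ, IntegrableOn (fun r => q r ^ k • (q r • g r)) (Ioi 0) := by
    intro k
    refine Integrable.mono hi (((hqc.pow k).aestronglyMeasurable).smul hi.aestronglyMeasurable)
      (Eventually.of_forall fun r => ?_)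
    rw [norm_smul, norm_pow, Real.norm_of_nonneg (hq0 r).le]
    exact mul_le_of_le_one_left (norm_nonneg _) (pow_le_one₀ (hq0 r).le (hq1 r))
  have hp : ∀ p : Polynomial ℝ, IntegrableOn (fun r => p.eval (q r) • (q r • g r)) (Ioi 0) ∧
      ∫ r in Ioi (0 : ℝ), p.eval (q r) • (q r • g r) = 0 := by
    intro p
    have e : ∀ r, p.eval (q r) • (q r • g r) =
        ∑ k ∈ Finset.range (p.natDegree + 1), p.coeff k • (q r ^ k • (q r • g r)) := by
      intro r
      rw [Polynomial.eval_eq_sum_range, Finset.sum_smul]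
      exact Finset.sum_congr rfl fun k _ => mul_smul _ _ _
    have hs : ∀ k, IntegrableOn (fun r => p.coeff k • (q r ^ k • (q r • g r))) (Ioi 0) := fun k =>
      (hik k).smul (p.coeff k)
    simp_rw [e]
    refine ⟨integrable_finsetSum _ fun k _ => hs k, ?_⟩
    rw [integral_finsetSum _ fun k _ => hs k]
    refine Finset.sum_eq_zero fun k _ => ?_
    rw [integral_smul]
    have : ∫ r in Ioi (0 : ℝ), q r ^ k • (q r • g r) = 0 := by
      rw [← h k]
      refine integral_congr_ae (Eventually.of_forall fun r => ?_)
      beta_reduce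
      rw [smul_smul, pow_succ]
    rw [this, smul_zero]
  have hae : ∀ᵐ r, r ∈ Ioi (0 : ℝ) → q r • g r = 0 := by
    refine isOpen_Ioi.ae_eq_zero_of_integral_contDiff_smul_eq_zero hi.locallyIntegrableOn ?_
    intro ψ hψ hψc hψs
    have hψ0 : ∀ r, r ≤ 0 → ψ r = 0 := by
      intro r hr
      by_contra hne
      exact absurd (hψs (subset_tsupport _ (Function.mem_support.2 hne))) (not_lt.2 hr)
    rw [← setIntegral_eq_integral_of_forall_compl_eq_zero (s := Ioi (0 : ℝ)) fun r hr => by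
      rw [hψ0 r (not_lt.1 hr), zero_smul]]
    set A := ∫ r in Ioi (0 : ℝ), ‖q r • g r‖ with hA
    have hA0 : 0 ≤ A := integral_nonneg fun _ => norm_nonneg _
    have key : ∀ ε > 0, ‖∫ r in Ioi (0 : ℝ), ψ r • (q r • g r)‖ ≤ ε * A := by
      intro ε hε
      -- Weierstrass approximation in the variable `q`: `ψ r` is uniformly close to a polynomial in
      -- `q r`, and the integrals of `q • g` against such polynomials vanish.
      obtain ⟨p, hpε⟩ := exists_polynomial_near_of_continuousOn 0 1 _
        (continuousOn_comp_sqrt_log hψ.continuous hψc (hψ0 0 le_rfl)) ε hε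
      obtain ⟨h1, h2⟩ := hp p
      have hψi : IntegrableOn (fun r => ψ r • (q r • g r)) (Ioi 0) := by
        obtain ⟨C, hC⟩ := hψ.continuous.bounded_above_of_compact_support hψc
        exact Integrable.bdd_smul hi C hψ.continuous.aestronglyMeasurable
          (Eventually.of_forall hC)
      rw [← sub_zero (∫ r in Ioi (0 : ℝ), ψ r • (q r • g r)), ← h2, ← integral_sub hψi h1, hA,
        ← integral_const_mul]
      refine norm_integral_le_of_norm_le (hi.norm.const_mul ε) ?_
      filter_upwards [ae_restrict_mem measurableSet_Ioi] with r hr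
      rw [← sub_smul, norm_smul]
      refine mul_le_mul_of_nonneg_right ?_ (norm_nonneg _)
      have h3 := hpε (q r) ⟨(hq0 r).le, hq1 r⟩
      have h4 : Real.sqrt (-2 * Real.log (q r)) = r := by
        rw [hq, Real.log_exp, show -2 * -(r ^ 2 / 2) = r ^ 2 by ring, Real.sqrt_sq (le_of_lt hr)]
      rw [h4, abs_sub_comm] at h3
      exact h3.le
    refine norm_le_zero_iff.1 (le_of_forall_pos_le_add fun ε hε => ?_)
    have := key (ε / (A + 1)) (by positivity)
    have h5 : ε / (A + 1) * A ≤ ε := by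
      rw [div_mul_eq_mul_div, div_le_iff₀ (by positivity)]
      nlinarith
    linarith
  have h6 := Measure.eqOn_open_of_ae_eq (μ := volume) (f := g) (g := fun _ => 0) (U := Ioi 0)
    ((ae_restrict_iff' measurableSet_Ioi).2 (hae.mono fun r hr hr' =>
      (smul_eq_zero.1 (hr hr')).resolve_left (hq0 r).ne')) isOpen_Ioi hg continuousOn_const
  exact h6 hr

theorem ofReal_cpow_eq_exp {x : ℝ} (hx : 0 < x) (s : ℂ) :
    (x : ℂ) ^ s = Complex.exp ((Real.log x : ℂ) * s) := by
  rw [Complex.cpow_def_of_ne_zero (by exact_mod_cast hx.ne'), Complex.ofReal_log hx.le]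

/-- The superposition `∫ a(t) r^(2 i t) dt` of oscillating powers of `r`. -/
noncomputable def oscillatory (a : ℝ → ℂ) (r : ℝ) : ℂ :=
  ∫ t, a t * Complex.exp (((2 * t * Real.log r : ℝ) : ℂ) * Complex.I)

theorem norm_oscillatory_le (a : ℝ → ℂ) (r : ℝ) : ‖oscillatory a r‖ ≤ ∫ t, ‖a t‖ := by
  refine (norm_integral_le_integral_norm _).trans (le_of_eq ?_)
  refine integral_congr_ae (Eventually.of_forall fun t => ?_)
  beta_reduce
  rw [norm_mul, Complex.norm_exp_ofReal_mul_I, mul_one]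

theorem continuousOn_oscillatory {a : ℝ → ℂ} (ha : Integrable a) :
    ContinuousOn (oscillatory a) (Ioi 0) := by
  refine continuousOn_of_dominated (bound := fun t => ‖a t‖) (fun r _ => ?_) (fun r _ => ?_) ha.norm ?_
  · exact ha.aestronglyMeasurable.mul (Continuous.aestronglyMeasurable (by fun_prop))
  · refine Eventually.of_forall fun t => ?_
    rw [norm_mul, Complex.norm_exp_ofReal_mul_I, mul_one]
  · refine Eventually.of_forall fun t => ?_
    refine continuousOn_const.mul (Complex.continuous_exp.comp_continuousOn ?_)
    refine ContinuousOn.mul (Complex.continuous_ofReal.comp_continuousOn ?_) continuousOn_const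
    exact continuousOn_const.mul (Real.continuousOn_log.mono fun r hr => (ne_of_gt hr : r ≠ 0))

/-- Fubini; the phase has modulus one, so the integrand is dominated by the product of two
integrable functions. -/
theorem integral_mul_oscillatory {a b : ℝ → ℂ} (ha : Integrable a) (hb : IntegrableOn b (Ioi 0)) :
    ∫ r in Ioi (0 : ℝ), b r * oscillatory a r = ∫ t, a t * ∫ r in Ioi (0 : ℝ),
      b r * Complex.exp (((2 * t * Real.log r : ℝ) : ℂ) * Complex.I) := by
  have h1 : Integrable (fun z : ℝ × ℝ => b z.1 * a z.2) ((volume.restrict (Ioi 0)).prod volume) :=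
    Integrable.mul_prod hb ha
  have h2 : Integrable (Function.uncurry fun r t : ℝ => b r * (a t *
      Complex.exp (((2 * t * Real.log r : ℝ) : ℂ) * Complex.I)))
      ((volume.restrict (Ioi 0)).prod volume) := by
    have hm : Measurable fun z : ℝ × ℝ =>
        Complex.exp (((2 * z.2 * Real.log z.1 : ℝ) : ℂ) * Complex.I) := by fun_prop
    have h3 := Integrable.mul_bdd (c := 1) h1 hm.aestronglyMeasurable
      (Eventually.of_forall fun z => (Complex.norm_exp_ofReal_mul_I _).le)
    refine h3.congr (Eventually.of_forall fun z => ?_)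
    simp only [Function.uncurry]
    ring
  simp only [oscillatory, ← integral_const_mul]
  rw [integral_integral_swap h2]
  refine integral_congr_ae (Eventually.of_forall fun t => ?_)
  refine integral_congr_ae (Eventually.of_forall fun r => ?_)
  beta_reduce
  ring

/-- A function which is continuous at the points of a vertical line and decays quadratically in strips is
integrable on this line. -/
theorem integrable_line {c : ℝ} {f : ℂ → ℂ} (hf : ∀ s : ℂ, s.re = c → ContinuousAt f s)
    (hdec : ∀ K : ℝ, 0 ≤ K → ∃ C : ℝ, ∀ s : ℂ, |s.re| ≤ K → 1 ≤ |s.im| → ‖f s‖ ≤ C / s.im ^ 2) :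
    Integrable fun t : ℝ => f (c + t * Complex.I) := by
  obtain ⟨B, hB⟩ := (isVerticalPath_line c).exists_isStripPath
  have hB0 : 0 ≤ B := (norm_nonneg _).trans (hB.norm_sub_le 0)
  obtain ⟨C, hC⟩ := hdec (|c| + B) (by positivity)
  have h := hB.integrable (f := f) (continuous_iff_continuousAt.2 fun t =>
    ContinuousAt.comp (hf _ (by simp)) (by fun_prop)) hC
  simp only [deriv_line] at h
  refine (h.const_mul (-Complex.I)).congr (Eventually.of_forall fun t => ?_)
  beta_reduce
  rw [← mul_assoc, neg_mul, Complex.I_mul_I, neg_neg, one_mul]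

theorem continuousAt_Gamma_of_re_pos {s : ℂ} (hs : 0 < s.re) : ContinuousAt Complex.Gamma s := by
  refine (Complex.differentiableAt_Gamma s fun m hm => ?_).continuousAt
  rw [hm] at hs
  simp at hs
  linarith [(Nat.cast_nonneg m : (0 : ℝ) ≤ m)]

theorem integrable_Gamma_line {σ : ℝ} (hσ : 0 < σ) :
    Integrable fun t : ℝ => Complex.Gamma (σ + t * Complex.I) :=
  integrable_line (fun s hs => continuousAt_Gamma_of_re_pos (by rwa [hs])) fun _ hK =>
    (exists_norm_Gamma_le_inv_sq hK).imp fun _ h => h.2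

theorem neg_line_eq (c t : ℝ) : -((c : ℂ) + t * Complex.I) = ((-c : ℝ) : ℂ) + ((-t : ℝ) : ℂ) * Complex.I := by
  push_cast
  ring

theorem integrable_Gamma_neg_line {c : ℝ} (hc : c < 0) :
    Integrable fun t : ℝ => Complex.Gamma (-(c + t * Complex.I)) := by
  have := (integrable_Gamma_line (neg_pos.2 hc)).comp_neg
  refine this.congr (Eventually.of_forall fun t => ?_)
  beta_reduce
  rw [neg_line_eq]

/-- The Cahen-Mellin integral. -/
theorem integral_Gamma_neg_mul_cpow {c : ℝ} (hc : c < 0) {y : ℝ} (hy : 0 < y) :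
    ∫ t : ℝ, Complex.Gamma (-(c + t * Complex.I)) * (y : ℂ) ^ (c + t * Complex.I) =
      2 * Real.pi * Complex.exp (-y) := by
  have hσ : 0 < -c := neg_pos.2 hc
  have hG : ∀ s : ℂ, 0 < s.re → mellin (fun x : ℝ => ((Real.exp (-x) : ℝ) : ℂ)) s = Complex.Gamma s := by
    intro s hs
    rw [Complex.Gamma_eq_integral hs, Complex.GammaIntegral_eq_mellin]
  have hG' : ∀ t : ℝ, mellin (fun x : ℝ => ((Real.exp (-x) : ℝ) : ℂ)) ((-c : ℝ) + t * Complex.I) =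
      Complex.Gamma ((-c : ℝ) + t * Complex.I) := fun t => hG _ (by simpa using hc)
  -- Mellin inversion of `exp(-x)` on the line of abscissa `-c > 0`; the change `t ↦ -t` then turns
  -- the variable into `-(c + it)`.
  have h := mellinInv_mellin_eq (-c) (fun x : ℝ => ((Real.exp (-x) : ℝ) : ℂ)) hy ?_ ?_ (by fun_prop)
  · rw [mellinInv] at h
    simp only [hG'] at h
    rw [← integral_neg_eq_self] at h
    have e : ∀ t : ℝ, (y : ℂ) ^ (-(((-c : ℝ) : ℂ) + ((-t : ℝ) : ℂ) * Complex.I)) •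
        Complex.Gamma (((-c : ℝ) : ℂ) + ((-t : ℝ) : ℂ) * Complex.I) =
        Complex.Gamma (-(c + t * Complex.I)) * (y : ℂ) ^ (c + t * Complex.I) := by
      intro t
      rw [← neg_line_eq, neg_neg, smul_eq_mul, mul_comm]
    simp only [e] at h
    have hp : (Real.pi : ℂ) ≠ 0 := by exact_mod_cast Real.pi_ne_zero
    rw [Complex.real_smul] at h
    push_cast at h
    rw [← h, ← mul_assoc, mul_one_div_cancel (mul_ne_zero two_ne_zero hp), one_mul]
  · have h1 : 0 < (((-c : ℝ) : ℂ)).re := hσ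
    refine (Complex.GammaIntegral_convergent h1).congr_fun (fun x _ => ?_) measurableSet_Ioi
    rw [smul_eq_mul, mul_comm]
  · refine (integrable_Gamma_line hσ).congr (Eventually.of_forall fun t => ?_)
    exact (hG' t).symm

end

/-! ### The profile tested against Gaussians -/

theorem integral_cexp_inner_mul_gaussian {d : ℕ} {μ : ℝ} (hμ : 0 < μ) (k : RSpace d) :
    ∫ x : RSpace d, Complex.exp (Complex.I * ((inner ℝ k x : ℝ) : ℂ)) *
      ((Real.exp (-(μ * ‖x‖ ^ 2 / 2)) : ℝ) : ℂ) =
      (((2 * Real.pi) ^ ((d : ℝ) / 2) * μ ^ (-((d : ℝ) / 2)) * Real.exp (-(‖k‖ ^ 2 / (2 * μ))) : ℝ) : ℂ) := by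
  have hb : 0 < ((μ / 2 : ℝ) : ℂ).re := by simpa using hμ
  have h := GaussianFourier.integral_cexp_neg_mul_sq_norm_add hb Complex.I k
  rw [finrank_euclideanSpace_fin] at h
  have e1 : ((Real.pi : ℂ) / ((μ / 2 : ℝ) : ℂ)) ^ ((d : ℂ) / 2) =
      (((2 * Real.pi) ^ ((d : ℝ) / 2) * μ ^ (-((d : ℝ) / 2)) : ℝ) : ℂ) := by
    have e2 : (2 * Real.pi) ^ ((d : ℝ) / 2) * μ ^ (-((d : ℝ) / 2)) =
        (Real.pi / (μ / 2)) ^ ((d : ℝ) / 2) := by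
      rw [Real.rpow_neg hμ.le, ← div_eq_mul_inv, ← Real.div_rpow (by positivity) hμ.le]
      congr 1
      field_simp
    rw [e2, Complex.ofReal_cpow (by positivity)]
    push_cast
    rfl
  have e3 : Complex.exp (Complex.I ^ 2 * (‖k‖ : ℂ) ^ 2 / (4 * ((μ / 2 : ℝ) : ℂ))) =
      ((Real.exp (-(‖k‖ ^ 2 / (2 * μ))) : ℝ) : ℂ) := by
    rw [Complex.ofReal_exp, Complex.I_sq]
    congr 1
    push_cast
    have : (μ : ℂ) ≠ 0 := by exact_mod_cast hμ.ne'
    field_simp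
    norm_num
  rw [Complex.ofReal_mul, ← e1, ← e3, ← h]
  refine integral_congr_ae (Eventually.of_forall fun x => ?_)
  beta_reduce
  rw [Complex.ofReal_exp, ← Complex.exp_add]
  congr 1
  push_cast
  ring

theorem integrable_gaussian {d : ℕ} {μ : ℝ} (hμ : 0 < μ) :
    Integrable fun x : RSpace d => ((Real.exp (-(μ * ‖x‖ ^ 2 / 2)) : ℝ) : ℂ) := by
  have hb : 0 < ((μ / 2 : ℝ) : ℂ).re := by simpa using hμ
  refine (GaussianFourier.integrable_cexp_neg_mul_sq_norm_add hb 0 (0 : RSpace d)).congr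
    (Eventually.of_forall fun x => ?_)
  beta_reduce
  rw [Complex.ofReal_exp]
  congr 1
  push_cast
  ring

/-- Fubini, then the Fourier transform of a Gaussian; its factor `(2π)^(d/2)` cancels the
normalization of the inverse transform. -/
theorem integral_gaussian_mul_maximizerFun {d : ℕ} (hd : 1 ≤ d) {j n : ℝ} (hn : 0 < n) (hj : 0 ≤ j)
    (h1 : j + d < 2 * n) {μ : ℝ} (hμ : 0 < μ) :
    ∫ x : RSpace d, ((Real.exp (-(μ * ‖x‖ ^ 2 / 2)) : ℝ) : ℂ) * maximizerFun d j n x =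
      ((μ ^ (-((d : ℝ) / 2)) : ℝ) : ℂ) *
        ∫ k : RSpace d, maximizerSymbol d j n k * ((Real.exp (-(‖k‖ ^ 2 / (2 * μ))) : ℝ) : ℂ) := by
  have hm := integrable_maximizerSymbol hd hn hj h1
  have hg := integrable_gaussian (d := d) hμ
  have h2 : Integrable (Function.uncurry fun x k : RSpace d =>
      ((Real.exp (-(μ * ‖x‖ ^ 2 / 2)) : ℝ) : ℂ) *
        (Complex.exp (Complex.I * ((inner ℝ k x : ℝ) : ℂ)) * maximizerSymbol d j n k))
      (volume.prod volume) := by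
    have h3 := Integrable.mul_bdd (c := 1)
      (g := fun z : RSpace d × RSpace d => Complex.exp (Complex.I * ((inner ℝ z.2 z.1 : ℝ) : ℂ)))
      (hg.mul_prod hm) (Continuous.aestronglyMeasurable (by fun_prop)) (Eventually.of_forall fun z => by
        rw [mul_comm, Complex.norm_exp_ofReal_mul_I])
    refine h3.congr (Eventually.of_forall fun z => ?_)
    simp only [Function.uncurry]
    ring
  have e1 : ∀ x : RSpace d, ((Real.exp (-(μ * ‖x‖ ^ 2 / 2)) : ℝ) : ℂ) * maximizerFun d j n x =
      (((2 * Real.pi) ^ (-(d : ℝ) / 2) : ℝ) : ℂ) * ∫ k : RSpace d,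
        ((Real.exp (-(μ * ‖x‖ ^ 2 / 2)) : ℝ) : ℂ) *
        (Complex.exp (Complex.I * ((inner ℝ k x : ℝ) : ℂ)) * maximizerSymbol d j n k) := by
    intro x
    rw [maximizerFun, unitaryFourierInv, integral_const_mul]
    ring
  simp_rw [e1]
  rw [integral_const_mul, integral_integral_swap h2, ← integral_const_mul, ← integral_const_mul]
  refine integral_congr_ae (Eventually.of_forall fun k => ?_)
  beta_reduce
  have e2 : ∫ x : RSpace d, ((Real.exp (-(μ * ‖x‖ ^ 2 / 2)) : ℝ) : ℂ) *
        (Complex.exp (Complex.I * ((inner ℝ k x : ℝ) : ℂ)) * maximizerSymbol d j n k) =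
      maximizerSymbol d j n k * ∫ x : RSpace d, Complex.exp (Complex.I * ((inner ℝ k x : ℝ) : ℂ)) *
        ((Real.exp (-(μ * ‖x‖ ^ 2 / 2)) : ℝ) : ℂ) := by
    rw [← integral_const_mul]
    refine integral_congr_ae (Eventually.of_forall fun x => ?_)
    beta_reduce
    ring
  have e3 : (2 * Real.pi) ^ (-(d : ℝ) / 2) * (2 * Real.pi) ^ ((d : ℝ) / 2) = 1 := by
    rw [← Real.rpow_add (by positivity), neg_div, neg_add_cancel, Real.rpow_zero]
  rw [e2, integral_cexp_inner_mul_gaussian hμ, Complex.ofReal_mul, Complex.ofReal_mul]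
  have e4 := congrArg (fun x : ℝ => (x : ℂ)) e3
  simp only [Complex.ofReal_mul, Complex.ofReal_one] at e4
  linear_combination (maximizerSymbol d j n k * ((μ ^ (-((d : ℝ) / 2)) : ℝ) : ℂ) *
    ((Real.exp (-(‖k‖ ^ 2 / (2 * μ))) : ℝ) : ℂ)) * e4

/-- The integral of the profile against a Gaussian. -/
theorem integral_gaussian_mul_radialProfile {d : ℕ} (hd : 1 ≤ d) {j n : ℝ} (hn : 0 < n) (hj : 0 ≤ j)
    (h1 : j + d < 2 * n) {μ : ℝ} (hμ : 0 < μ) :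
    ∫ r in Ioi (0 : ℝ), r ^ (d - 1) • (((Real.exp (-(μ * r ^ 2 / 2)) : ℝ) : ℂ) *
      ((radialProfile d j n r : ℝ) : ℂ)) = ((μ ^ (-((d : ℝ) / 2)) : ℝ) : ℂ) *
        ∫ r in Ioi (0 : ℝ), ((r ^ ((j + d) - 1) / (1 + r ^ (2 * n)) *
          Real.exp (-(r ^ 2 / (2 * μ))) : ℝ) : ℂ) := by
  have h := integral_gaussian_mul_maximizerFun hd hn hj h1 hμ
  simp_rw [maximizerFun_eq_radialProfile hd hn hj h1] at h
  rw [integral_radial hd (fun r : ℝ => ((Real.exp (-(μ * r ^ 2 / 2)) : ℝ) : ℂ) *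
      ((radialProfile d j n r : ℝ) : ℂ)),
    show (∫ k : RSpace d, maximizerSymbol d j n k * ((Real.exp (-(‖k‖ ^ 2 / (2 * μ))) : ℝ) : ℂ)) = _ from
    integral_radial hd (fun r : ℝ => ((r ^ j / (1 + r ^ (2 * n)) : ℝ) : ℂ) *
      ((Real.exp (-(r ^ 2 / (2 * μ))) : ℝ) : ℂ))] at h
  have hs := (sphereArea_pos hd).ne'
  rw [mul_smul_comm] at h
  rw [smul_right_injective ℂ hs h]
  congr 1
  refine setIntegral_congr_fun measurableSet_Ioi fun r hr => ?_
  rw [← pow_mul_rpow_div_eq hd j n hr, Complex.real_smul, smul_eq_mul]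
  push_cast
  ring

theorem integrableOn_gaussian_mul_radialProfile {d : ℕ} (hd : 1 ≤ d) {j n : ℝ} (hn : 0 < n)
    (hj : 0 ≤ j) (h1 : j + d < 2 * n) {μ : ℝ} (hμ : 0 < μ) :
    IntegrableOn (fun r : ℝ => r ^ (d - 1) • (((Real.exp (-(μ * r ^ 2 / 2)) : ℝ) : ℂ) *
      ((radialProfile d j n r : ℝ) : ℂ))) (Ioi 0) := by
  refine (integrable_radial hd (f := fun r : ℝ => ((Real.exp (-(μ * r ^ 2 / 2)) : ℝ) : ℂ) *
      ((radialProfile d j n r : ℝ) : ℂ))).1 ?_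
  obtain ⟨f, hf⟩ := exists_C0_maximizerFun hd hn hj h1
  have h := Integrable.mul_bdd (c := ‖f‖) (integrable_gaussian (d := d) hμ)
    (map_continuous f).aestronglyMeasurable (Eventually.of_forall fun x => f.toBCF.norm_coe_le_norm x)
  refine h.congr (Eventually.of_forall fun x => ?_)
  beta_reduce
  rw [hf, maximizerFun_eq_radialProfile hd hn hj h1]

theorem mellin_exp_neg_mul_sq {μ : ℝ} (hμ : 0 < μ) {u : ℂ} (hu : 0 < u.re) :
    ∫ r in Ioi (0 : ℝ), (r : ℂ) ^ (u - 1) * ((Real.exp (-(μ * r ^ 2 / 2)) : ℝ) : ℂ) =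
      1 / 2 * (Complex.exp ((Real.log (2 / μ) : ℂ) * (u / 2)) * Complex.Gamma (u / 2)) := by
  have h := mellin_comp_rpow (fun x : ℝ => Complex.exp (-((μ / 2 : ℝ) * x))) u 2
  have h2 : 0 < (u / ((2 : ℝ) : ℂ)).re := by
    rw [Complex.div_ofReal_re]; positivity
  have e := Complex.integral_cpow_mul_exp_neg_mul_Ioi h2 (by positivity : 0 < μ / 2)
  have e2 : (1 / ((μ / 2 : ℝ) : ℂ)) = ((2 / μ : ℝ) : ℂ) := by push_cast; field_simp
  rw [e2, ofReal_cpow_eq_exp (by positivity)] at e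
  simp only [mellin, smul_eq_mul] at h
  rw [e] at h
  rw [abs_two, Complex.real_smul] at h
  push_cast at h e ⊢
  rw [one_div, ← h]
  refine setIntegral_congr_fun measurableSet_Ioi fun r _ => ?_
  congr 2
  rw [Real.rpow_two]
  push_cast
  ring

theorem integrable_profileKernel_line {d : ℕ} (hd : 1 ≤ d) {j n : ℝ} (hn : 0 < n) (hj : 0 ≤ j)
    (h1 : j + d < 2 * n) {c : ℝ} (hc : c < 0) (hc' : -((j + d) / 2) < c) :
    Integrable fun t : ℝ => profileKernel d j n (c + t * Complex.I) := by
  refine integrable_line (fun s hs => ?_) fun K hK => exists_norm_profileKernel_le d j hn hK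
  have hP := admissible_profileFoxParameters hd hn hj h1
  rw [← profileFoxParameters_kernel]
  refine (FoxParameters.differentiableAt_kernel hP.A_pos hP.B_pos ?_).continuousAt
  rintro (h | h)
  · obtain ⟨x, rfl, hx⟩ := leftPoles_profileFoxParameters d j hn h
    rw [Complex.ofReal_re] at hs
    linarith
  · obtain ⟨x, rfl, hx⟩ := rightPoles_profileFoxParameters d hn h1 h
    rw [Complex.ofReal_re] at hs
    linarith

theorem integrableOn_rpow_mul_gaussian {μ a : ℝ} (hμ : 0 < μ) (ha : 0 < a) :
    IntegrableOn (fun r : ℝ => r ^ (a - 1) * Real.exp (-(μ * r ^ 2 / 2))) (Ioi 0) := by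
  refine (integrableOn_rpow_mul_exp_neg_mul_sq (by positivity : 0 < μ / 2) (by linarith :
    -1 < a - 1)).congr_fun (fun r _ => ?_) measurableSet_Ioi
  beta_reduce
  congr 2
  ring

/-! ### The Mellin–Barnes representation of the profile -/

section MellinBarnes

variable {d : ℕ} {j n c : ℝ}

theorem rpow_mul_osc_eq {r : ℝ} (hr : 0 < r) (a c t : ℝ) :
    ((r ^ (a + 2 * c - 1) : ℝ) : ℂ) * Complex.exp (((2 * t * Real.log r : ℝ) : ℂ) * Complex.I) =
      (r : ℂ) ^ ((a : ℂ) + 2 * (c + t * Complex.I) - 1) := by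
  rw [ofReal_cpow_eq_exp hr, Real.rpow_def_of_pos hr, Complex.ofReal_exp, ← Complex.exp_add]
  congr 1
  push_cast
  ring

theorem integral_rpow_gaussian_osc {μ : ℝ} (hμ : 0 < μ) (hc' : -((d : ℝ) / 2) < c) (t : ℝ) :
    ∫ r in Ioi (0 : ℝ), ((r ^ ((d : ℝ) + 2 * c - 1) * Real.exp (-(μ * r ^ 2 / 2)) : ℝ) : ℂ) *
      Complex.exp (((2 * t * Real.log r : ℝ) : ℂ) * Complex.I) =
      1 / 2 * (Complex.exp ((Real.log (2 / μ) : ℂ) * (d / 2 + (c + t * Complex.I))) *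
        Complex.Gamma (d / 2 + (c + t * Complex.I))) := by
  have hu : 0 < ((d : ℂ) + 2 * (c + t * Complex.I)).re := by
    simp
    linarith
  have h := mellin_exp_neg_mul_sq hμ hu
  have e : ((d : ℂ) + 2 * (c + t * Complex.I)) / 2 = d / 2 + (c + t * Complex.I) := by ring
  rw [e] at h
  rw [← h]
  refine setIntegral_congr_fun measurableSet_Ioi fun r hr => ?_
  have := rpow_mul_osc_eq hr d c t
  rw [Complex.ofReal_natCast] at this
  rw [← this, Complex.ofReal_mul]
  ring

theorem integral_rpow_div_osc (hn : 0 < n) (h1 : j + d < 2 * n) (hc : c < 0)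
    (hc' : -((j + d) / 2) < c) (t : ℝ) :
    ∫ r in Ioi (0 : ℝ), ((r ^ ((j + d) + 2 * c - 1) / (1 + r ^ (2 * n)) : ℝ) : ℂ) *
      Complex.exp (((2 * t * Real.log r : ℝ) : ℂ) * Complex.I) =
      (2 * n : ℂ)⁻¹ * (Complex.Gamma ((j + d) / (2 * n) + (c + t * Complex.I) / n) *
        Complex.Gamma (1 - ((j + d) / (2 * n) + (c + t * Complex.I) / n))) := by
  have e : (((j + d : ℝ) : ℂ) + 2 * (c + t * Complex.I)).re = j + d + 2 * c := by simp
  have h := mellin_inv_one_add_rpow hn (u := ((j + d : ℝ) : ℂ) + 2 * (c + t * Complex.I))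
    (by rw [e]; linarith) (by rw [e]; linarith)
  have hn' : (n : ℂ) ≠ 0 := by exact_mod_cast hn.ne'
  have e2 : (((j + d : ℝ) : ℂ) + 2 * (c + t * Complex.I)) / (2 * n) =
      (j + d) / (2 * n) + (c + t * Complex.I) / n := by
    push_cast
    field_simp
  rw [e2] at h
  rw [← h, mellin]
  refine setIntegral_congr_fun measurableSet_Ioi fun r hr => ?_
  rw [smul_eq_mul, ← rpow_mul_osc_eq hr]
  push_cast
  ring

/-- The Cahen–Mellin integral at `y = r²/(2μ)`, with `r^(2s)` separated into its modulus and its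
phase. -/
theorem oscillatory_Gamma_neg {μ : ℝ} (hμ : 0 < μ) (hc : c < 0) {r : ℝ} (hr : 0 < r) :
    ((r ^ (2 * c) : ℝ) : ℂ) * oscillatory (fun t => Complex.exp (-(Real.log (2 * μ) : ℂ) *
      (c + t * Complex.I)) * Complex.Gamma (-(c + t * Complex.I))) r =
      2 * Real.pi * ((Real.exp (-(r ^ 2 / (2 * μ))) : ℝ) : ℂ) := by
  have hy : 0 < r ^ 2 / (2 * μ) := by positivity
  have h := integral_Gamma_neg_mul_cpow hc hy
  have hl : Real.log (r ^ 2 / (2 * μ)) = 2 * Real.log r - Real.log (2 * μ) := by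
    rw [Real.log_div (by positivity) (by positivity), Real.log_pow]
    norm_num
  rw [Complex.ofReal_exp, Complex.ofReal_neg, ← h, oscillatory, ← integral_const_mul]
  refine integral_congr_ae (Eventually.of_forall fun t => ?_)
  beta_reduce
  rw [ofReal_cpow_eq_exp hy, hl, Real.rpow_def_of_pos hr, Complex.ofReal_exp]
  have : Complex.exp (((2 * Real.log r - Real.log (2 * μ) : ℝ) : ℂ) * (c + t * Complex.I)) =
      Complex.exp ((Real.log r * (2 * c) : ℝ) : ℂ) * Complex.exp (-(Real.log (2 * μ) : ℂ) *
      (c + t * Complex.I)) * Complex.exp (((2 * t * Real.log r : ℝ) : ℂ) * Complex.I) := by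
    rw [← Complex.exp_add, ← Complex.exp_add]
    congr 1
    push_cast
    ring
  rw [this]
  ring

theorem integrable_exp_mul {f : ℝ → ℂ} (hf : Integrable f) (a c : ℝ) :
    Integrable fun t : ℝ => Complex.exp (-(a : ℂ) * (c + t * Complex.I)) * f t := by
  refine Integrable.bdd_mul (c := Real.exp (-(a * c))) hf
    (Continuous.aestronglyMeasurable (by fun_prop)) (Eventually.of_forall fun t => ?_)
  rw [Complex.norm_exp]
  simp

/-- The Mellin-Barnes integrand on a line, up to an oscillating power. -/
noncomputable def barnesWeight (d : ℕ) (j n c t : ℝ) : ℂ :=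
  Complex.exp (-(Real.log 4 : ℂ) * (c + t * Complex.I)) * profileKernel d j n (c + t * Complex.I)

theorem integrable_barnesWeight (hd : 1 ≤ d) (hn : 0 < n) (hj : 0 ≤ j)
    (h1 : j + d < 2 * n) (hc : c < 0) (hc' : -((j + d) / 2) < c) :
    Integrable (barnesWeight d j n c) :=
  integrable_exp_mul (integrable_profileKernel_line hd hn hj h1 hc hc') (Real.log 4) c

/-- `Γ(d/2+s)`, nonzero since `c > -d/2`, cancels the denominator of the kernel, and `4^(-s) (2/μ)^s
= (2μ)^(-s)`. What remains is the product of a Cahen–Mellin factor and an Euler factor. -/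
theorem barnesWeight_mul (hn : 0 < n) {μ : ℝ} (hμ : 0 < μ) (hc' : -((d : ℝ) / 2) < c) (t : ℝ) :
    barnesWeight d j n c t * (1 / 2 * (Complex.exp ((Real.log (2 / μ) : ℂ) *
      (d / 2 + (c + t * Complex.I))) * Complex.Gamma (d / 2 + (c + t * Complex.I)))) =
    ((n * (2 / μ) ^ ((d : ℝ) / 2) : ℝ) : ℂ) *
      ((Complex.exp (-(Real.log (2 * μ) : ℂ) * (c + t * Complex.I)) *
        Complex.Gamma (-(c + t * Complex.I))) *
      ((2 * n : ℂ)⁻¹ * (Complex.Gamma ((j + d) / (2 * n) + (c + t * Complex.I) / n) *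
        Complex.Gamma (1 - ((j + d) / (2 * n) + (c + t * Complex.I) / n))))) := by
  have hn' : (n : ℂ) ≠ 0 := by exact_mod_cast hn.ne'
  have hG : Complex.Gamma (d / 2 + (c + t * Complex.I)) ≠ 0 := by
    refine Complex.Gamma_ne_zero_of_re_pos ?_
    simp
    linarith
  have hl1 : Real.log (2 / μ) = Real.log 2 - Real.log μ := Real.log_div two_ne_zero hμ.ne'
  have hl2 : Real.log (2 * μ) = Real.log 2 + Real.log μ := Real.log_mul two_ne_zero hμ.ne'
  have hl3 : Real.log 4 = 2 * Real.log 2 := by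
    rw [show (4 : ℝ) = 2 ^ 2 by norm_num, Real.log_pow]; norm_num
  have e : Complex.exp (-(Real.log 4 : ℂ) * (c + t * Complex.I)) *
      Complex.exp ((Real.log (2 / μ) : ℂ) * (d / 2 + (c + t * Complex.I))) =
      (((2 / μ) ^ ((d : ℝ) / 2) : ℝ) : ℂ) *
        Complex.exp (-(Real.log (2 * μ) : ℂ) * (c + t * Complex.I)) := by
    rw [Real.rpow_def_of_pos (by positivity), Complex.ofReal_exp, ← Complex.exp_add,
      ← Complex.exp_add, hl1, hl2, hl3]
    congr 1
    push_cast
    ring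
  rw [barnesWeight, profileKernel]
  generalize Complex.Gamma (d / 2 + (c + t * Complex.I)) = G at *
  generalize Complex.exp (-(Real.log 4 : ℂ) * (c + t * Complex.I)) = X at *
  generalize Complex.exp ((Real.log (2 / μ) : ℂ) * (d / 2 + (c + t * Complex.I))) = Y at *
  generalize Complex.exp (-(Real.log (2 * μ) : ℂ) * (c + t * Complex.I)) = Z at *
  generalize Complex.Gamma (-(c + t * Complex.I)) = G1
  generalize Complex.Gamma ((j + d) / (2 * n) + (c + t * Complex.I) / n) = G2
  generalize Complex.Gamma (1 - ((j + d) / (2 * n) + (c + t * Complex.I) / n)) = G3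
  rw [Complex.ofReal_mul]
  generalize (((2 / μ) ^ ((d : ℝ) / 2) : ℝ) : ℂ) = W at *
  field_simp
  linear_combination (G1 * G2 * G3) * e

/-- Fubini twice: integrating the Gaussian first cancels `Γ(d/2+s)`; then the Euler factor is
written back as an integral over `r`, after which the integral over `t` is of Cahen–Mellin type. -/
theorem integral_gaussian_mul_oscillatory_barnesWeight (hd : 1 ≤ d) (hn : 0 < n) (hj : 0 ≤ j)
    (h1 : j + d < 2 * n) (hc : c < 0) (hc' : -((d : ℝ) / 2) < c) {μ : ℝ} (hμ : 0 < μ) :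
    ∫ r in Ioi (0 : ℝ), ((r ^ ((d : ℝ) + 2 * c - 1) * Real.exp (-(μ * r ^ 2 / 2)) : ℝ) : ℂ) *
      oscillatory (barnesWeight d j n c) r =
    ((n * (2 / μ) ^ ((d : ℝ) / 2) * (2 * Real.pi) : ℝ) : ℂ) *
      ∫ r in Ioi (0 : ℝ), ((r ^ ((j + d) - 1) / (1 + r ^ (2 * n)) *
          Real.exp (-(r ^ 2 / (2 * μ))) : ℝ) : ℂ) := by
  have hcj : -((j + d) / 2) < c := by linarith
  have hb1 : IntegrableOn (fun r : ℝ => ((r ^ ((d : ℝ) + 2 * c - 1) *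
      Real.exp (-(μ * r ^ 2 / 2)) : ℝ) : ℂ)) (Ioi 0) :=
    (integrableOn_rpow_mul_gaussian hμ (by linarith : 0 < (d : ℝ) + 2 * c)).ofReal (𝕜 := ℂ)
  have hb2 : IntegrableOn (fun r : ℝ => ((r ^ ((j + d) + 2 * c - 1) / (1 + r ^ (2 * n)) : ℝ) : ℂ))
      (Ioi 0) :=
    (integrableOn_rpow_div_one_add_rpow hn (by linarith : 0 < j + d + 2 * c) (by linarith)).ofReal
      (𝕜 := ℂ)
  have ha2 := integrable_exp_mul (integrable_Gamma_neg_line hc) (Real.log (2 * μ)) c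
  rw [integral_mul_oscillatory (integrable_barnesWeight hd hn hj h1 hc hcj) hb1]
  simp_rw [integral_rpow_gaussian_osc hμ hc', barnesWeight_mul hn hμ hc',
    ← integral_rpow_div_osc hn h1 hc hcj]
  rw [integral_const_mul, ← integral_mul_oscillatory ha2 hb2,
    Complex.ofReal_mul (n * (2 / μ) ^ ((d : ℝ) / 2)) (2 * Real.pi),
    mul_assoc ((n * (2 / μ) ^ ((d : ℝ) / 2) : ℝ) : ℂ)]
  congr 1
  rw [← integral_const_mul]
  refine setIntegral_congr_fun measurableSet_Ioi fun r hr => ?_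
  have hr' : (0 : ℝ) < r := hr
  have h3 := oscillatory_Gamma_neg hμ hc hr
  have e : r ^ ((j + d) + 2 * c - 1) = r ^ ((j + d) - 1) * r ^ (2 * c) := by
    rw [← Real.rpow_add hr']; congr 1; ring
  rw [e]
  push_cast at h3 ⊢
  linear_combination (((r ^ ((j + d) - 1) : ℝ) : ℂ) / (1 + ((r ^ (2 * n) : ℝ) : ℂ))) * h3

/-- The Mellin-Barnes representation of the profile. -/
theorem rpow_mul_oscillatory_barnesWeight (hd : 1 ≤ d) (hn : 0 < n) (hj : 0 ≤ j)
    (h1 : j + d < 2 * n) (hc : c < 0) (hc' : -((d : ℝ) / 2) < c) {r : ℝ} (hr : 0 < r) :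
    ((r ^ (2 * c) : ℝ) : ℂ) * oscillatory (barnesWeight d j n c) r =
      ((2 * Real.pi * n * 2 ^ ((d : ℝ) / 2) * radialProfile d j n r : ℝ) : ℂ) := by
  set κ : ℝ := 2 * Real.pi * n * 2 ^ ((d : ℝ) / 2) with hκ
  have hcj : -((j + d) / 2) < c := by linarith
  have ha := integrable_barnesWeight hd hn hj h1 hc hcj
  have hpow : ∀ r : ℝ, 0 < r → r ^ ((d : ℝ) + 2 * c - 1) = r ^ (d - 1) * r ^ (2 * c) := by
    intro r hr
    rw [← Real.rpow_natCast, ← Real.rpow_add hr, Nat.cast_sub hd]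
    congr 1
    push_cast
    ring
  -- The difference of the two sides, weighted by `r^(d-1)`. Its Gaussian integrals vanish for all
  -- `μ > 0`; those with `μ = m + 1` are the moments needed for `g = 0`.
  let g : ℝ → ℂ := fun r => ((r ^ (d - 1) : ℝ) : ℂ) *
    (((r ^ (2 * c) : ℝ) : ℂ) * oscillatory (barnesWeight d j n c) r -
      (κ : ℂ) * ((radialProfile d j n r : ℝ) : ℂ))
  have hg : ContinuousOn g (Ioi 0) := by
    refine ContinuousOn.mul (by fun_prop) (ContinuousOn.sub (ContinuousOn.mul ?_
      (continuousOn_oscillatory ha)) (continuousOn_const.mul ?_))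
    · refine Complex.continuous_ofReal.comp_continuousOn fun r hr => ?_
      exact (Real.continuousAt_rpow_const _ _ (Or.inl (ne_of_gt hr))).continuousWithinAt
    · exact Complex.continuous_ofReal.comp_continuousOn
        ((continuousOn_radialProfile hd hn hj h1).mono Ioi_subset_Ici_self)
  have hsplit : ∀ μ : ℝ, 0 < μ →
      IntegrableOn (fun r => Real.exp (-(μ * r ^ 2 / 2)) • g r) (Ioi 0) ∧
      ∫ r in Ioi (0 : ℝ), Real.exp (-(μ * r ^ 2 / 2)) • g r = 0 := by
    intro μ hμ
    have e : EqOn (fun r => ((r ^ ((d : ℝ) + 2 * c - 1) * Real.exp (-(μ * r ^ 2 / 2)) : ℝ) : ℂ) *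
        oscillatory (barnesWeight d j n c) r - (κ : ℂ) * (r ^ (d - 1) •
        (((Real.exp (-(μ * r ^ 2 / 2)) : ℝ) : ℂ) * ((radialProfile d j n r : ℝ) : ℂ))))
        (fun r => Real.exp (-(μ * r ^ 2 / 2)) • g r) (Ioi 0) := by
      intro r hr
      simp only [g]
      rw [hpow r hr, Complex.real_smul, Complex.real_smul]
      push_cast
      ring
    have i1 : IntegrableOn (fun r => ((r ^ ((d : ℝ) + 2 * c - 1) *
        Real.exp (-(μ * r ^ 2 / 2)) : ℝ) : ℂ) * oscillatory (barnesWeight d j n c) r) (Ioi 0) := by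
      have hb1 : IntegrableOn (fun r : ℝ => ((r ^ ((d : ℝ) + 2 * c - 1) *
          Real.exp (-(μ * r ^ 2 / 2)) : ℝ) : ℂ)) (Ioi 0) :=
        (integrableOn_rpow_mul_gaussian hμ (by linarith : 0 < (d : ℝ) + 2 * c)).ofReal
          (𝕜 := ℂ)
      exact Integrable.mul_bdd (c := ∫ t, ‖barnesWeight d j n c t‖) hb1
        ((continuousOn_oscillatory ha).aestronglyMeasurable measurableSet_Ioi)
        (Eventually.of_forall fun r => norm_oscillatory_le _ r)
    have i2 := (integrableOn_gaussian_mul_radialProfile hd hn hj h1 hμ).const_mul (κ : ℂ)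
    refine ⟨IntegrableOn.congr_fun (i1.sub i2) e measurableSet_Ioi, ?_⟩
    rw [← setIntegral_congr_fun measurableSet_Ioi e, integral_sub i1 i2, integral_const_mul,
      integral_gaussian_mul_oscillatory_barnesWeight hd hn hj h1 hc hc' hμ,
      integral_gaussian_mul_radialProfile hd hn hj h1 hμ, ← mul_assoc ((κ : ℝ) : ℂ), ← sub_mul]
    refine mul_eq_zero_of_left ?_ _
    rw [← Complex.ofReal_mul, ← Complex.ofReal_sub, Complex.ofReal_eq_zero, hκ,
      Real.div_rpow zero_le_two hμ.le, Real.rpow_neg hμ.le]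
    ring
  have h0 := eq_zero_of_integral_exp_pow_smul (g := g) hg ?_ ?_ hr
  · have hr' : ((r ^ (d - 1) : ℝ) : ℂ) ≠ 0 := by exact_mod_cast (pow_pos hr _).ne'
    have := sub_eq_zero.1 ((mul_eq_zero.1 h0).resolve_left hr')
    rw [this, Complex.ofReal_mul κ]
  · simpa using (hsplit 1 one_pos).1
  · intro m
    have := (hsplit ((m : ℝ) + 1) (by positivity)).2
    rw [← this]
    refine integral_congr_ae (Eventually.of_forall fun r => ?_)
    beta_reduce
    rw [← Real.exp_nat_mul]
    congr 2
    push_cast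
    ring

theorem integral_profileKernel_line (hd : 1 ≤ d) (hn : 0 < n) (hj : 0 ≤ j)
    (h1 : j + d < 2 * n) (hc : c < 0) (hc' : -((d : ℝ) / 2) < c) {r : ℝ} (hr : 0 < r) :
    ∫ t : ℝ, (((r / 2) ^ 2 : ℝ) : ℂ) ^ (c + t * Complex.I) * profileKernel d j n (c + t * Complex.I) =
      ((2 * Real.pi * n * 2 ^ ((d : ℝ) / 2) * radialProfile d j n r : ℝ) : ℂ) := by
  rw [← rpow_mul_oscillatory_barnesWeight hd hn hj h1 hc hc' hr, oscillatory, ← integral_const_mul]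
  refine integral_congr_ae (Eventually.of_forall fun t => ?_)
  beta_reduce
  have hl : Real.log ((r / 2) ^ 2) = 2 * Real.log r - Real.log 4 := by
    rw [div_pow, Real.log_div (by positivity) (by positivity), Real.log_pow]
    norm_num
  rw [barnesWeight, ofReal_cpow_eq_exp (by positivity), hl, Real.rpow_def_of_pos hr, Complex.ofReal_exp]
  have : Complex.exp (((2 * Real.log r - Real.log 4 : ℝ) : ℂ) * (c + t * Complex.I)) =
      Complex.exp ((Real.log r * (2 * c) : ℝ) : ℂ) * Complex.exp (-(Real.log 4 : ℂ) *
      (c + t * Complex.I)) * Complex.exp (((2 * t * Real.log r : ℝ) : ℂ) * Complex.I) := by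
    rw [← Complex.exp_add, ← Complex.exp_add]
    congr 1
    push_cast
    ring
  rw [this]
  ring

end MellinBarnes

/-! ### The Fox function representation -/

theorem hasValuePos_profileFoxParameters {d : ℕ} (hd : 1 ≤ d) {j n : ℝ} (hn : 0 < n) (hj : 0 ≤ j)
    (h1 : j + d < 2 * n) {r : ℝ} (hr : 0 < r) :
    (profileFoxParameters d j n).HasValuePos ((r / 2) ^ 2)
      ((2 ^ ((d : ℝ) / 2) * n * radialProfile d j n r : ℝ) : ℂ) := by
  have hd' : (1 : ℝ) ≤ d := by exact_mod_cast hd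
  -- As `d ≥ 1`, `c = -1/4` lies in `(-d/2, 0)`; it separates the left poles, at most `-1/2`, from
  -- the right ones, which are nonnegative.
  have h := (FoxParameters.hasValuePos_of_line (c := -(1 / 4))
    (admissible_profileFoxParameters hd hn hj h1) (kernelDecays_profileFoxParameters d j hn)
    (fun σ hσ => by
      obtain ⟨x, hx, hx'⟩ := leftPoles_profileFoxParameters d j hn hσ
      exact ⟨x, hx, by linarith⟩)
    (fun σ hσ => by
      obtain ⟨x, hx, hx'⟩ := rightPoles_profileFoxParameters d hn h1 hσ
      exact ⟨x, hx, by linarith⟩) (z := (r / 2) ^ 2) (by positivity)).2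
  rw [profileFoxParameters_kernel, integral_profileKernel_line hd hn hj h1 (by norm_num) (by linarith)
    hr] at h
  have hp : (Real.pi : ℂ) ≠ 0 := by exact_mod_cast Real.pi_ne_zero
  have e : (1 / (2 * (Real.pi : ℂ))) * ((2 * Real.pi * n * 2 ^ ((d : ℝ) / 2) *
      radialProfile d j n r : ℝ) : ℂ) = ((2 ^ ((d : ℝ) / 2) * n * radialProfile d j n r : ℝ) : ℂ) := by
    push_cast
    field_simp
  rwa [e] at h

/-- A value at zero of a Fox function is a limit of the values at positive arguments. -/
theorem FoxParameters.hasFoxH_of_continuousOn {n ns m ms : ℕ} {P : FoxParameters n ns m ms}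
    {F u : ℝ → ℝ} (hF : ContinuousOn F (Ici 0)) (hu : Continuous u) (hu0 : u 0 = 0)
    (hu1 : ∀ x, 0 < x → 0 < u x) (κ : ℝ)
    (h : ∀ x, 0 < x → P.HasValuePos x ((κ * F (u x) : ℝ) : ℂ)) {x : ℝ} (hx : 0 ≤ x) :
    P.HasFoxH x ((κ * F (u x) : ℝ) : ℂ) := by
  rcases hx.eq_or_lt with rfl | hx
  · refine Or.inr ⟨rfl, fun x => ((κ * F (u x) : ℝ) : ℂ), h, ?_⟩
    refine (Complex.continuous_ofReal.tendsto _).comp (Tendsto.const_mul κ ?_)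
    rw [hu0]
    refine (hF 0 self_mem_Ici).tendsto.comp (tendsto_nhdsWithin_iff.2 ⟨?_, ?_⟩)
    · have := (hu.tendsto 0).mono_left (nhdsWithin_le_nhds (s := Ioi 0))
      rwa [hu0] at this
    · filter_upwards [self_mem_nhdsWithin] with x hx
      exact (hu1 x hx).le
  · exact Or.inl ⟨hx, h x hx⟩

theorem hasFoxH_profileFoxParameters {d : ℕ} (hd : 1 ≤ d) {j n : ℝ} (hn : 0 < n) (hj : 0 ≤ j)
    (h1 : j + d < 2 * n) {r : ℝ} (hr : 0 ≤ r) :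
    (profileFoxParameters d j n).HasFoxH ((r / 2) ^ 2)
      ((2 ^ ((d : ℝ) / 2) * n * radialProfile d j n r : ℝ) : ℂ) := by
  -- `2√x` inverts `x = (r/2)²`, so the limit at `z = 0` becomes continuity of the profile at `0`.
  have h := FoxParameters.hasFoxH_of_continuousOn (P := profileFoxParameters d j n)
    (continuousOn_radialProfile hd hn hj h1) (u := fun x => 2 * Real.sqrt x) (by fun_prop)
    (by simp) (fun x hx => by positivity) (2 ^ ((d : ℝ) / 2) * n) (fun x hx => by
      have := hasValuePos_profileFoxParameters hd hn hj h1 (r := 2 * Real.sqrt x) (by positivity)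
      rwa [mul_div_cancel_left₀ _ (two_ne_zero' ℝ), Real.sq_sqrt hx.le] at this)
    (sq_nonneg (r / 2))
  beta_reduce at h
  rwa [Real.sqrt_sq (by positivity), mul_div_cancel₀ _ (two_ne_zero' ℝ)] at h

/-! ### The Meijer function representation -/

/-- Compare with the point `1` in the multiplication formula, where all factors are nonzero.
`Complex.Gamma` is `0` at its poles, so this says that both sides have their poles at the same
points. -/
theorem prod_Gamma_ne_zero_iff {N : ℕ} (hN : 1 ≤ N) (v : ℂ) :
    ∏ h ∈ Finset.range N, Complex.Gamma (v + h / N) ≠ 0 ↔ Complex.Gamma (N * v) ≠ 0 := by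
  have hN' : (N : ℂ) ≠ 0 := by exact_mod_cast (by omega : N ≠ 0)
  have hN0 : (0 : ℝ) < N := by exact_mod_cast hN
  have h := prod_Gamma_mul_eq hN 1 v
  have h1 : ∏ h ∈ Finset.range N, Complex.Gamma (1 + (h : ℂ) / N) ≠ 0 := by
    refine Finset.prod_ne_zero_iff.2 fun k _ => Complex.Gamma_ne_zero_of_re_pos ?_
    have e : (1 + (k : ℂ) / N).re = 1 + (k : ℝ) / N := by simp [Complex.div_natCast_re]
    rw [e]
    positivity
  have h2 : Complex.Gamma (N * 1) ≠ 0 := Complex.Gamma_ne_zero_of_re_pos (by simpa using hN0)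
  have h3 : ∀ w : ℂ, (N : ℂ) ^ w ≠ 0 := fun w => by simp [Complex.cpow_eq_zero_iff, hN']
  constructor
  · intro h4 h5
    rw [h5, zero_mul, mul_zero] at h
    exact mul_ne_zero h4 (mul_ne_zero h2 (h3 _)) h.symm
  · intro h4 h5
    rw [h5, zero_mul] at h
    exact mul_ne_zero h1 (mul_ne_zero h4 (h3 _)) h

/-- In a quotient the constant of Gauss's formula disappears. The identity holds at the poles as
well, both sides being `0` when the denominators vanish. -/
theorem prod_Gamma_div_prod_Gamma {N : ℕ} (hN : 1 ≤ N) (u v : ℂ) :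
    (∏ h ∈ Finset.range N, Complex.Gamma (u + h / N)) / ∏ h ∈ Finset.range N, Complex.Gamma (v + h / N) =
      Complex.Gamma (N * u) / Complex.Gamma (N * v) * (N : ℂ) ^ (N * v - N * u) := by
  have hN' : (N : ℂ) ≠ 0 := by exact_mod_cast (by omega : N ≠ 0)
  have h3 : (N : ℂ) ^ (N * u) ≠ 0 := by simp [Complex.cpow_eq_zero_iff, hN']
  have h := prod_Gamma_mul_eq hN u v
  rw [Complex.cpow_sub _ _ hN']
  by_cases h0 : Complex.Gamma (N * v) = 0
  · have h1 : ∏ h ∈ Finset.range N, Complex.Gamma (v + h / N) = 0 := by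
      by_contra hne
      exact (prod_Gamma_ne_zero_iff hN v).1 hne h0
    rw [h0, h1, div_zero, div_zero, zero_mul]
  · have h1 := (prod_Gamma_ne_zero_iff hN v).2 h0
    rw [div_mul_div_comm, div_eq_div_iff h1 (mul_ne_zero h0 h3)]
    linear_combination h

/-- The reflection formula turns every pair of factors into `π / sin`, and the product formula for
sines does the rest. -/
theorem prod_Gamma_mul_Gamma_one_sub {M : ℕ} (hM : 1 ≤ M) (w : ℂ) :
    (∏ l ∈ Finset.range M, Complex.Gamma (w + l / M)) *
      ∏ l ∈ Finset.range M, Complex.Gamma (1 - (w + l / M)) =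
      (Real.pi : ℂ) ^ (M - 1) * 2 ^ (M - 1) *
        (Complex.Gamma (M * w) * Complex.Gamma (1 - M * w)) := by
  rw [← Finset.prod_mul_distrib]
  simp_rw [Complex.Gamma_mul_Gamma_one_sub]
  rw [Finset.prod_div_distrib, prod_sin_add_div hM, Finset.prod_const, Finset.card_range,
    div_div_eq_mul_div]
  obtain ⟨m, rfl⟩ : ∃ m, M = m + 1 := ⟨M - 1, by omega⟩
  rw [Nat.add_sub_cancel, pow_succ]
  ring

/-- Gauss's formula contracts the `N`-fold products to `Γ(-Ns)/Γ(d/2+Ns)`, and the reflection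
formula contracts the `M`-fold ones. The power of `N` left over is `N^(d/2)` times `N^(2Ns)`; the
latter accounts for `ρ/(2N)` in place of `ρ/2`. -/
theorem kernel_meijerParameters_profile (d : ℕ) (j : ℝ) {N M : ℕ} (hN : 1 ≤ N) (hM : 1 ≤ M) (s : ℂ) :
    (meijerParameters (profileMeijerA d j N M) ![] (profileMeijerB d j N M)
      (profileMeijerBs d N)).kernel s =
      ((Real.pi ^ (M - 1) * 2 ^ (M - 1) * (N : ℝ) ^ ((d : ℝ) / 2) : ℝ) : ℂ) *
        (Complex.exp ((2 * Real.log N : ℝ) * (N * s)) * profileKernel d j ((N : ℝ) / M) (N * s)) := by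
  have hN' : (N : ℂ) ≠ 0 := by exact_mod_cast (by omega : N ≠ 0)
  have hM' : (M : ℂ) ≠ 0 := by exact_mod_cast (by omega : M ≠ 0)
  have hN0 : (0 : ℝ) < N := by exact_mod_cast hN
  set w : ℂ := (j + d) / (2 * N) + s with hw
  set v : ℂ := d / (2 * N) + s with hv
  have e1 : ∏ l : Fin M, Complex.Gamma (1 - profileMeijerA d j N M l + (1 : ℝ) * s) =
      ∏ l ∈ Finset.range M, Complex.Gamma (w + l / M) := by
    rw [Finset.prod_range]
    refine Finset.prod_congr rfl fun l _ => ?_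
    rw [profileMeijerA]
    congr 1
    push_cast
    ring
  have e2 : ∏ l : Fin (N + M), Complex.Gamma (profileMeijerB d j N M l - (1 : ℝ) * s) =
      (∏ h ∈ Finset.range N, Complex.Gamma (-s + h / N)) *
        ∏ l ∈ Finset.range M, Complex.Gamma (1 - (w + l / M)) := by
    -- The parameters `b_(N+h)` list the arguments `1 - (w + l/M)` in the opposite order, so the
    -- range is reflected.
    rw [Fin.prod_univ_add,
      ← Finset.prod_range_reflect (fun l : ℕ => Complex.Gamma (1 - (w + (l : ℂ) / M))), Finset.prod_range, Finset.prod_range]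
    congr 1
    · refine Finset.prod_congr rfl fun l _ => ?_
      rw [profileMeijerB, Fin.append_left]
      congr 1
      push_cast
      ring
    · refine Finset.prod_congr rfl fun l _ => ?_
      rw [profileMeijerB, Fin.append_right, Nat.sub_sub, Nat.cast_sub (by omega)]
      congr 1
      push_cast
      field_simp
      rw [hw]
      field_simp
      ring
  have e3 : ∏ l : Fin N, Complex.Gamma (1 - profileMeijerBs d N l + (1 : ℝ) * s) =
      ∏ h ∈ Finset.range N, Complex.Gamma (v + h / N) := by
    rw [Finset.prod_range]
    refine Finset.prod_congr rfl fun l _ => ?_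
    rw [profileMeijerBs]
    congr 1
    push_cast
    ring
  have e4 : (M : ℂ) * w = (j + d) / (2 * ((N : ℝ) / M : ℝ)) + N * s / ((N : ℝ) / M : ℝ) := by
    rw [hw]
    push_cast
    field_simp
  have e5 : (N : ℂ) * v = d / 2 + N * s := by
    rw [hv]
    field_simp
  have e6 : (N : ℂ) ^ (N * v - N * -s) = (((N : ℝ) ^ ((d : ℝ) / 2) : ℝ) : ℂ) *
      Complex.exp ((2 * Real.log N : ℝ) * (N * s)) := by
    rw [e5, ← Complex.ofReal_natCast, ofReal_cpow_eq_exp hN0, Real.rpow_def_of_pos hN0,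
      Complex.ofReal_exp, ← Complex.exp_add]
    congr 1
    push_cast
    ring
  have h1 := prod_Gamma_div_prod_Gamma hN (-s) v
  have h2 := prod_Gamma_mul_Gamma_one_sub hM w
  rw [e6, e5] at h1
  rw [e4] at h2
  simp only [FoxParameters.kernel, meijerParameters]
  rw [e1, e2, e3, Finset.univ_eq_empty, Finset.prod_empty, one_mul, profileKernel,
    mul_left_comm, mul_div_right_comm, h1, h2, mul_neg]
  push_cast
  ring

section Meijer

variable {d : ℕ} {j : ℝ} {N M : ℕ}

theorem kernelDecays_meijerParameters_profile (d : ℕ) (j : ℝ) (hN : 1 ≤ N) (hM : 1 ≤ M) :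
    (meijerParameters (profileMeijerA d j N M) ![] (profileMeijerB d j N M)
      (profileMeijerBs d N)).KernelDecays := by
  intro K hK
  have hN0 : (0 : ℝ) < N := by exact_mod_cast hN
  have hN1 : (1 : ℝ) ≤ N := by exact_mod_cast hN
  have hM0 : (0 : ℝ) < M := by exact_mod_cast hM
  obtain ⟨C, hC⟩ := exists_norm_profileKernel_le d j (div_pos hN0 hM0) (K := N * K) (by positivity)
  set κ : ℝ := Real.pi ^ (M - 1) * 2 ^ (M - 1) * (N : ℝ) ^ ((d : ℝ) / 2) with hκ
  have hκ0 : 0 < κ := by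
    have := Real.pi_pos
    positivity
  refine ⟨κ * (Real.exp (|2 * Real.log N| * (N * K)) * (C / N ^ 2)), fun s hs hs' => ?_⟩
  have hre : ((N : ℂ) * s).re = N * s.re := by simp
  have him : ((N : ℂ) * s).im = N * s.im := by simp
  have h1 : |((N : ℂ) * s).re| ≤ N * K := by
    rw [hre, abs_mul, abs_of_pos hN0]
    exact mul_le_mul_of_nonneg_left hs hN0.le
  have h2 := hC (N * s) h1 (by
    rw [him, abs_mul, abs_of_pos hN0]
    nlinarith)
  have h3 : ‖Complex.exp ((2 * Real.log N : ℝ) * (N * s))‖ ≤ Real.exp (|2 * Real.log N| * (N * K)) := by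
    rw [Complex.norm_exp, Complex.re_ofReal_mul]
    refine Real.exp_le_exp.2 ((le_abs_self _).trans ?_)
    rw [abs_mul]
    exact mul_le_mul_of_nonneg_left h1 (abs_nonneg _)
  rw [kernel_meijerParameters_profile d j hN hM, ← hκ, norm_mul, norm_mul, Complex.norm_real,
    Real.norm_of_nonneg hκ0.le, mul_div_assoc, mul_div_assoc, div_div]
  rw [him, mul_pow] at h2
  exact mul_le_mul_of_nonneg_left (mul_le_mul h3 h2 (norm_nonneg _) (Real.exp_pos _).le) hκ0.le

theorem leftPoles_meijerParameters_profile {σ : ℂ}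
    (hσ : σ ∈ (meijerParameters (profileMeijerA d j N M) ![] (profileMeijerB d j N M)
      (profileMeijerBs d N)).leftPoles) : ∃ x : ℝ, σ = x ∧ x ≤ -((j + d) / (2 * N)) := by
  obtain ⟨l, k, rfl⟩ := hσ
  refine ⟨-((j + d) / (2 * N)) - (l : ℕ) / M - k, ?_, ?_⟩
  · simp only [meijerParameters, profileMeijerA]
    push_cast
    ring
  · have h1 : (0 : ℝ) ≤ ((l : ℕ) : ℝ) / M := by positivity
    have h2 : (0 : ℝ) ≤ k := by positivity
    linarith

theorem rightPoles_meijerParameters_profile (hN : 1 ≤ N) (hM : 1 ≤ M)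
    (h1 : j + d < 2 * ((N : ℝ) / M)) {σ : ℂ}
    (hσ : σ ∈ (meijerParameters (profileMeijerA d j N M) ![] (profileMeijerB d j N M)
      (profileMeijerBs d N)).rightPoles) : ∃ x : ℝ, σ = x ∧ 0 ≤ x := by
  obtain ⟨l, k, rfl⟩ := hσ
  have hN0 : (0 : ℝ) < N := by exact_mod_cast hN
  have hM0 : (0 : ℝ) < M := by exact_mod_cast hM
  have h2 : (0 : ℝ) ≤ k := by positivity
  induction l using Fin.addCases with
  | left l =>
    refine ⟨(l : ℕ) / N + k, ?_, by positivity⟩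
    simp only [meijerParameters, profileMeijerB, Fin.append_left]
    push_cast
    ring
  | right l =>
    refine ⟨-((j + d) / (2 * N)) + ((l : ℕ) + 1) / M + k, ?_, ?_⟩
    · simp only [meijerParameters, profileMeijerB, Fin.append_right]
      push_cast
      ring
    · have h3 : (j + d) / (2 * N) ≤ 1 / M := by
        rw [div_le_div_iff₀ (by positivity) hM0]
        rw [← mul_div_assoc, lt_div_iff₀ hM0] at h1
        linarith
      have h4 : 1 / (M : ℝ) ≤ ((l : ℕ) + 1) / M := by
        refine div_le_div_of_nonneg_right ?_ hM0.le
        have : (0 : ℝ) ≤ (l : ℕ) := by positivity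
        linarith
      linarith

theorem admissible_meijerParameters_profile (hd : 1 ≤ d) (hj : 0 ≤ j) (hN : 1 ≤ N) (hM : 1 ≤ M)
    (h1 : j + d < 2 * ((N : ℝ) / M)) :
    (meijerParameters (profileMeijerA d j N M) ![] (profileMeijerB d j N M)
      (profileMeijerBs d N)).Admissible where
  A_pos _ := one_pos
  As_pos _ := one_pos
  B_pos _ := one_pos
  Bs_pos _ := one_pos
  disjoint := by
    rw [Set.disjoint_left]
    intro σ hl hr
    obtain ⟨x, rfl, hx⟩ := leftPoles_meijerParameters_profile hl
    obtain ⟨y, hxy, hy⟩ := rightPoles_meijerParameters_profile hN hM h1 hr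
    have := Complex.ofReal_injective hxy
    have hN0 : (0 : ℝ) < N := by exact_mod_cast hN
    have h3 : 0 < (j + d) / (2 * N) := by positivity
    linarith
  alpha_pos := by
    have hM0 : (0 : ℝ) < M := by exact_mod_cast hM
    simp only [FoxParameters.alpha, meijerParameters, Finset.sum_const, Finset.card_univ,
      Fintype.card_fin, nsmul_eq_mul, mul_one]
    push_cast
    linarith

theorem hasValuePos_meijerParameters_profile (hd : 1 ≤ d) (hj : 0 ≤ j) (hN : 1 ≤ N) (hM : 1 ≤ M)
    (h1 : j + d < 2 * ((N : ℝ) / M)) {r : ℝ} (hr : 0 < r) :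
    (meijerParameters (profileMeijerA d j N M) ![] (profileMeijerB d j N M)
      (profileMeijerBs d N)).HasValuePos ((r / (2 * N)) ^ (2 * N))
      ((2 ^ ((d : ℝ) / 2 + M - 1) * Real.pi ^ ((M : ℝ) - 1) * (N : ℝ) ^ ((d : ℝ) / 2) / M *
        radialProfile d j ((N : ℝ) / M) r : ℝ) : ℂ) := by
  have hd' : (1 : ℝ) ≤ d := by exact_mod_cast hd
  have hN0 : (0 : ℝ) < N := by exact_mod_cast hN
  have hM0 : (0 : ℝ) < M := by exact_mod_cast hM
  -- The Meijer variable `s` lives on `Re s = c/N`, so that `N s` runs along the line used for the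
  -- Fox function.
  set c : ℝ := -(1 / 4) with hc
  have hcl : -((j + d) / (2 * N)) < c / N := by
    rw [hc, ← div_div, ← neg_div]
    refine div_lt_div_of_pos_right ?_ hN0
    linarith
  have hcr : c / N < 0 := div_neg_of_neg_of_pos (by norm_num [hc]) hN0
  set z : ℝ := (r / (2 * N)) ^ (2 * N) with hz
  have hz0 : 0 < z := by positivity
  have h := (FoxParameters.hasValuePos_of_line (c := c / N)
    (admissible_meijerParameters_profile hd hj hN hM h1)
    (kernelDecays_meijerParameters_profile d j hN hM)
    (fun σ hσ => by
      obtain ⟨x, hx, hx'⟩ := leftPoles_meijerParameters_profile hσ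
      exact ⟨x, hx, hx'.trans_lt hcl⟩)
    (fun σ hσ => by
      obtain ⟨x, hx, hx'⟩ := rightPoles_meijerParameters_profile hN hM h1 hσ
      exact ⟨x, hx, hcr.trans_le hx'⟩) hz0).2
  set κ : ℝ := Real.pi ^ (M - 1) * 2 ^ (M - 1) * (N : ℝ) ^ ((d : ℝ) / 2) with hκ
  have hl : Real.log z = 2 * N * (Real.log (r / 2) - Real.log N) := by
    rw [hz, Real.log_pow, ← div_div, Real.log_div (by positivity) hN0.ne']
    push_cast
    ring
  have e : ∀ t : ℝ, (z : ℂ) ^ (((c / N : ℝ) : ℂ) + t * Complex.I) *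
      (meijerParameters (profileMeijerA d j N M) ![] (profileMeijerB d j N M)
      (profileMeijerBs d N)).kernel (((c / N : ℝ) : ℂ) + t * Complex.I) =
      (κ : ℂ) * ((((r / 2) ^ 2 : ℝ) : ℂ) ^ ((c : ℂ) + ((N * t : ℝ) : ℂ) * Complex.I) *
        profileKernel d j ((N : ℝ) / M) ((c : ℂ) + ((N * t : ℝ) : ℂ) * Complex.I)) := by
    intro t
    have e1 : (N : ℂ) * (((c / N : ℝ) : ℂ) + t * Complex.I) = c + ((N * t : ℝ) : ℂ) * Complex.I := by
      have : (N : ℂ) ≠ 0 := by exact_mod_cast hN0.ne'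
      push_cast
      field_simp
    have e2 : (z : ℂ) ^ (((c / N : ℝ) : ℂ) + t * Complex.I) =
        Complex.exp (2 * (Real.log (r / 2) - Real.log N) * (c + ((N * t : ℝ) : ℂ) * Complex.I)) := by
      rw [ofReal_cpow_eq_exp hz0, hl, ← e1]
      congr 1
      push_cast
      ring
    rw [kernel_meijerParameters_profile d j hN hM, ← hκ, e1, e2, ofReal_cpow_eq_exp (by positivity),
      Real.log_pow]
    have e3 : Complex.exp (((2 : ℕ) * Real.log (r / 2) : ℝ) * (c + ((N * t : ℝ) : ℂ) * Complex.I)) =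
        Complex.exp (2 * (Real.log (r / 2) - Real.log N) * (c + ((N * t : ℝ) : ℂ) * Complex.I)) *
        Complex.exp ((2 * Real.log N : ℝ) * (c + ((N * t : ℝ) : ℂ) * Complex.I)) := by
      rw [← Complex.exp_add]
      congr 1
      push_cast
      ring
    rw [e3]
    ring
  simp_rw [e] at h
  -- The substitution `t ↦ N t` has Jacobian `1/N`, which together with the factor `n = N/M` of the
  -- Fox formula gives `1/M`.
  rw [integral_const_mul, Measure.integral_comp_mul_left (fun t : ℝ => (((r / 2) ^ 2 : ℝ) : ℂ) ^
    ((c : ℂ) + (t : ℂ) * Complex.I) * profileKernel d j ((N : ℝ) / M) ((c : ℂ) + (t : ℂ) * Complex.I)),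
    integral_profileKernel_line hd (div_pos hN0 hM0) hj h1 (by norm_num [hc]) (by linarith) hr,
    abs_of_pos (inv_pos.2 hN0)] at h
  have hp := Real.pi_pos
  have e4 : (2 : ℝ) ^ ((d : ℝ) / 2 + M - 1) = 2 ^ ((d : ℝ) / 2) * 2 ^ (M - 1) := by
    rw [add_sub_assoc, Real.rpow_add two_pos, ← Real.rpow_natCast 2 (M - 1), Nat.cast_sub hM, Nat.cast_one]
  have e5 : Real.pi ^ ((M : ℝ) - 1) = Real.pi ^ (M - 1) := by
    rw [← Real.rpow_natCast Real.pi (M - 1), Nat.cast_sub hM, Nat.cast_one]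
  rw [e4, e5]
  refine (congrArg (FoxParameters.HasValuePos _ z) ?_).mp h
  rw [Complex.real_smul, ← Complex.ofReal_mul, ← Complex.ofReal_mul]
  have e6 : (1 / (2 * (Real.pi : ℂ))) = ((1 / (2 * Real.pi) : ℝ) : ℂ) := by push_cast; rfl
  rw [e6, ← Complex.ofReal_mul, hκ]
  congr 1
  field_simp

theorem hasMeijerG_profile (hd : 1 ≤ d) (hj : 0 ≤ j) (hN : 1 ≤ N) (hM : 1 ≤ M)
    (h1 : j + d < 2 * ((N : ℝ) / M)) {r : ℝ} (hr : 0 ≤ r) :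
    HasMeijerG (profileMeijerA d j N M) ![] (profileMeijerB d j N M) (profileMeijerBs d N)
      ((r / (2 * N)) ^ (2 * N))
      ((2 ^ ((d : ℝ) / 2 + M - 1) * Real.pi ^ ((M : ℝ) - 1) * (N : ℝ) ^ ((d : ℝ) / 2) / M *
        radialProfile d j ((N : ℝ) / M) r : ℝ) : ℂ) := by
  have hN0 : (0 : ℝ) < N := by exact_mod_cast hN
  have hM0 : (0 : ℝ) < M := by exact_mod_cast hM
  have hne : 2 * N ≠ 0 := by omega
  have h2N : (2 * (N : ℝ)) ≠ 0 := by positivity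
  -- `2N x^(1/(2N))` inverts `x = (r/(2N))^(2N)`, again to reduce `z = 0` to continuity of the
  -- profile.
  have hinv : ∀ x : ℝ, 0 ≤ x → (2 * N * x ^ (((2 * N : ℕ) : ℝ)⁻¹) / (2 * N)) ^ (2 * N) = x := by
    intro x hx
    rw [mul_div_cancel_left₀ _ h2N, Real.rpow_inv_natCast_pow hx hne]
  have h := FoxParameters.hasFoxH_of_continuousOn
    (P := meijerParameters (profileMeijerA d j N M) ![] (profileMeijerB d j N M) (profileMeijerBs d N))
    (continuousOn_radialProfile hd (div_pos hN0 hM0) hj h1)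
    (u := fun x => 2 * N * x ^ (((2 * N : ℕ) : ℝ)⁻¹))
    (continuous_const.mul (Real.continuous_rpow_const (by positivity)))
    (by rw [Real.zero_rpow (by positivity), mul_zero]) (fun x hx => by positivity)
    (2 ^ ((d : ℝ) / 2 + M - 1) * Real.pi ^ ((M : ℝ) - 1) * (N : ℝ) ^ ((d : ℝ) / 2) / M) (fun x hx => by
      have := hasValuePos_meijerParameters_profile hd hj hN hM h1
        (r := 2 * N * x ^ (((2 * N : ℕ) : ℝ)⁻¹)) (by positivity)
      rwa [hinv x hx.le] at this)
    (x := (r / (2 * N)) ^ (2 * N)) (by positivity)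
  beta_reduce at h
  rwa [Real.pow_rpow_inv_natCast (by positivity) hne, mul_div_cancel₀ _ h2N] at h

end Meijer

/-! ### The theorem -/

theorem proposition5p9 (d : ℕ) (hd : 1 ≤ d) (j n : ℝ) (hn : 0 < n) (hj : 0 ≤ j)
    (hθ : j / n + d / (2 * n) < 1) :
    -- the Sobolev inequality and its sharp constant
    IsSharpSobolevConstant d j n (sharpSobolevValue d j n) ∧
    -- the maximizer, an inverse Fourier transform of an integrable function
    Integrable (maximizerSymbol d j n) ∧
    (∃ f : Lp ℂ 2 (volume : Measure (RSpace d)), f =ᵐ[volume] maximizerFun d j n ∧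
      IsSobolevMaximizer d j n (sharpSobolevValue d j n) f) ∧
    (∃ f : C₀(RSpace d, ℂ), ∀ x, f x = maximizerFun d j n x) ∧
    -- the Bessel representation
    (∀ x : RSpace d, maximizerFun d j n x = ((radialProfile d j n ‖x‖ : ℝ) : ℂ)) ∧
    ContinuousOn (radialProfile d j n) (Ici 0) ∧
    (∀ ρ : ℝ, 0 < ρ → IntegrableOn (besselIntegrand d j n ρ) (Ioi 0)) ∧
    -- the representation by a Fox function
    (∀ ρ : ℝ, 0 ≤ ρ → ∃ H : ℂ, (profileFoxParameters d j n).HasFoxH ((ρ / 2) ^ 2) H ∧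
      ((radialProfile d j n ρ : ℝ) : ℂ) =
        ((1 / ((2 : ℝ) ^ ((d : ℝ) / 2) * n) : ℝ) : ℂ) * H) ∧
    -- the representation by a Meijer function
    (∀ N M : ℕ, 1 ≤ N → 1 ≤ M → n = (N : ℝ) / M →
      ∀ ρ : ℝ, 0 ≤ ρ → ∃ G : ℂ,
        HasMeijerG (profileMeijerA d j N M) ![] (profileMeijerB d j N M) (profileMeijerBs d N)
          ((ρ / (2 * N)) ^ (2 * N)) G ∧
        ((radialProfile d j n ρ : ℝ) : ℂ) =
          ((M / ((2 : ℝ) ^ ((d : ℝ) / 2 + M - 1) * Real.pi ^ ((M : ℝ) - 1) *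
            (N : ℝ) ^ ((d : ℝ) / 2)) : ℝ) : ℂ) * G) := by
  -- The condition `θ < 1` is exactly what makes `sobolevWeight` integrable. As `j ≥ 0`, it implies
  -- `j + d < 2n`, the condition for the maximizer's symbol.
  have hW : 2 * j + d < 2 * n := by
    have e : j / n + d / (2 * n) = (2 * j + d) / (2 * n) := by field_simp
    rwa [e, div_lt_one (by positivity)] at hθ
  have h1 : j + d < 2 * n := by linarith
  have hm := integrable_maximizerSymbol hd hn hj h1
  have hp := Real.pi_pos
  rw [← sqrt_integral_sobolevWeight hd hn hj hW]
  have hwi := integrable_sobolevWeight hd hn hj hW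
  have hwp := integral_sobolevWeight_pos hd hn hj hW
  refine ⟨isSharpSobolevConstant_sqrt_integral hd hj hn hwi hwp hm, hm,
    exists_isSobolevMaximizer hj hn hwi hwp hm, exists_C0_maximizerFun hd hn hj h1,
    maximizerFun_eq_radialProfile hd hn hj h1, continuousOn_radialProfile hd hn hj h1,
    fun ρ hρ => integrableOn_besselIntegrand hd hn hj h1 hρ,
    fun ρ hρ => ⟨_, hasFoxH_profileFoxParameters hd hn hj h1 hρ, ?_⟩, ?_⟩
  · rw [← Complex.ofReal_mul]
    congr 1
    field_simp
  · rintro N M hN hM rfl ρ hρ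
    have hN0 : (0 : ℝ) < N := by exact_mod_cast hN
    have hM0 : (0 : ℝ) < M := by exact_mod_cast hM
    refine ⟨_, hasMeijerG_profile hd hj hN hM h1 hρ, ?_⟩
    rw [← Complex.ofReal_mul]
    congr 1
    field_simp
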